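/- A stable flow instance with forced and forbidden edges consists of a finite directed graph $D$ with $n$ vertices and $m$ edges (parallel edges and loops allowed), a set $S$ of terminal vertices, capacities $c:E(D)\to\mathbb{R}_{>0}$, for every vertex $v\notin S$ a strict ranking of its outgoing edges and a strict ranking of its incoming edges, and bounds $\ell,u:E(D)\to\mathbb{R}_{\ge 0}$ (an edge $e$ is forced if $\ell(e)>0$ and forbidden if $u(e)<c(e)$). A flow is a function $f:E(D)\to\mathbb{R}_{\ge 0}$ with $f\le c$ such that at every vertex outside $S$ the total flow on incoming edges equals the total flow on outgoing edges. A blocking walk of $f$ is a directed walk $v_1,e_1,v_2,\dots,e_{k-1},v_k$ with $k\ge 2$ such that (1) $f(e_i)<c(e_i)$ for all $i$; (2) $v_1\in S$, or $v_1$ prefers $e_1$ to some outgoing edge $e'$ of $v_1$ with $f(e')>0$; (3) $v_k\in S$, or $v_k$ prefers $e_{k-1}$ to some incoming edge $e''$ of $v_k$ with $f(e'')>0$. A flow is stable if it has no blocking walk. Theorem. There is an algorithm which, given any such instance, either finds a stable flow $f$ with $\ell(e)\le f(e)\le u(e)$ for all $e\in E(D)$, or correctly reports that no such flow exists, and which runs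 in $O(m^2\log n)$ time. That is, there are a fixed program and a constant $C$ such that the program halts on every instance after at most $C\cdot\max(m,1)^2\cdot\log\max(n,2)$ steps with such an answer. Time is counted on a unit-cost random access machine with registers and arrays for natural numbers (which can be incremented, decremented, compared and used as array indices) and for real numbers (which can be added, subtracted and compared). The input consists of arrays holding the tails, heads, preference ranks, capacities and bounds of the edges and the indicator of $S$. -/

import Mathlib

noncomputable section

namespace StableFlow

/-! ## Networks with preferences, stable flows, forced and forbidden edges -/

/-- A stable flow instance with forced and forbidden edges, on the vertex set `Fin n` and the edge
set `Fin m`. Parallel edges and loops are allowed. The out-edges of a nonterminal vertex `v` are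
ranked strictly by `outRank`, its in-edges by `inRank`; a smaller rank means more preferred.
The ranks of edges at terminal vertices play no role. An edge `e` is forced if `0 < lower e` and
forbidden if `upper e < cap e`. -/
structure Network (n m : ℕ) where
  tail : Fin m → Fin n
  head : Fin m → Fin n
  terminal : Fin n → Bool
  outRank : Fin m → ℕ
  inRank : Fin m → ℕ
  cap : Fin m → ℝ
  lower : Fin m → ℝ
  upper : Fin m → ℝ
  outRank_strict : ∀ e e', tail e = tail e' → terminal (tail e) = false →
    outRank e = outRank e' → e = e'
  inRank_strict : ∀ e e', head e = head e' → terminal (head e) = false →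
    inRank e = inRank e' → e = e'
  cap_pos : ∀ e, 0 < cap e
  lower_nonneg : ∀ e, 0 ≤ lower e
  upper_nonneg : ∀ e, 0 ≤ upper e

namespace Network

variable {n m : ℕ}

/-- Feasible flows: nonnegative, below the capacities, and conserved at nonterminal vertices. -/
structure IsFlow (I : Network n m) (f : Fin m → ℝ) : Prop where
  nonneg : ∀ e, 0 ≤ f e
  le_cap : ∀ e, f e ≤ I.cap e
  kirchhoff : ∀ v, I.terminal v = false →
    (∑ e with I.head e = v, f e) = ∑ e with I.tail e = v, f e

/-- `I.DominatesAtStart f e`: the tail of `e` is a terminal, or it sends positive flow along some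
out-edge to which it prefers `e`. -/
def DominatesAtStart (I : Network n m) (f : Fin m → ℝ) (e : Fin m) : Prop :=
  I.terminal (I.tail e) = true ∨
    ∃ e', I.tail e' = I.tail e ∧ 0 < f e' ∧ I.outRank e < I.outRank e'

/-- `I.DominatesAtEnd f e`: the head of `e` is a terminal, or it receives positive flow along some
in-edge to which it prefers `e`. -/
def DominatesAtEnd (I : Network n m) (f : Fin m → ℝ) (e : Fin m) : Prop :=
  I.terminal (I.head e) = true ∨
    ∃ e', I.head e' = I.head e ∧ 0 < f e' ∧ I.inRank e < I.inRank e'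

/-- A blocking walk, given as the nonempty list of its edges: consecutive edges fit together,
all edges are unsaturated, and the walk dominates the flow at both of its ends. -/
structure IsBlockingWalk (I : Network n m) (f : Fin m → ℝ) (W : List (Fin m)) : Prop where
  ne_nil : W ≠ []
  isWalk : W.IsChain (fun e e' => I.head e = I.tail e')
  unsaturated : ∀ e ∈ W, f e < I.cap e
  start : I.DominatesAtStart f (W.head ne_nil)
  finish : I.DominatesAtEnd f (W.getLast ne_nil)

/-- A stable flow: a feasible flow without blocking walks. -/
def IsStableFlow (I : Network n m) (f : Fin m → ℝ) : Prop :=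
  I.IsFlow f ∧ ¬ ∃ W, I.IsBlockingWalk f W

/-- A stable flow with forced and forbidden edges: a stable flow respecting the lower and the
upper bounds. -/
def IsRestrictedStableFlow (I : Network n m) (f : Fin m → ℝ) : Prop :=
  I.IsStableFlow f ∧ (∀ e, I.lower e ≤ f e) ∧ (∀ e, f e ≤ I.upper e)

end Network

/-! ## The machine model

A unit-cost random access machine with registers and arrays (indexed by `ℕ`, of unbounded length)
for natural numbers and for real numbers. Natural numbers can be incremented, decremented, compared
and used as array indices, so that they never exceed the largest number in the input or the program
by more than the running time. Real numbers can be added, subtracted and compared. Every elementary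
operation and every test takes one step. Programs are finite and do not depend on the input. -/

/-- Memory: registers and arrays. -/
structure Store where
  natReg : ℕ → ℕ
  realReg : ℕ → ℝ
  natArr : ℕ → ℕ → ℕ
  realArr : ℕ → ℕ → ℝ

/-- Elementary operations. The arguments named `d`, `a`, `b`, `i` are register numbers, `A` is the
number of an array. -/
inductive Op where
  | natConst (d k : ℕ)
  | natCopy (d a : ℕ)
  | natSucc (d : ℕ)
  | natPred (d : ℕ)
  | natLoad (d A i : ℕ)
  | natStore (A i a : ℕ)
  | realZero (d : ℕ)
  | realCopy (d a : ℕ)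
  | realAdd (d a b : ℕ)
  | realSub (d a b : ℕ)
  | realLoad (d A i : ℕ)
  | realStore (A i a : ℕ)

/-- The effect of an elementary operation on the memory. -/
def Op.apply (σ : Store) : Op → Store
  | .natConst d k => { σ with natReg := Function.update σ.natReg d k }
  | .natCopy d a => { σ with natReg := Function.update σ.natReg d (σ.natReg a) }
  | .natSucc d => { σ with natReg := Function.update σ.natReg d (σ.natReg d + 1) }
  | .natPred d => { σ with natReg := Function.update σ.natReg d (σ.natReg d - 1) }
  | .natLoad d A i =>
      { σ with natReg := Function.update σ.natReg d (σ.natArr A (σ.natReg i)) }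
  | .natStore A i a =>
      { σ with
          natArr := Function.update σ.natArr A
            (Function.update (σ.natArr A) (σ.natReg i) (σ.natReg a)) }
  | .realZero d => { σ with realReg := Function.update σ.realReg d 0 }
  | .realCopy d a => { σ with realReg := Function.update σ.realReg d (σ.realReg a) }
  | .realAdd d a b =>
      { σ with realReg := Function.update σ.realReg d (σ.realReg a + σ.realReg b) }
  | .realSub d a b =>
      { σ with realReg := Function.update σ.realReg d (σ.realReg a - σ.realReg b) }
  | .realLoad d A i =>
      { σ with realReg := Function.update σ.realReg d (σ.realArr A (σ.natReg i)) }
  | .realStore A i a =>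
      { σ with
          realArr := Function.update σ.realArr A
            (Function.update (σ.realArr A) (σ.natReg i) (σ.realReg a)) }

/-- Tests: comparisons of two registers. -/
inductive Test where
  | natLt (a b : ℕ)
  | natLe (a b : ℕ)
  | natEq (a b : ℕ)
  | natNe (a b : ℕ)
  | realLt (a b : ℕ)
  | realLe (a b : ℕ)

/-- The test `b` succeeds in the memory state `σ`. -/
def Test.Holds (σ : Store) : Test → Prop
  | .natLt a b => σ.natReg a < σ.natReg b
  | .natLe a b => σ.natReg a ≤ σ.natReg b
  | .natEq a b => σ.natReg a = σ.natReg b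
  | .natNe a b => σ.natReg a ≠ σ.natReg b
  | .realLt a b => σ.realReg a < σ.realReg b
  | .realLe a b => σ.realReg a ≤ σ.realReg b

/-- Programs. -/
inductive Program where
  | skip
  | op (o : Op)
  | seq (p q : Program)
  | branch (b : Test) (p q : Program)
  | loop (b : Test) (p : Program)

/-- `Exec p σ t τ`: started in memory state `σ`, the program `p` halts after exactly `t` steps in
memory state `τ`. (`loop b p` repeats `p` as long as `b` holds.) -/
inductive Exec : Program → Store → ℕ → Store → Prop where
  | skip (σ : Store) : Exec .skip σ 0 σ
  | op (o : Op) (σ : Store) : Exec (.op o) σ 1 (o.apply σ)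
  | seq {p q : Program} {σ τ υ : Store} {s t : ℕ} (hp : Exec p σ s τ) (hq : Exec q τ t υ) :
      Exec (.seq p q) σ (s + t) υ
  | branch_true {b : Test} {p q : Program} {σ τ : Store} {t : ℕ} (hb : b.Holds σ)
      (h : Exec p σ t τ) : Exec (.branch b p q) σ (t + 1) τ
  | branch_false {b : Test} {p q : Program} {σ τ : Store} {t : ℕ} (hb : ¬ b.Holds σ)
      (h : Exec q σ t τ) : Exec (.branch b p q) σ (t + 1) τ
  | loop_stop {b : Test} {p : Program} {σ : Store} (hb : ¬ b.Holds σ) :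
      Exec (.loop b p) σ 1 σ
  | loop_step {b : Test} {p : Program} {σ τ υ : Store} {s t : ℕ} (hb : b.Holds σ)
      (hp : Exec p σ s τ) (hl : Exec (.loop b p) τ t υ) : Exec (.loop b p) σ (s + t + 1) υ

/-- The machine is deterministic: running time and result are determined by the input. -/
theorem Exec.unique {p : Program} {σ τ : Store} {t : ℕ} (h : Exec p σ t τ) :
    ∀ {t' : ℕ} {τ' : Store}, Exec p σ t' τ' → t' = t ∧ τ' = τ := by
  induction h with
  | skip σ => intro t' τ' h'; cases h'; exact ⟨rfl, rfl⟩
  | op o σ => intro t' τ' h'; cases h'; exact ⟨rfl, rfl⟩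
  | seq _ _ ih1 ih2 =>
    intro t' τ' h'
    cases h' with
    | seq h1 h2 =>
      obtain ⟨rfl, rfl⟩ := ih1 h1
      obtain ⟨rfl, rfl⟩ := ih2 h2
      exact ⟨rfl, rfl⟩
  | branch_true hb _ ih =>
    intro t' τ' h'
    cases h' with
    | branch_true _ h1 => obtain ⟨rfl, rfl⟩ := ih h1; exact ⟨rfl, rfl⟩
    | branch_false hb' _ => exact absurd hb hb'
  | branch_false hb _ ih =>
    intro t' τ' h'
    cases h' with
    | branch_true hb' _ => exact absurd hb' hb
    | branch_false _ h1 => obtain ⟨rfl, rfl⟩ := ih h1; exact ⟨rfl, rfl⟩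
  | loop_stop hb =>
    intro t' τ' h'
    cases h' with
    | loop_stop _ => exact ⟨rfl, rfl⟩
    | loop_step hb' _ _ => exact absurd hb' hb
  | loop_step hb _ _ ih1 ih2 =>
    intro t' τ' h'
    cases h' with
    | loop_stop hb' => exact absurd hb hb'
    | loop_step _ h1 h2 =>
      obtain ⟨rfl, rfl⟩ := ih1 h1
      obtain ⟨rfl, rfl⟩ := ih2 h2
      exact ⟨rfl, rfl⟩

/-! ## Input and output -/

/-- The array whose first `k` entries are given by `f`, all others being zero. -/
def arrayOf {α : Type} [Zero α] {k : ℕ} (f : Fin k → α) : ℕ → α :=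
  fun i => if h : i < k then f ⟨i, h⟩ else 0

/-- The initial memory: `n` and `m` in the natural-number registers `0` and `1`; tails, heads,
out-ranks and in-ranks of the edges in the natural-number arrays `0`, `1`, `2`, `3`; the indicator of
the set of terminal vertices in the natural-number array `4`; capacities, lower bounds and upper
bounds of the edges in the real arrays `0`, `1`, `2`; zeros everywhere else. -/
def Network.input {n m : ℕ} (I : Network n m) : Store where
  natReg
    | 0 => n
    | 1 => m
    | _ => 0
  realReg _ := 0
  natArr
    | 0 => arrayOf (fun e => (I.tail e : ℕ))
    | 1 => arrayOf (fun e => (I.head e : ℕ))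
    | 2 => arrayOf I.outRank
    | 3 => arrayOf I.inRank
    | 4 => arrayOf (fun v => if I.terminal v = true then 1 else 0)
    | _ => fun _ => 0
  realArr
    | 0 => arrayOf I.cap
    | 1 => arrayOf I.lower
    | 2 => arrayOf I.upper
    | _ => fun _ => 0

/-- The answer (`1`: a flow was found, `0`: there is none) is read off the natural-number
register `0`. -/
def Store.answer (σ : Store) : ℕ := σ.natReg 0

/-- The computed flow is read off the first `m` entries of the real array `0`. -/
def Store.flow (σ : Store) (m : ℕ) : Fin m → ℝ := fun e => σ.realArr 0 e

/-- On the instance `I`, the program `p` halts after `t` steps with a correct result: either it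
outputs a stable flow respecting all bounds, or it reports that there is none, and there is none. -/
def Solves (p : Program) {n m : ℕ} (I : Network n m) (t : ℕ) : Prop :=
  ∃ σ : Store, Exec p I.input t σ ∧
    ((σ.answer = 1 ∧ I.IsRestrictedStableFlow (σ.flow m)) ∨
      (σ.answer = 0 ∧ ¬ ∃ f : Fin m → ℝ, I.IsRestrictedStableFlow f))

end StableFlow

end

/-! All terminals are merged into one vertex, the hub, and every edge `e` is cut into five arcs
(`Network.split`). The optional part, of capacity `ub e - lower e`, stays an arc from tail to head.
The forced part becomes an arc from the tail to the hub and another from the hub to the head, each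
of capacity `lower e`. The forbidden part becomes an excess arc from the tail to the hub and a
mirror arc from the hub to the head; the mirror stays closed until positive flow on the excess arc
has shown that the tail wants more than `ub e`. The bounds thus turn into conditions on arcs at the
hub: forced parts full, excess and mirror arcs empty (`Network.Accepted`).

On this network a Gale-Shapley procedure runs. Its state is a circulation `f` and a set `R` of
rejected arcs. A vertex other than the hub without available out-arcs rejects its worst candidate
in-arc, and an excess arc with flow is put into `R`, which opens its mirror. When nothing is left to
reject, additional flow is followed from the hub: a vertex passes it on along its best available
out-arc or, lacking one, returns it along its worst rejected in-arc with flow. The walk runs into a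
cycle, and as much as possible is pushed around that cycle. The procedure stops when the hub has
neither an available out-arc nor a rejected excess arc with flow.

Soundness (`isRestrictedStableFlow_merge`): by `Inv`, the first edge of a blocking walk would be
rejected by its head, rejection would propagate along the walk, and the head of a rejected last edge
is no terminal and receives nothing on worse in-edges.

Completeness compares the state with an arbitrary solution `g`, lifted to a circulation `G`. An edge
is wanted if it begins an unsaturated walk that dominates `g` at its end; by stability, the tail of
a wanted edge is no terminal and sends nothing along worse edges. `Witness` records the consequences
for arcs. The relation `Compat`, whose core is `G ≤ f` on rejected arcs, survives rejections
(`le_of_worst`, `Compat.insert_excess`) and pushes (`Compat.pushed`, through `lt_of_back`). The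
common tool is `exists_closed`, which applies conservation to `f - G` on the set of tails of wanted
arcs with surplus. In a final state `eq_at_hub` gives `f = G` on all arcs at the hub, so a
circulation that is not accepted excludes every solution.

A potential of at most three per arc drops in every phase but the last, and a phase scans the arcs a
bounded number of times. The time is therefore `O(m²)`; the factor `log n` is only slack. -/

noncomputable section

namespace StableFlow

open Finset

/-! ## Circulations with preferences -/

/-- A digraph with arcs `1, …, size` and a distinguished vertex `hub`, which plays the role of all
terminals. Some arcs into the hub are *excess* arcs; an excess arc `a` has the *mirror* arc `a + 1`,
which leaves the hub. -/
structure ArcNet where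
  size : ℕ
  hub : ℕ
  tl : ℕ → ℕ
  hd : ℕ → ℕ
  outR : ℕ → ℕ
  inR : ℕ → ℕ
  cap : ℕ → ℝ
  IsExcess : ℕ → Prop
  cap_nonneg : ∀ a ∈ Icc 1 size, 0 ≤ cap a
  excess_mem : ∀ a, IsExcess a → a ∈ Icc 1 size
  excess_hd : ∀ a, IsExcess a → hd a = hub
  mirror_tl : ∀ a, IsExcess a → tl (a + 1) = hub
  mirror_not_excess : ∀ a, IsExcess a → ¬ IsExcess (a + 1)
  mirror_cap : ∀ a, IsExcess a → cap (a + 1) = cap a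

namespace ArcNet

variable (T : ArcNet)

/-- The set of arcs. -/
def arcs : Finset ℕ := Icc 1 T.size

/-- Preference at the tail, ties broken by the numbering. -/
def OutBetter (a b : ℕ) : Prop := T.outR a < T.outR b ∨ (T.outR a = T.outR b ∧ a < b)

/-- Preference at the head, ties broken by the numbering. -/
def InBetter (a b : ℕ) : Prop := T.inR a < T.inR b ∨ (T.inR a = T.inR b ∧ a < b)

open Classical in
/-- Current capacities: a mirror arc is closed until its excess arc has been rejected. -/
def dcap (R : Set ℕ) (a : ℕ) : ℝ := if T.IsExcess (a - 1) ∧ a - 1 ∉ R then 0 else T.cap a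

/-- Arcs along which the flow may be increased. -/
def Avail (f : ℕ → ℝ) (R : Set ℕ) (a : ℕ) : Prop := a ∉ R ∧ f a < T.dcap R a

/-- Arcs at which flow may be refused by their heads. -/
def Cand (f : ℕ → ℝ) (R : Set ℕ) (a : ℕ) : Prop :=
  (a ∉ R ∧ T.hd a ≠ T.hub) ∨ (a ∈ R ∧ 0 < f a)

/-- Inflow minus outflow. -/
def net (f : ℕ → ℝ) (v : ℕ) : ℝ :=
  ∑ a ∈ T.arcs, ((if T.hd a = v then f a else 0) - (if T.tl a = v then f a else 0))

/-- The invariants of the algorithm: `f` is a circulation and `R` is the set of rejected arcs. -/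
structure Inv (f : ℕ → ℝ) (R : Set ℕ) : Prop where
  nonneg : ∀ a ∈ T.arcs, 0 ≤ f a
  le_dcap : ∀ a ∈ T.arcs, f a ≤ T.dcap R a
  circ : ∀ v, T.net f v = 0
  rej_hd : ∀ a ∈ T.arcs, a ∈ R → ¬ T.IsExcess a → T.hd a ≠ T.hub
  rej_out : ∀ a ∈ T.arcs, a ∈ R → ¬ T.IsExcess a → ∀ b ∈ T.arcs, T.tl b = T.hd a →
    ¬ T.Avail f R b
  rej_in : ∀ a ∈ T.arcs, a ∈ R → ¬ T.IsExcess a → ∀ b ∈ T.arcs, T.hd b = T.hd a →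
    T.InBetter a b → b ∈ R ∧ f b = 0
  prop : ∀ a ∈ T.arcs, ∀ b ∈ T.arcs, T.tl b = T.tl a → T.tl a ≠ T.hub → 0 < f a →
    T.OutBetter b a → ¬ T.Avail f R b

/-- What is known about a circulation `G` that comes from a stable flow respecting the bounds. `D` is
the set of arcs that begin a walk which would block if the first tail agreed; `act` is the set of
those excess arcs that the head of the underlying edge is not interested in. -/
structure Witness (G : ℕ → ℝ) (D act : Set ℕ) : Prop where
  nonneg : ∀ a ∈ T.arcs, 0 ≤ G a
  le_cap : ∀ a ∈ T.arcs, G a ≤ T.cap a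
  circ : ∀ v, v ≠ T.hub → T.net G v = 0
  excess : ∀ a, T.IsExcess a → G a = 0
  mirror : ∀ a, T.IsExcess a → G (a + 1) = 0
  start : ∀ a ∈ T.arcs, a ∈ D → T.tl a ≠ T.hub ∧
    ∀ b ∈ T.arcs, T.tl b = T.tl a → T.OutBetter a b → G b = 0
  extend : ∀ a ∈ T.arcs, G a < T.cap a → T.hd a ≠ T.hub → (T.IsExcess (a - 1) → a - 1 ∈ act) →
    ∀ b ∈ T.arcs, b ∈ D → T.tl b = T.hd a → a ∈ D
  dominate : ∀ a ∈ T.arcs, G a < T.cap a → T.hd a ≠ T.hub → (T.IsExcess (a - 1) → a - 1 ∈ act) →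
    ∀ b ∈ T.arcs, T.hd b = T.hd a → T.InBetter a b → 0 < G b → a ∈ D
  hub : ∀ a ∈ T.arcs, G a < T.cap a → T.hd a = T.hub →
    (T.IsExcess (a - 1) → a - 1 ∈ act) → ¬ (T.IsExcess a ∧ a ∈ act) → a ∈ D

/-- The state of the algorithm has not yet moved past `G`. -/
structure Compat (G : ℕ → ℝ) (act : Set ℕ) (f : ℕ → ℝ) (R : Set ℕ) : Prop where
  le : ∀ a ∈ T.arcs, a ∈ R → G a ≤ f a
  act : ∀ a, T.IsExcess a → a ∈ R → a ∈ act

variable {T}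

lemma outBetter_trichotomy {a b : ℕ} (h : a ≠ b) : T.OutBetter a b ∨ T.OutBetter b a := by
  unfold OutBetter; omega

lemma dcap_le_cap {R : Set ℕ} {a : ℕ} (ha : a ∈ T.arcs) : T.dcap R a ≤ T.cap a := by
  unfold dcap; split_ifs
  · exact T.cap_nonneg a ha
  · exact le_rfl

lemma net_sub (f g : ℕ → ℝ) (v : ℕ) : T.net (fun a => f a - g a) v = T.net f v - T.net g v := by
  unfold net; rw [← Finset.sum_sub_distrib]
  refine Finset.sum_congr rfl fun a _ => ?_
  split_ifs <;> ring

/-- If a vertex conserves `h` and `h` is nonnegative on its out-arcs, then a positive out-arc or a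
negative in-arc entails a positive in-arc. -/
lemma exists_pos_in {h : ℕ → ℝ} {v : ℕ} (hv : T.net h v = 0)
    (hout : ∀ b ∈ T.arcs, T.tl b = v → 0 ≤ h b)
    (hx : (∃ b ∈ T.arcs, T.tl b = v ∧ 0 < h b) ∨ ∃ b ∈ T.arcs, T.hd b = v ∧ h b < 0) :
    ∃ e ∈ T.arcs, T.hd e = v ∧ 0 < h e := by
  by_contra hcon
  push Not at hcon
  have hle : ∀ a ∈ T.arcs,
      ((if T.hd a = v then h a else 0) - (if T.tl a = v then h a else 0)) ≤ 0 := by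
    intro a ha
    have h1 := hcon a ha
    have h2 := hout a ha
    split_ifs with h3 h4 h4
    · linarith
    · linarith [h1 h3]
    · linarith [h2 h4]
    · linarith
  have hz := (Finset.sum_eq_zero_iff_of_nonpos hle).1 hv
  rcases hx with ⟨b, hb, htb, hpos⟩ | ⟨b, hb, htb, hneg⟩
  · have h1 := hz b hb
    rw [if_pos htb] at h1
    split_ifs at h1 with h3
    · linarith [hcon b hb h3]
    · linarith
  · have h1 := hz b hb
    rw [if_pos htb] at h1
    split_ifs at h1 with h3
    · linarith [hout b hb h3]
    · linarith

/-- Conservation across the boundary of a vertex set. -/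
lemma boundary_eq_zero {h : ℕ → ℝ} {X : Finset ℕ} (hX : ∀ v ∈ X, T.net h v = 0)
    (hin : ∀ a ∈ T.arcs, T.hd a ∈ X → T.tl a ∉ X → h a ≤ 0)
    (hout : ∀ a ∈ T.arcs, T.tl a ∈ X → T.hd a ∉ X → 0 ≤ h a) :
    ∀ a ∈ T.arcs, ¬ (T.hd a ∈ X ↔ T.tl a ∈ X) → h a = 0 := by
  have hsum : ∑ a ∈ T.arcs, ((if T.hd a ∈ X then h a else 0) - (if T.tl a ∈ X then h a else 0))
      = 0 := by
    have : ∑ v ∈ X, T.net h v = 0 := Finset.sum_eq_zero hX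
    unfold net at this
    rw [Finset.sum_comm] at this
    refine (Finset.sum_congr rfl fun a _ => ?_).trans this
    rw [Finset.sum_sub_distrib, Finset.sum_ite_eq, Finset.sum_ite_eq]
  have hle : ∀ a ∈ T.arcs,
      ((if T.hd a ∈ X then h a else 0) - (if T.tl a ∈ X then h a else 0)) ≤ 0 := by
    intro a ha
    have h1 := hin a ha
    have h2 := hout a ha
    split_ifs with h3 h4 h4
    · linarith
    · linarith [h1 h3 h4]
    · linarith [h2 h4 h3]
    · linarith
  have hz := (Finset.sum_eq_zero_iff_of_nonpos hle).1 hsum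
  intro a ha hiff
  have h1 := hz a ha
  split_ifs at h1 with h3 h4 h4
  · exact absurd (iff_of_true h3 h4) hiff
  · linarith
  · linarith
  · exact absurd (iff_of_false h3 h4) hiff

/-! ### Comparing the state of the algorithm with a witness. -/

section Optimality

variable {G f : ℕ → ℝ} {D act R : Set ℕ}

/-- There are three reasons for being unavailable: rejection, where compatibility applies;
saturation; or being a closed mirror arc, where `G` vanishes as on all mirror arcs. This is how the
state yields upper bounds on `G`. -/
lemma le_of_not_avail (hI : T.Inv f R) (hW : T.Witness G D act) (hJ : T.Compat G act f R) {b : ℕ}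
    (hb : b ∈ T.arcs) (h : ¬ T.Avail f R b) : G b ≤ f b := by
  by_cases hR : b ∈ R
  · exact hJ.le b hb hR
  · have h1 : T.dcap R b ≤ f b := by
      by_contra h2
      exact h ⟨hR, not_le.1 h2⟩
    unfold dcap at h1
    split_ifs at h1 with h2
    · have := hW.mirror _ h2.1
      have h3 := T.excess_mem _ h2.1
      rw [Finset.mem_Icc] at h3
      rw [Nat.sub_add_cancel (by omega)] at this
      rw [this]; exact hI.nonneg b hb
    · exact (hW.le_cap b hb).trans h1

/-- Positive current capacity excludes a closed mirror arc. This discharges the side condition on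
mirror arcs in `Witness`. -/
lemma open_of_lt (hJ : T.Compat G act f R) {b : ℕ}
    (h : 0 < T.dcap R b) : T.IsExcess (b - 1) → b - 1 ∈ act := by
  intro he
  by_cases hR : b - 1 ∈ R
  · exact hJ.act _ he hR
  · unfold dcap at h
    rw [if_pos ⟨he, hR⟩] at h
    exact absurd h (lt_irrefl _)

lemma lt_cap_of_lt (hI : T.Inv f R) {b : ℕ} (hb : b ∈ T.arcs) (h : G b < f b) : G b < T.cap b :=
  h.trans_le ((hI.le_dcap b hb).trans (dcap_le_cap hb))

lemma dcap_pos_of_lt (hI : T.Inv f R) (hW : T.Witness G D act) {b : ℕ} (hb : b ∈ T.arcs)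
    (h : G b < f b) : 0 < T.dcap R b :=
  (hW.nonneg b hb).trans_lt (h.trans_le (hI.le_dcap b hb))

lemma dcap_pos_of_avail (hI : T.Inv f R) {b : ℕ} (hb : b ∈ T.arcs)
    (h : T.Avail f R b) : 0 < T.dcap R b := (hI.nonneg b hb).trans_lt h.2

/-- A set of vertices that is closed under the exchanges between `G` and `f`. -/
structure Closed (T : ArcNet) (G f : ℕ → ℝ) (D : Set ℕ) (X : Finset ℕ) : Prop where
  not_hub : T.hub ∉ X
  wanted : ∀ x ∈ X, ∃ a ∈ T.arcs, a ∈ D ∧ T.tl a = x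
  out : ∀ b ∈ T.arcs, T.tl b ∈ X → G b ≤ f b
  into : ∀ b ∈ T.arcs, T.hd b ∈ X → G b ≤ f b
  next : ∀ b ∈ T.arcs, T.tl b ∈ X → G b < f b → T.hd b ∈ X

-- `X` consists of the tails of the arcs of `D` on which `f` exceeds `G`. Out of such a tail `G ≤ f`
-- holds: arcs worse than the one in `D` are empty in `G`, and better ones are unavailable because
-- that one carries flow. An arc into `X` with `G < f` lies in `D` by `extend`, so its tail is again
-- in `X`. Hence `f - G` is at most zero on arcs entering `X` and at least zero on arcs leaving it,
-- and conservation makes it vanish on the boundary.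
open Classical in
lemma exists_closed (hI : T.Inv f R) (hW : T.Witness G D act) (hJ : T.Compat G act f R) :
    ∃ X : Finset ℕ, Closed T G f D X ∧ ∀ a ∈ T.arcs, a ∈ D → G a < f a → T.hd a ∈ X := by
  set X : Finset ℕ := (T.arcs.filter fun a => a ∈ D ∧ G a < f a).image T.tl with hXdef
  have hmem : ∀ x, x ∈ X ↔ ∃ a ∈ T.arcs, (a ∈ D ∧ G a < f a) ∧ T.tl a = x := by
    intro x; simp [hXdef, and_assoc]
  have hub : T.hub ∉ X := by
    rw [hmem]
    rintro ⟨a, ha, ⟨haD, _⟩, ht⟩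
    exact (hW.start a ha haD).1 ht
  have hout : ∀ b ∈ T.arcs, T.tl b ∈ X → G b ≤ f b := by
    intro b hb hbX
    obtain ⟨a, ha, ⟨haD, hlt⟩, ht⟩ := (hmem _).1 hbX
    by_cases hab : a = b
    · subst hab; exact hlt.le
    rcases outBetter_trichotomy (T := T) hab with h | h
    · rw [(hW.start a ha haD).2 b hb ht.symm h]; exact hI.nonneg b hb
    · exact le_of_not_avail hI hW hJ hb
        (hI.prop a ha b hb ht.symm (hW.start a ha haD).1 ((hW.nonneg a ha).trans_lt hlt) h)
  have hin : ∀ b ∈ T.arcs, T.hd b ∈ X → G b < f b → T.tl b ∈ X := by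
    intro b hb hbX hlt
    obtain ⟨a, ha, ⟨haD, _⟩, ht⟩ := (hmem _).1 hbX
    rw [hmem]
    exact ⟨b, hb, ⟨hW.extend b hb (lt_cap_of_lt hI hb hlt) (fun h => hub (h ▸ hbX))
      (open_of_lt hJ (dcap_pos_of_lt hI hW hb hlt)) a ha haD ht, hlt⟩, rfl⟩
  have hbd := boundary_eq_zero (T := T) (h := fun a => f a - G a) (X := X)
    (fun v hv => by rw [net_sub, hI.circ, hW.circ v (fun h => hub (h ▸ hv)), sub_zero])
    (fun a ha h1 h2 => by
      by_contra h3
      exact h2 (hin a ha h1 (by linarith)))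
    (fun a ha h1 _ => by linarith [hout a ha h1])
  have hnext : ∀ b ∈ T.arcs, T.tl b ∈ X → G b < f b → T.hd b ∈ X := by
    intro b hb h1 h2
    by_contra h3
    have := hbd b hb (fun h => h3 (h.2 h1))
    linarith
  refine ⟨X, ⟨hub, fun x hx => ?_, hout, fun b hb h1 => ?_, hnext⟩, fun a ha haD hlt =>
    hnext a ha ((hmem _).2 ⟨a, ha, ⟨haD, hlt⟩, rfl⟩) hlt⟩
  · obtain ⟨a, ha, ⟨haD, _⟩, ht⟩ := (hmem _).1 hx
    exact ⟨a, ha, haD, ht⟩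
  · by_cases h2 : T.tl b ∈ X
    · exact hout b hb h2
    · have := hbd b hb (fun h => h2 (h.1 h1))
      linarith

/-- On wanted arcs into the hub, the state is at most `G`. -/
lemma le_of_hd_eq_hub (hI : T.Inv f R) (hW : T.Witness G D act) (hJ : T.Compat G act f R) {a : ℕ}
    (ha : a ∈ T.arcs) (haD : a ∈ D) (hub : T.hd a = T.hub) : f a ≤ G a := by
  by_contra h
  -- An arc of `D` with surplus ends in the closed set, which does not contain the hub.
  obtain ⟨X, hX, hX'⟩ := exists_closed hI hW hJ
  exact hX.not_hub (hub ▸ hX' a ha haD (not_le.1 h))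

/-- An in-arc of `v` on which the state exceeds `G`, where `v` may reject an arc `r` positive in
`G`, shows that `v` lies in every closed set as produced by `exists_closed`. -/
lemma mem_closed_of_cand (hI : T.Inv f R) (hW : T.Witness G D act) (hJ : T.Compat G act f R)
    {X : Finset ℕ} (hX : ∀ a ∈ T.arcs, a ∈ D → G a < f a → T.hd a ∈ X) {r e : ℕ}
    (hr : r ∈ T.arcs) (he : e ∈ T.arcs) (hre : T.hd e = T.hd r) (hub : T.hd r ≠ T.hub)
    (hworst : ∀ b ∈ T.arcs, T.hd b = T.hd r → T.Cand f R b → b ≠ r → T.InBetter b r)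
    (hr0 : 0 < G r) (hrf : f r ≤ G r) (hlt : G e < f e) : T.hd r ∈ X := by
  have hne : e ≠ r := by rintro rfl; linarith
  have hc : T.Cand f R e := by
    by_cases h : e ∈ R
    · exact Or.inr ⟨h, (hW.nonneg e he).trans_lt hlt⟩
    · exact Or.inl ⟨h, hre ▸ hub⟩
  rw [← hre]
  refine hX e he ?_ hlt
  exact hW.dominate e he (lt_cap_of_lt hI he hlt) (hre ▸ hub)
    (open_of_lt hJ (dcap_pos_of_lt hI hW he hlt)) r hr hre.symm (hworst e he hre hc hne) hr0

lemma net_diff (hI : T.Inv f R) (hW : T.Witness G D act) {v : ℕ} (hv : v ≠ T.hub) :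
    T.net (fun a => f a - G a) v = 0 := by
  rw [net_sub, hI.circ, hW.circ v hv, sub_zero]

/-- The worst candidate at a vertex without available out-arcs may be rejected. -/
lemma le_of_worst (hI : T.Inv f R) (hW : T.Witness G D act) (hJ : T.Compat G act f R) {r : ℕ}
    (hr : r ∈ T.arcs) (hub : T.hd r ≠ T.hub)
    (hout : ∀ b ∈ T.arcs, T.tl b = T.hd r → ¬ T.Avail f R b)
    (hworst : ∀ b ∈ T.arcs, T.hd b = T.hd r → T.Cand f R b → b ≠ r → T.InBetter b r) :
    G r ≤ f r := by
  by_contra h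
  rw [not_le] at h
  obtain ⟨X, hX, hX'⟩ := exists_closed hI hW hJ
  -- Out of `hd r` the state is at least `G`, while it falls short of `G` on `r`; conservation
  -- yields an in-arc `e` with surplus. As a candidate it is better than `r`, hence in `D`, and so
  -- `hd r` lies in the closed set, where no in-arc falls short.
  obtain ⟨e, he, hev, hpos⟩ := exists_pos_in (net_diff hI hW hub)
    (fun b hb hbv => sub_nonneg.2 (le_of_not_avail hI hW hJ hb (hout b hb hbv)))
    (Or.inr ⟨r, hr, rfl, by linarith⟩)
  have := mem_closed_of_cand hI hW hJ hX' hr he hev hub hworst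
    ((hI.nonneg r hr).trans_lt h) h.le (by linarith)
  linarith [hX.into r hr this]

end Optimality

end ArcNet

/-! ## The steps of the algorithm -/

/-- `x` is the first element of `S` with respect to `lt`, or `0` if `S` is empty. -/
def IsPick (S : Set ℕ) (lt : ℕ → ℕ → Prop) (x : ℕ) : Prop :=
  (x = 0 ∧ ∀ b, b ∉ S) ∨ (x ≠ 0 ∧ x ∈ S ∧ ∀ b ∈ S, b ≠ x → lt x b)

namespace ArcNet

variable (T : ArcNet)

/-- Vertices that can be met by the algorithm. -/
def Rel (v : ℕ) : Prop := v = T.hub ∨ ∃ a ∈ T.arcs, T.tl a = v ∨ T.hd a = v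

/-- `B v` is the best available arc out of `v`, and `W v` is the worst candidate into `v`. -/
structure Tables (f : ℕ → ℝ) (R : Set ℕ) (B W : ℕ → ℕ) : Prop where
  out : ∀ v, T.Rel v → IsPick {a | a ∈ T.arcs ∧ T.tl a = v ∧ T.Avail f R a} T.OutBetter (B v)
  into : ∀ v, T.Rel v → IsPick {a | a ∈ T.arcs ∧ T.hd a = v ∧ T.Cand f R a}
    (fun a b => T.InBetter b a) (W v)
  rejected : ∀ a ∈ T.arcs, a ∉ R → T.hd a ≠ T.hub → B (T.hd a) = 0 → W (T.hd a) ≠ a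

/-- The vertex to which `v` passes on additional flow. -/
def succ (B W : ℕ → ℕ) (v : ℕ) : ℕ := if B v ≠ 0 then T.hd (B v) else T.tl (W v)

/-- The amount that `v` can pass on. -/
def res (f : ℕ → ℝ) (R : Set ℕ) (B W : ℕ → ℕ) (v : ℕ) : ℝ :=
  if B v ≠ 0 then T.dcap R (B v) - f (B v) else f (W v)

/-- Passing on the amount `x` at `v`. -/
def pushAt (B W : ℕ → ℕ) (x : ℝ) (g : ℕ → ℝ) (v : ℕ) : ℕ → ℝ :=
  if B v ≠ 0 then Function.update g (B v) (g (B v) + x)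
  else Function.update g (W v) (g (W v) - x)

/-- Passing on the amount `x` along `j` arcs, from `v` on. -/
def push (B W : ℕ → ℕ) (x : ℝ) (g : ℕ → ℝ) (v : ℕ) : ℕ → ℕ → ℝ
  | 0 => g
  | j + 1 => pushAt B W x (push B W x g v j) ((T.succ B W)^[j] v)

open Classical in
/-- The number of stages an arc has before it. -/
def pot (f : ℕ → ℝ) (R : Set ℕ) (a : ℕ) : ℕ :=
  if a ∈ R then (if f a = 0 then 0 else 1) else (if f a < T.cap a then 3 else 2)

/-- The potential that bounds the number of phases. -/
def potential (f : ℕ → ℝ) (R : Set ℕ) : ℕ := ∑ a ∈ T.arcs, T.pot f R a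

variable {T} {G f : ℕ → ℝ} {D act R : Set ℕ} {B W : ℕ → ℕ}

lemma ne_zero_of_mem {a : ℕ} (ha : a ∈ T.arcs) : a ≠ 0 := by
  unfold arcs at ha; rw [Finset.mem_Icc] at ha; omega

lemma pot_le (f : ℕ → ℝ) (R : Set ℕ) (a : ℕ) : T.pot f R a ≤ 3 := by
  unfold pot; split_ifs <;> omega

lemma potential_le (f : ℕ → ℝ) (R : Set ℕ) : T.potential f R ≤ 3 * T.size := by
  unfold potential
  refine (Finset.sum_le_card_nsmul _ _ 3 fun a _ => pot_le f R a).trans ?_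
  simp [arcs, mul_comm]

lemma inv_zero : T.Inv (fun _ => 0) ∅ where
  nonneg _ _ := le_rfl
  le_dcap a ha := by
    unfold dcap; split_ifs
    · exact le_rfl
    · exact T.cap_nonneg a ha
  circ v := by simp [net]
  rej_hd _ _ h := h.elim
  rej_out _ _ h := h.elim
  rej_in _ _ h := h.elim
  prop _ _ _ _ _ _ h := absurd h (lt_irrefl _)

lemma compat_zero : T.Compat G act (fun _ => 0) ∅ := ⟨fun _ _ h => h.elim, fun _ _ h => h.elim⟩

lemma dcap_eq_cap {b : ℕ} (hb : b ∈ T.arcs) (h : T.tl b ≠ T.hub) : T.dcap R b = T.cap b := by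
  unfold dcap
  rw [if_neg]
  rintro ⟨h1, _⟩
  have := T.mirror_tl _ h1
  rw [Nat.sub_add_cancel (Nat.one_le_iff_ne_zero.2 (ne_zero_of_mem hb))] at this
  exact h this

lemma dcap_eq_cap_of_pos {b : ℕ} (h : 0 < T.dcap R b) : T.dcap R b = T.cap b := by
  unfold dcap at h ⊢
  split_ifs at h ⊢
  · exact absurd h (lt_irrefl _)
  · rfl

lemma dcap_mono {b r : ℕ} (hb : b ∈ T.arcs) : T.dcap R b ≤ T.dcap (insert r R) b := by
  unfold dcap
  split_ifs with h1 h2 h2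
  · exact le_rfl
  · exact T.cap_nonneg b hb
  · exact absurd ⟨h2.1, fun h => h2.2 (Set.mem_insert_of_mem _ h)⟩ h1
  · exact le_rfl

/-- Rejecting a further arc. -/
lemma Inv.insert (hI : T.Inv f R) {r : ℕ}
    (h : T.IsExcess r ∨ (T.hd r ≠ T.hub ∧
      (∀ b ∈ T.arcs, T.tl b = T.hd r → ¬ T.Avail f R b) ∧
      ∀ b ∈ T.arcs, T.hd b = T.hd r → T.InBetter r b → ¬ T.Cand f R b)) :
    T.Inv f (insert r R) := by
  -- A rejection can raise only the current capacity of a mirror arc, and mirror arcs leave the hub;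
  -- elsewhere no arc becomes available.
  have hav : ∀ b ∈ T.arcs, T.tl b ≠ T.hub → ¬ T.Avail f R b → ¬ T.Avail f (Insert.insert r R) b := by
    rintro b hb ht h1 ⟨h2, h3⟩
    refine h1 ⟨fun h4 => h2 (Set.mem_insert_of_mem _ h4), ?_⟩
    rwa [dcap_eq_cap hb ht] at h3 ⊢
  refine ⟨hI.nonneg, fun a ha => (hI.le_dcap a ha).trans (dcap_mono ha), hI.circ, ?_, ?_, ?_, ?_⟩
  · rintro a ha (rfl | hR) he
    · exact (h.resolve_left he).1
    · exact hI.rej_hd a ha hR he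
  · rintro a ha (rfl | hR) he b hb hab
    · have h' := h.resolve_left he
      exact hav b hb (hab ▸ h'.1) (h'.2.1 b hb hab)
    · exact hav b hb (hab ▸ hI.rej_hd a ha hR he) (hI.rej_out a ha hR he b hb hab)
  · rintro a ha (rfl | hR) he b hb hab hlt
    · have h' := h.resolve_left he
      have hc := h'.2.2 b hb hab hlt
      unfold Cand at hc
      push Not at hc
      have hbR : b ∈ R := by
        by_contra hbR
        exact h'.1 (hab ▸ hc.1 hbR)
      exact ⟨Set.mem_insert_of_mem _ hbR, le_antisymm (hc.2 hbR) (hI.nonneg b hb)⟩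
    · have := hI.rej_in a ha hR he b hb hab hlt
      exact ⟨Set.mem_insert_of_mem _ this.1, this.2⟩
  · intro a ha b hb hab ht hpos hlt
    exact hav b hb (hab ▸ ht) (hI.prop a ha b hb hab ht hpos hlt)

/-- The rejected arc passes from the values 2, 3 to the values 0, 1. -/
lemma potential_insert {r : ℕ} (hr : r ∈ T.arcs) (hR : r ∉ R) :
    T.potential f (insert r R) < T.potential f R := by
  unfold potential
  refine Finset.sum_lt_sum (fun a _ => ?_) ⟨r, hr, ?_⟩
  · by_cases h : a = r
    · subst h
      unfold pot
      rw [if_pos (Set.mem_insert _ _), if_neg hR]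
      split_ifs <;> omega
    · have : a ∈ insert r R ↔ a ∈ R := ⟨fun h1 => h1.resolve_left h, fun h1 => Or.inr h1⟩
      unfold pot
      split_ifs <;> first | exact le_rfl | tauto
  · unfold pot
    rw [if_pos (Set.mem_insert _ _), if_neg hR]
    split_ifs <;> omega

lemma Compat.insert (hJ : T.Compat G act f R) {r : ℕ} (h1 : G r ≤ f r)
    (h2 : T.IsExcess r → r ∈ act) : T.Compat G act f (insert r R) := by
  constructor
  · rintro a ha (rfl | hR)
    · exact h1
    · exact hJ.le a ha hR
  · rintro a ha (rfl | hR)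
    · exact h2 ha
    · exact hJ.act a ha hR

/-- Positive flow on an excess arc shows that the tail wants more than the bound. -/
lemma Compat.insert_excess (hJ : T.Compat G act f R) (hI : T.Inv f R) (hW : T.Witness G D act)
    {q : ℕ} (hq : T.IsExcess q) (hpos : 0 < f q) : T.Compat G act f (Insert.insert q R) := by
  have hqa := T.excess_mem q hq
  have h0 := hW.excess q hq
  refine hJ.insert (h0 ▸ hpos.le) fun _ => ?_
  -- Outside `act`, the arc `q` would lie in `D`, and then `f q ≤ G q = 0`.
  by_contra hact
  have hlt : G q < f q := h0 ▸ hpos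
  have := le_of_hd_eq_hub hI hW hJ hqa
    (hW.hub q hqa (lt_cap_of_lt hI hqa hlt) (T.excess_hd q hq)
      (open_of_lt hJ (dcap_pos_of_lt hI hW hqa hlt)) fun h => hact h.2)
    (T.excess_hd q hq)
  linarith

lemma Tables.out_spec (hT : T.Tables f R B W) {v : ℕ} (hv : T.Rel v) (h : B v ≠ 0) :
    B v ∈ T.arcs ∧ T.tl (B v) = v ∧ T.Avail f R (B v) ∧
      ∀ b ∈ T.arcs, T.tl b = v → T.Avail f R b → b ≠ B v → T.OutBetter (B v) b := by
  rcases hT.out v hv with ⟨h0, _⟩ | ⟨_, ⟨h1, h2, h3⟩, h4⟩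
  · exact absurd h0 h
  · exact ⟨h1, h2, h3, fun b hb hbv hba hne => h4 b ⟨hb, hbv, hba⟩ hne⟩

lemma Tables.out_none (hT : T.Tables f R B W) {v : ℕ} (hv : T.Rel v) (h : B v = 0) :
    ∀ b ∈ T.arcs, T.tl b = v → ¬ T.Avail f R b := by
  rcases hT.out v hv with ⟨_, h1⟩ | ⟨h0, _⟩
  · exact fun b hb hbv hba => h1 b ⟨hb, hbv, hba⟩
  · exact absurd h h0

lemma Tables.into_none (hT : T.Tables f R B W) {v : ℕ} (hv : T.Rel v) (h : W v = 0) :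
    ∀ b ∈ T.arcs, T.hd b = v → ¬ T.Cand f R b := by
  rcases hT.into v hv with ⟨_, h1⟩ | ⟨h0, _⟩
  · exact fun b hb hbv hba => h1 b ⟨hb, hbv, hba⟩
  · exact absurd h h0

lemma Tables.into_spec (hT : T.Tables f R B W) {v : ℕ} (hv : T.Rel v) (h : W v ≠ 0) :
    W v ∈ T.arcs ∧ T.hd (W v) = v ∧ T.Cand f R (W v) ∧
      ∀ b ∈ T.arcs, T.hd b = v → T.Cand f R b → b ≠ W v → T.InBetter b (W v) := by
  rcases hT.into v hv with ⟨h0, _⟩ | ⟨_, ⟨h1, h2, h3⟩, h4⟩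
  · exact absurd h0 h
  · exact ⟨h1, h2, h3, fun b hb hbv hba hne => h4 b ⟨hb, hbv, hba⟩ hne⟩

/-- Since nothing is left to reject, the worst candidate at a vertex without available out-arcs has
been rejected already, and it is a candidate only because it carries flow. -/
lemma Tables.back_spec (hT : T.Tables f R B W) {v : ℕ} (hv : T.Rel v) (hB : B v = 0)
    (h : W v ≠ 0) : W v ∈ R ∧ 0 < f (W v) := by
  obtain ⟨h1, h2, h3 | h3, _⟩ := hT.into_spec hv h
  · exact absurd rfl (h2 ▸ hT.rejected (W v) h1 h3.1 h3.2 (h2.symm ▸ hB))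
  · exact h3

lemma inBetter_asymm {a b : ℕ} (h : T.InBetter a b) : ¬ T.InBetter b a := by
  unfold InBetter at *; omega

lemma outBetter_asymm {a b : ℕ} (h : T.OutBetter a b) : ¬ T.OutBetter b a := by
  unfold OutBetter at *; omega

/-- Rejecting the worst candidate at a vertex without available out-arcs. -/
lemma Inv.insert_worst (hI : T.Inv f R) {r : ℕ} (hub : T.hd r ≠ T.hub)
    (hout : IsPick {a | a ∈ T.arcs ∧ T.tl a = T.hd r ∧ T.Avail f R a} T.OutBetter 0)
    (hin : IsPick {a | a ∈ T.arcs ∧ T.hd a = T.hd r ∧ T.Cand f R a}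
      (fun a b => T.InBetter b a) r) (hr : r ∈ T.arcs) :
    T.Inv f (Insert.insert r R) ∧ ∀ {G D act}, T.Witness G D act → T.Compat G act f R →
      T.Compat G act f (Insert.insert r R) := by
  have h1 : ∀ b ∈ T.arcs, T.tl b = T.hd r → ¬ T.Avail f R b := by
    rcases hout with ⟨_, h⟩ | ⟨h, _⟩
    · exact fun b hb hbv hba => h b ⟨hb, hbv, hba⟩
    · exact absurd rfl h
  have h2 : ∀ b ∈ T.arcs, T.hd b = T.hd r → T.Cand f R b → b ≠ r → T.InBetter b r := by
    rcases hin with ⟨h, _⟩ | ⟨_, _, h⟩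
    · exact absurd h (ne_zero_of_mem hr)
    · exact fun b hb hbv hba hne => h b ⟨hb, hbv, hba⟩ hne
  constructor
  · refine hI.insert (Or.inr ⟨hub, h1, fun b hb hbv hlt hc => ?_⟩)
    refine inBetter_asymm hlt (h2 b hb hbv hc ?_)
    rintro rfl
    exact inBetter_asymm hlt hlt
  · intro G D act hW hJ
    exact hJ.insert (le_of_worst hI hW hJ hr hub h1 h2)
      fun h => absurd (T.excess_hd r h) hub

/-- When the hub is inactive, the state agrees with `G` on all arcs at the hub. -/
lemma eq_at_hub (hI : T.Inv f R) (hW : T.Witness G D act) (hJ : T.Compat G act f R)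
    (hout : ∀ a ∈ T.arcs, T.tl a = T.hub → ¬ T.Avail f R a)
    (hex : ∀ q, T.IsExcess q → f q = 0) :
    ∀ a ∈ T.arcs, T.tl a = T.hub ∨ T.hd a = T.hub → f a = G a := by
  classical
  have hle : ∀ a ∈ T.arcs, T.hd a = T.hub → f a ≤ G a := by
    intro a ha h
    by_contra hlt
    rw [not_le] at hlt
    by_cases he : T.IsExcess a
    · rw [hex a he, hW.excess a he] at hlt
      exact lt_irrefl _ hlt
    · exact absurd (le_of_hd_eq_hub hI hW hJ ha
        (hW.hub a ha (lt_cap_of_lt hI ha hlt) h (open_of_lt hJ (dcap_pos_of_lt hI hW ha hlt))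
          fun h => he h.1) h) (not_le.2 hlt)
  have hge : ∀ a ∈ T.arcs, T.tl a = T.hub → G a ≤ f a :=
    fun a ha h => le_of_not_avail hI hW hJ ha (hout a ha h)
  set X := (T.arcs.image T.tl ∪ T.arcs.image T.hd).erase T.hub with hX
  have htl : ∀ a ∈ T.arcs, T.tl a ∈ X ↔ T.tl a ≠ T.hub := by
    intro a ha
    simp only [hX, Finset.mem_erase, Finset.mem_union, Finset.mem_image, and_iff_left_iff_imp]
    exact fun _ => Or.inl ⟨a, ha, rfl⟩
  have hhd : ∀ a ∈ T.arcs, T.hd a ∈ X ↔ T.hd a ≠ T.hub := by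
    intro a ha
    simp only [hX, Finset.mem_erase, Finset.mem_union, Finset.mem_image, and_iff_left_iff_imp]
    exact fun _ => Or.inr ⟨a, ha, rfl⟩
  -- `X` is the set of all end vertices other than the hub. The two inequalities have opposite
  -- directions on arcs entering and on arcs leaving `X`, so conservation turns them into
  -- equalities.
  have hbd := boundary_eq_zero (T := T) (h := fun a => G a - f a) (X := X)
    (fun v hv => by
      rw [net_sub, hI.circ, hW.circ v (Finset.ne_of_mem_erase hv), sub_zero])
    (fun a ha _ h2 => sub_nonpos.2 (hge a ha (by by_contra h3; exact h2 ((htl a ha).2 h3))))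
    (fun a ha _ h2 => sub_nonneg.2 (hle a ha (by by_contra h3; exact h2 ((hhd a ha).2 h3))))
  intro a ha h
  -- Loops at the hub do not cross the boundary, but both inequalities apply to them.
  by_cases hboth : T.tl a = T.hub ∧ T.hd a = T.hub
  · refine le_antisymm (hle a ha hboth.2) (hge a ha hboth.1)
  · have := hbd a ha (by rw [htl a ha, hhd a ha]; tauto)
    linarith

end ArcNet

/-! ### The walk of additional flow from the hub. -/

namespace ArcNet

variable {T : ArcNet} {G f : ℕ → ℝ} {D act R : Set ℕ} {B W : ℕ → ℕ}

lemma succ_of_ne {v : ℕ} (h : B v ≠ 0) : T.succ B W v = T.hd (B v) := if_pos h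

lemma succ_of_eq {v : ℕ} (h : B v = 0) : T.succ B W v = T.tl (W v) := if_neg (not_not.2 h)

/-- The vertices met when additional flow is passed on from the hub. -/
lemma orbit_spec (hI : T.Inv f R) (hT : T.Tables f R B W) (h0 : B T.hub ≠ 0 ∨ W T.hub ≠ 0)
    (k : ℕ) : T.Rel ((T.succ B W)^[k] T.hub) ∧
      (B ((T.succ B W)^[k] T.hub) ≠ 0 ∨ W ((T.succ B W)^[k] T.hub) ≠ 0) := by
  induction k with
  | zero => exact ⟨Or.inl rfl, h0⟩
  | succ k ih =>
    rw [Function.iterate_succ_apply']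
    set v := (T.succ B W)^[k] T.hub
    obtain ⟨hv, hgood⟩ := ih
    by_cases hB : B v = 0
    · have hWv := hgood.resolve_left (not_not.2 hB)
      obtain ⟨h1, h2, -, -⟩ := hT.into_spec hv hWv
      obtain ⟨hR, hpos⟩ := hT.back_spec hv hB hWv
      have hrel : T.Rel (T.tl (W v)) := Or.inr ⟨W v, h1, Or.inl rfl⟩
      rw [succ_of_eq hB]
      refine ⟨hrel, ?_⟩
      by_contra hcon
      push Not at hcon
      have hnone := hT.into_none hrel hcon.2
      by_cases hub : T.tl (W v) = T.hub
      · rw [hub] at hcon; tauto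
      -- Flow leaves the tail along the rejected arc, so flow also enters it; the arc that brings it
      -- is a candidate, and the walk can go on.
      obtain ⟨e, he, hev, hpos'⟩ := exists_pos_in (hI.circ (T.tl (W v)))
        (fun b hb _ => hI.nonneg b hb) (Or.inl ⟨W v, h1, rfl, hpos⟩)
      refine hnone e he hev ?_
      by_cases heR : e ∈ R
      · exact Or.inr ⟨heR, hpos'⟩
      · exact Or.inl ⟨heR, hev ▸ hub⟩
    · obtain ⟨h1, h2, h3, -⟩ := hT.out_spec hv hB
      have hrel : T.Rel (T.hd (B v)) := Or.inr ⟨B v, h1, Or.inr rfl⟩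
      rw [succ_of_ne hB]
      refine ⟨hrel, ?_⟩
      by_cases hub : T.hd (B v) = T.hub
      · rwa [hub]
      by_contra hcon
      push Not at hcon
      exact hT.into_none hrel hcon.2 (B v) h1 rfl (Or.inl ⟨h3.1, hub⟩)

/-- `G` forces that no additional flow may enter `v`. -/
structure Refuses (T : ArcNet) (G f : ℕ → ℝ) (D act R : Set ℕ) (v : ℕ) : Prop where
  ne_hub : v ≠ T.hub
  out : ∀ b ∈ T.arcs, T.tl b = v → G b ≤ f b
  wanted : ∀ a ∈ T.arcs, T.hd a = v → (a ∉ R ∨ G a < f a) → G a < T.cap a →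
    (T.IsExcess (a - 1) → a - 1 ∈ act) → a ∈ D

/-- An arc of `D` out of a vertex prolongs every open in-arc that is not full in `G`, which puts
that in-arc into `D`. -/
lemma refuses_of_wanted (hW : T.Witness G D act) {d : ℕ} (hd : d ∈ T.arcs) (hdD : d ∈ D)
    (hout : ∀ b ∈ T.arcs, T.tl b = T.tl d → G b ≤ f b) : Refuses T G f D act R (T.tl d) where
  ne_hub := (hW.start d hd hdD).1
  out := hout
  wanted a ha had _ hlt hop :=
    hW.extend a ha hlt (had ▸ (hW.start d hd hdD).1) hop d hd hdD had.symm

/-- `W v` has positive flow in `G`, and all other candidates are better; those that are open and not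
full in `G` therefore dominate `G` at `v`. -/
lemma refuses_of_tight (hI : T.Inv f R) (hW : T.Witness G D act) (hJ : T.Compat G act f R)
    (hT : T.Tables f R B W) {v : ℕ} (hv : T.Rel v) (hub : v ≠ T.hub) (hB : B v = 0)
    (hWv : W v ≠ 0) (htight : f (W v) ≤ G (W v)) : Refuses T G f D act R v where
  ne_hub := hub
  out b hb hbv := le_of_not_avail hI hW hJ hb (hT.out_none hv hB b hb hbv)
  wanted a ha hav h hlt hop := by
    obtain ⟨h1, h2, -, h4⟩ := hT.into_spec hv hWv
    obtain ⟨hR, hpos⟩ := hT.back_spec hv hB hWv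
    have hne : a ≠ W v := by
      rintro rfl
      exact h.elim (fun h => h hR) fun h => absurd h (not_lt.2 htight)
    have hc : T.Cand f R a := by
      by_cases haR : a ∈ R
      · exact Or.inr ⟨haR, (hW.nonneg a ha).trans_lt (h.resolve_left (not_not.2 haR))⟩
      · exact Or.inl ⟨haR, hav ▸ hub⟩
    exact hW.dominate a ha hlt (hav ▸ hub) hop (W v) h1 (h2.trans hav.symm) (h4 a ha hav hc hne)
      (hpos.trans_le htight)

/-- If `v` passes on flow to a vertex that refuses it, then `v` refuses flow itself. -/
lemma refuses_of_succ (hI : T.Inv f R) (hW : T.Witness G D act) (hJ : T.Compat G act f R)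
    (hT : T.Tables f R B W) {v : ℕ} (hv : T.Rel v) (hgood : B v ≠ 0 ∨ W v ≠ 0)
    (h : Refuses T G f D act R (T.succ B W v)) : Refuses T G f D act R v := by
  obtain ⟨X, hX, hX'⟩ := exists_closed hI hW hJ
  have hmem : (∃ e ∈ T.arcs, T.hd e = T.succ B W v ∧ 0 < f e - G e) → T.succ B W v ∈ X := by
    rintro ⟨e, he, hev, hpos⟩
    have hlt : G e < f e := sub_pos.1 hpos
    rw [← hev]
    exact hX' e he (h.wanted e he hev (Or.inr hlt) (lt_cap_of_lt hI he hlt)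
      (open_of_lt hJ (dcap_pos_of_lt hI hW he hlt))) hlt
  have hpos_in := exists_pos_in (net_diff hI hW h.ne_hub)
    (fun b hb hbv => sub_nonneg.2 (h.out b hb hbv))
  by_cases hB : B v = 0
  · have hWv := hgood.resolve_left (not_not.2 hB)
    obtain ⟨h1, h2, -, -⟩ := hT.into_spec hv hWv
    obtain ⟨hR, hpos⟩ := hT.back_spec hv hB hWv
    rw [succ_of_eq hB] at *
    rcases (hJ.le _ h1 hR).lt_or_eq with hlt | heq
    -- Here the refusing vertex has surplus on an out-arc, hence on an in-arc, and lies in the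
    -- closed set. So does `v`, the head of that out-arc.
    · have hX1 := hmem (hpos_in (Or.inl ⟨W v, h1, rfl, sub_pos.2 hlt⟩))
      have hvX : v ∈ X := h2 ▸ hX.next _ h1 hX1 hlt
      obtain ⟨d, hd, hdD, hdv⟩ := hX.wanted v hvX
      rw [← hdv] at hvX ⊢
      exact refuses_of_wanted hW hd hdD fun b hb hbv => hX.out b hb (hbv ▸ hvX)
    · refine refuses_of_tight hI hW hJ hT hv ?_ hB hWv heq.ge
      rintro rfl
      by_cases he : T.IsExcess (W T.hub)
      · rw [← heq, hW.excess _ he] at hpos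
        exact lt_irrefl _ hpos
      · exact hI.rej_hd _ h1 hR he h2
  · obtain ⟨h1, h2, h3, h4⟩ := hT.out_spec hv hB
    rw [succ_of_ne hB] at *
    -- A deficit on `B v` would be balanced by a surplus on another in-arc of the refusing vertex.
    -- This would place the vertex in the closed set, where no in-arc has a deficit.
    have hle : G (B v) ≤ f (B v) := by
      by_contra hlt
      rw [not_le] at hlt
      exact absurd (hX.into _ h1 (hmem (hpos_in (Or.inr ⟨B v, h1, rfl, sub_neg.2 hlt⟩))))
        (not_le.2 hlt)
    have hD : B v ∈ D := h.wanted _ h1 rfl (Or.inl h3.1)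
      (hle.trans_lt (h3.2.trans_le (dcap_le_cap h1))) (open_of_lt hJ (dcap_pos_of_avail hI h1 h3))
    rw [← h2]
    refine refuses_of_wanted hW h1 hD fun b hb hbv => ?_
    by_cases hbB : b = B v
    · rw [hbB]; exact hle
    by_cases hba : T.Avail f R b
    · rw [(hW.start _ h1 hD).2 b hb hbv (h4 b hb (hbv.trans h2) hba hbB)]
      exact hI.nonneg b hb
    · exact le_of_not_avail hI hW hJ hb hba

/-- Arcs on which flow is sent back are not tight. -/
lemma lt_of_back (hI : T.Inv f R) (hW : T.Witness G D act) (hJ : T.Compat G act f R)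
    (hT : T.Tables f R B W) (h0 : B T.hub ≠ 0 ∨ W T.hub ≠ 0) (k : ℕ)
    (hB : B ((T.succ B W)^[k] T.hub) = 0) :
    G (W ((T.succ B W)^[k] T.hub)) < f (W ((T.succ B W)^[k] T.hub)) := by
  -- Refusal is inherited backwards along the walk, and the hub, where the walk starts, never
  -- refuses.
  have hno : ∀ k, ¬ Refuses T G f D act R ((T.succ B W)^[k] T.hub) := by
    intro k
    induction k with
    | zero => exact fun h => h.ne_hub rfl
    | succ k ih =>
      rw [Function.iterate_succ_apply']
      obtain ⟨h1, h2⟩ := orbit_spec hI hT h0 k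
      exact fun h => ih (refuses_of_succ hI hW hJ hT h1 h2 h)
  obtain ⟨h1, h2⟩ := orbit_spec hI hT h0 k
  by_contra hlt
  rw [not_lt] at hlt
  have hWv := h2.resolve_left (not_not.2 hB)
  refine hno k (refuses_of_tight hI hW hJ hT h1 ?_ hB hWv hlt)
  -- The hub can return flow only on excess arcs, where `G` is zero and `f` is positive.
  intro hub
  obtain ⟨h3, h4, -, -⟩ := hT.into_spec h1 hWv
  obtain ⟨hR, hpos⟩ := hT.back_spec h1 hB hWv
  rw [hub] at h3 h4 hR hpos hlt
  by_cases he : T.IsExcess (W T.hub)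
  · rw [hW.excess _ he] at hlt
    exact absurd hpos (not_lt.2 hlt)
  · exact hI.rej_hd _ h3 hR he h4

/-! ### Pushing flow around a cycle -/

/-- The arc along which `v` passes on flow. -/
def arcAt (B W : ℕ → ℕ) (v : ℕ) : ℕ := if B v ≠ 0 then B v else W v

lemma arcAt_mem (hT : T.Tables f R B W) {v : ℕ} (hv : T.Rel v) (hgood : B v ≠ 0 ∨ W v ≠ 0) :
    arcAt B W v ∈ T.arcs := by
  unfold arcAt
  split_ifs with h
  · exact (hT.out_spec hv h).1
  · exact (hT.into_spec hv (hgood.resolve_left h)).1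

/-- Arcs used forwards are not rejected, arcs used backwards are; within one direction the tail or
the head of the arc recovers the vertex. -/
lemma arcAt_inj (hT : T.Tables f R B W) {v w : ℕ} (hv : T.Rel v) (hv' : B v ≠ 0 ∨ W v ≠ 0)
    (hw : T.Rel w) (hw' : B w ≠ 0 ∨ W w ≠ 0) (h : arcAt B W v = arcAt B W w) : v = w := by
  unfold arcAt at h
  split_ifs at h with h1 h2 h2
  · rw [← (hT.out_spec hv h1).2.1, h, (hT.out_spec hw h2).2.1]
  · have h3 := (hT.out_spec hv h1).2.2.1.1
    rw [not_not] at h2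
    exact absurd (hT.back_spec hw h2 (hw'.resolve_left (not_not.2 h2))).1 (h ▸ h3)
  · have h3 := (hT.out_spec hw h2).2.2.1.1
    rw [not_not] at h1
    exact absurd (hT.back_spec hv h1 (hv'.resolve_left (not_not.2 h1))).1 (h ▸ h3)
  · rw [← (hT.into_spec hv (hv'.resolve_left h1)).2.1, h,
      (hT.into_spec hw (hw'.resolve_left h2)).2.1]

/-- The orbit of the hub becomes periodic after at most as many steps as there are arcs. -/
lemma exists_period (hI : T.Inv f R) (hT : T.Tables f R B W) (h0 : B T.hub ≠ 0 ∨ W T.hub ≠ 0) :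
    ∃ p, 0 < p ∧ p ≤ T.size ∧
      Function.IsPeriodicPt (T.succ B W) p ((T.succ B W)^[T.size] T.hub) := by
  have horb := orbit_spec hI hT h0
  -- Pigeonhole: `size + 1` iterates choose among `size` arcs, and equal arcs come from equal
  -- vertices.
  obtain ⟨i, hi, j, hj, hne, heq⟩ := Finset.exists_ne_map_eq_of_card_lt_of_maps_to
    (s := Finset.range (T.size + 1)) (t := T.arcs)
    (f := fun k => arcAt B W ((T.succ B W)^[k] T.hub)) (by simp [arcs])
    (fun k _ => arcAt_mem hT (horb k).1 (horb k).2)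
  have heq' := arcAt_inj hT (horb i).1 (horb i).2 (horb j).1 (horb j).2 heq
  rw [Finset.mem_range] at hi hj
  have key : ∀ i j, i < j → j ≤ T.size →
      (T.succ B W)^[i] T.hub = (T.succ B W)^[j] T.hub → ∃ p, 0 < p ∧ p ≤ T.size ∧
        Function.IsPeriodicPt (T.succ B W) p ((T.succ B W)^[T.size] T.hub) := by
    intro i j hlt hj h
    refine ⟨j - i, by omega, by omega, ?_⟩
    unfold Function.IsPeriodicPt Function.IsFixedPt
    rw [← Function.iterate_add_apply, show j - i + T.size = (T.size - i) + j by omega,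
      Function.iterate_add_apply, ← h, ← Function.iterate_add_apply]
    congr 2
    omega
  rcases Nat.lt_or_gt_of_ne hne with hlt | hlt
  · exact key i j hlt (by omega) heq'
  · exact key j i hlt (by omega) heq'.symm

lemma net_update {g : ℕ → ℝ} {a : ℕ} (ha : a ∈ T.arcs) (x : ℝ) (u : ℕ) :
    T.net (Function.update g a (g a + x)) u =
      T.net g u + ((if T.hd a = u then x else 0) - (if T.tl a = u then x else 0)) := by
  unfold net
  rw [← Finset.add_sum_erase _ _ ha, ← Finset.add_sum_erase _ (fun b => _) ha]
  rw [Finset.sum_congr rfl (g := fun b => (if T.hd b = u then g b else 0) -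
    (if T.tl b = u then g b else 0))]
  · rw [Function.update_self]
    split_ifs <;> ring
  · intro b hb
    rw [Function.update_of_ne (Finset.ne_of_mem_erase hb)]

lemma net_pushAt (hT : T.Tables f R B W) {v : ℕ} (hv : T.Rel v) (hgood : B v ≠ 0 ∨ W v ≠ 0)
    (g : ℕ → ℝ) (x : ℝ) (u : ℕ) :
    T.net (pushAt B W x g v) u =
      T.net g u + ((if T.succ B W v = u then x else 0) - (if v = u then x else 0)) := by
  unfold pushAt
  by_cases h : B v = 0
  · obtain ⟨ha, ht, -, -⟩ := hT.into_spec hv (hgood.resolve_left (not_not.2 h))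
    rw [if_neg (not_not.2 h), sub_eq_add_neg, net_update ha, succ_of_eq h, ht]
    split_ifs <;> ring
  · obtain ⟨ha, ht, -, -⟩ := hT.out_spec hv h
    rw [if_pos h, net_update ha, succ_of_ne h, ht]

lemma push_succ (B W : ℕ → ℕ) (x : ℝ) (g : ℕ → ℝ) (v j : ℕ) :
    T.push B W x g v (j + 1) = pushAt B W x (T.push B W x g v j) ((T.succ B W)^[j] v) := rfl

lemma push_of_ne {x : ℝ} {v a : ℕ} (j : ℕ)
    (h : ∀ i < j, arcAt B W ((T.succ B W)^[i] v) ≠ a) : T.push B W x f v j a = f a := by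
  induction j with
  | zero => rfl
  | succ j ih =>
    have h1 := h j (Nat.lt_succ_self j)
    rw [← ih fun i hi => h i (hi.trans (Nat.lt_succ_self j))]
    rw [push_succ]
    unfold pushAt
    unfold arcAt at h1
    split_ifs at h1 ⊢
    · rw [Function.update_of_ne h1.symm]
    · rw [Function.update_of_ne h1.symm]

/-- As the arcs of the walk are pairwise distinct, each of them is changed exactly once. -/
lemma push_arcAt {x : ℝ} {v : ℕ} (j : ℕ)
    (hinj : ∀ i < j, ∀ i' < j, arcAt B W ((T.succ B W)^[i] v) = arcAt B W ((T.succ B W)^[i'] v) →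
      i = i') {i : ℕ} (hi : i < j) :
    T.push B W x f v j (arcAt B W ((T.succ B W)^[i] v)) =
      f (arcAt B W ((T.succ B W)^[i] v)) + (if B ((T.succ B W)^[i] v) ≠ 0 then x else -x) := by
  induction j with
  | zero => omega
  | succ j ih =>
    by_cases hij : i = j
    · subst hij
      have := push_of_ne (T := T) (f := f) (x := x) (v := v) (B := B) (W := W)
        (a := arcAt B W ((T.succ B W)^[i] v)) i fun i' hi' h => by
          have := hinj i' (by omega) i (by omega) h
          omega
      rw [push_succ, ← this]
      unfold arcAt pushAt
      split_ifs
      · rw [Function.update_self]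
      · rw [Function.update_self, sub_eq_add_neg]
    · have hij' : i < j := by omega
      rw [← ih (fun i hi i' hi' => hinj i (by omega) i' (by omega)) hij']
      have hne : arcAt B W ((T.succ B W)^[i] v) ≠ arcAt B W ((T.succ B W)^[j] v) := by
        intro h
        have := hinj i (by omega) j (by omega) h
        omega
      rw [push_succ]
      unfold pushAt
      rw [show arcAt B W ((T.succ B W)^[j] v) = if B ((T.succ B W)^[j] v) ≠ 0 then
        B ((T.succ B W)^[j] v) else W ((T.succ B W)^[j] v) from rfl] at hne
      split_ifs at hne ⊢
      · rw [Function.update_of_ne hne]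
      · rw [Function.update_of_ne hne]

end ArcNet

/-! ### Pushing around the cycle preserves the invariants and lowers the potential. -/

namespace ArcNet

variable {T : ArcNet} {G f : ℕ → ℝ} {D act R : Set ℕ} {B W : ℕ → ℕ}

/-- A vertex on the cycle that is reached from the hub. -/
def base (T : ArcNet) (B W : ℕ → ℕ) : ℕ := (T.succ B W)^[T.size] T.hub

/-- The length of the cycle that is reached from the hub. -/
def period (T : ArcNet) (B W : ℕ → ℕ) : ℕ := Function.minimalPeriod (T.succ B W) (T.base B W)

lemma iterate_base (i : ℕ) :
    (T.succ B W)^[i] (T.base B W) = (T.succ B W)^[i + T.size] T.hub := by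
  unfold base; rw [Function.iterate_add_apply]

lemma cycle_spec (hI : T.Inv f R) (hT : T.Tables f R B W) (h0 : B T.hub ≠ 0 ∨ W T.hub ≠ 0)
    (i : ℕ) : T.Rel ((T.succ B W)^[i] (T.base B W)) ∧
      (B ((T.succ B W)^[i] (T.base B W)) ≠ 0 ∨ W ((T.succ B W)^[i] (T.base B W)) ≠ 0) := by
  rw [iterate_base]; exact orbit_spec hI hT h0 _

lemma period_pos (hI : T.Inv f R) (hT : T.Tables f R B W) (h0 : B T.hub ≠ 0 ∨ W T.hub ≠ 0) :
    0 < T.period B W := by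
  obtain ⟨p, h1, -, h3⟩ := exists_period hI hT h0
  exact h3.minimalPeriod_pos h1

lemma period_le (hI : T.Inv f R) (hT : T.Tables f R B W) (h0 : B T.hub ≠ 0 ∨ W T.hub ≠ 0) :
    T.period B W ≤ T.size := by
  obtain ⟨p, h1, h2, h3⟩ := exists_period hI hT h0
  exact (h3.minimalPeriod_le h1).trans h2

lemma iterate_period : (T.succ B W)^[T.period B W] (T.base B W) = T.base B W :=
  Function.iterate_minimalPeriod

/-- The flow after pushing the amount `x` around the cycle. -/
def pushed (T : ArcNet) (B W : ℕ → ℕ) (x : ℝ) (f : ℕ → ℝ) : ℕ → ℝ :=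
  T.push B W x f (T.base B W) (T.period B W)

lemma arcAt_cycle_inj (hI : T.Inv f R) (hT : T.Tables f R B W)
    (h0 : B T.hub ≠ 0 ∨ W T.hub ≠ 0) : ∀ i < T.period B W, ∀ i' < T.period B W,
      arcAt B W ((T.succ B W)^[i] (T.base B W)) = arcAt B W ((T.succ B W)^[i'] (T.base B W)) →
      i = i' := by
  intro i hi j hj h
  have h1 := cycle_spec hI hT h0 i
  have h2 := cycle_spec hI hT h0 j
  exact Function.iterate_injOn_Iio_minimalPeriod hi hj (arcAt_inj hT h1.1 h1.2 h2.1 h2.2 h)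

lemma pushed_arcAt (hI : T.Inv f R) (hT : T.Tables f R B W) (h0 : B T.hub ≠ 0 ∨ W T.hub ≠ 0)
    {x : ℝ} {i : ℕ} (hi : i < T.period B W) :
    T.pushed B W x f (arcAt B W ((T.succ B W)^[i] (T.base B W))) =
      f (arcAt B W ((T.succ B W)^[i] (T.base B W))) +
        (if B ((T.succ B W)^[i] (T.base B W)) ≠ 0 then x else -x) :=
  push_arcAt _ (arcAt_cycle_inj hI hT h0) hi

/-- Description of the flow after a push. -/
lemma pushed_cases (hI : T.Inv f R) (hT : T.Tables f R B W) (h0 : B T.hub ≠ 0 ∨ W T.hub ≠ 0)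
    (x : ℝ) (a : ℕ) : T.pushed B W x f a = f a ∨
      ∃ i < T.period B W, ∃ v, v = (T.succ B W)^[i] (T.base B W) ∧
        ((B v ≠ 0 ∧ a = B v ∧ T.pushed B W x f a = f a + x) ∨
          (B v = 0 ∧ W v ≠ 0 ∧ a = W v ∧ T.pushed B W x f a = f a - x)) := by
  by_cases h : ∃ i < T.period B W, arcAt B W ((T.succ B W)^[i] (T.base B W)) = a
  · obtain ⟨i, hi, rfl⟩ := h
    refine Or.inr ⟨i, hi, _, rfl, ?_⟩
    have h1 := pushed_arcAt hI hT h0 (x := x) hi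
    by_cases hB : B ((T.succ B W)^[i] (T.base B W)) = 0
    · rw [if_neg (not_not.2 hB), ← sub_eq_add_neg] at h1
      exact Or.inr ⟨hB, (cycle_spec hI hT h0 i).2.resolve_left (not_not.2 hB),
        if_neg (not_not.2 hB), h1⟩
    · rw [if_pos hB] at h1
      exact Or.inl ⟨hB, if_pos hB, h1⟩
  · push Not at h
    exact Or.inl (push_of_ne _ h)

/-- The changes telescope, so that only the two ends of the walk are unbalanced; after a full period
they coincide. -/
lemma net_push (hI : T.Inv f R) (hT : T.Tables f R B W) (h0 : B T.hub ≠ 0 ∨ W T.hub ≠ 0)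
    (x : ℝ) (u j : ℕ) : T.net (T.push B W x f (T.base B W) j) u =
      (if (T.succ B W)^[j] (T.base B W) = u then x else 0) - (if T.base B W = u then x else 0) := by
  induction j with
  | zero => rw [push, hI.circ, Function.iterate_zero_apply, sub_self]
  | succ j ih =>
    have h := cycle_spec hI hT h0 j
    rw [push_succ, net_pushAt hT h.1 h.2, ih, Function.iterate_succ_apply']
    ring

variable {x : ℝ}

lemma res_out {v : ℕ} (hB : B v ≠ 0) (hx : x ≤ T.res f R B W v) :
    f (B v) + x ≤ T.dcap R (B v) := by
  unfold res at hx; rw [if_pos hB] at hx; linarith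

lemma res_back {v : ℕ} (hB : B v = 0) (hx : x ≤ T.res f R B W v) : x ≤ f (W v) := by
  unfold res at hx; rwa [if_neg (not_not.2 hB)] at hx

/-- A push raises the flow only on arcs that were available and lowers it only on rejected arcs,
which are unavailable whatever their flow. -/
lemma not_avail_pushed (hI : T.Inv f R) (hT : T.Tables f R B W)
    (h0 : B T.hub ≠ 0 ∨ W T.hub ≠ 0) {b : ℕ} (h : ¬ T.Avail f R b) :
    ¬ T.Avail (T.pushed B W x f) R b := by
  rintro ⟨h1, h2⟩
  have hv := fun i => (cycle_spec hI hT h0 i).1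
  rcases pushed_cases hI hT h0 x b with h3 | ⟨i, _, v, rfl, ⟨hB, rfl, h3⟩ | ⟨hB, hW, rfl, h3⟩⟩
  · exact h ⟨h1, h3 ▸ h2⟩
  · exact h (hT.out_spec (hv i) hB).2.2.1
  · exact h1 (hT.back_spec (hv i) hB hW).1

/-- Pushing preserves the invariants. -/
lemma Inv.pushed (hI : T.Inv f R) (hT : T.Tables f R B W) (h0 : B T.hub ≠ 0 ∨ W T.hub ≠ 0)
    (hx0 : 0 ≤ x) (hx : ∀ i, x ≤ T.res f R B W ((T.succ B W)^[i] (T.base B W))) :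
    T.Inv (T.pushed B W x f) R := by
  have hv := fun i => (cycle_spec hI hT h0 i).1
  have hcases := pushed_cases hI hT h0 x
  refine ⟨?_, ?_, ?_, hI.rej_hd, ?_, ?_, ?_⟩
  · intro a ha
    have h4 := hI.nonneg a ha
    rcases hcases a with h3 | ⟨i, _, v, rfl, ⟨hB, rfl, h3⟩ | ⟨hB, hW, rfl, h3⟩⟩
    · rwa [h3]
    · linarith
    · linarith [res_back hB (hx i)]
  · intro a ha
    have h4 := hI.le_dcap a ha
    rcases hcases a with h3 | ⟨i, _, v, rfl, ⟨hB, rfl, h3⟩ | ⟨hB, hW, rfl, h3⟩⟩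
    · rwa [h3]
    · rw [h3]; exact res_out hB (hx i)
    · linarith
  · intro v
    unfold ArcNet.pushed
    rw [net_push hI hT h0, iterate_period, sub_self]
  · intro a ha hR he b hb hab
    exact not_avail_pushed hI hT h0 (hI.rej_out a ha hR he b hb hab)
  · intro a ha hR he b hb hab hlt
    obtain ⟨h1, h2⟩ := hI.rej_in a ha hR he b hb hab hlt
    refine ⟨h1, ?_⟩
    rcases hcases b with h3 | ⟨i, _, v, rfl, ⟨hB, rfl, h3⟩ | ⟨hB, hW, rfl, h3⟩⟩
    · rw [h3, h2]
    · exact absurd h1 (hT.out_spec (hv i) hB).2.2.1.1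
    · exact absurd h2 (hT.back_spec (hv i) hB hW).2.ne'
  · intro a ha b hb hab ht hpos hlt
    apply not_avail_pushed hI hT h0
    rcases hcases a with h3 | ⟨i, _, v, rfl, ⟨hB, rfl, h3⟩ | ⟨hB, hW, rfl, h3⟩⟩
    · exact hI.prop a ha b hb hab ht (h3 ▸ hpos) hlt
    -- The flow has grown on the best available arc out of its tail, so no better arc is available
    -- there.
    · intro hba
      obtain ⟨-, h5, -, h6⟩ := hT.out_spec (hv i) hB
      have hne : b ≠ B ((T.succ B W)^[i] (T.base B W)) := by
        rintro rfl
        exact outBetter_asymm hlt hlt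
      exact outBetter_asymm hlt (h6 b hb (hab.trans h5) hba hne)
    · exact hI.prop _ ha b hb hab ht (hT.back_spec (hv i) hB hW).2 hlt

/-- A push that is not maximal does not change the tables. -/
lemma Tables.pushed (hI : T.Inv f R) (hT : T.Tables f R B W) (h0 : B T.hub ≠ 0 ∨ W T.hub ≠ 0)
    (hx0 : 0 ≤ x) (hx : ∀ i, x < T.res f R B W ((T.succ B W)^[i] (T.base B W))) :
    T.Tables (T.pushed B W x f) R B W := by
  have hv := fun i => (cycle_spec hI hT h0 i).1
  have hcases := pushed_cases hI hT h0 x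
  have h1 : ∀ a, T.Avail (T.pushed B W x f) R a ↔ T.Avail f R a := by
    refine fun a => ⟨fun h => ?_, fun h => ?_⟩
    · by_contra h'
      exact not_avail_pushed hI hT h0 h' h
    · refine ⟨h.1, ?_⟩
      rcases hcases a with h3 | ⟨i, _, v, rfl, ⟨hB, rfl, h3⟩ | ⟨hB, hW, rfl, h3⟩⟩
      · rw [h3]; exact h.2
      · have := hx i
        unfold res at this
        rw [if_pos hB] at this
        linarith
      · linarith [h.2]
  have h2 : ∀ a ∈ T.arcs, T.Cand (T.pushed B W x f) R a ↔ T.Cand f R a := by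
    intro a ha
    unfold Cand
    refine or_congr_right (and_congr_right fun hR => ?_)
    rcases hcases a with h3 | ⟨i, _, v, rfl, ⟨hB, rfl, h3⟩ | ⟨hB, hW, rfl, h3⟩⟩
    · rw [h3]
    · exact absurd hR (hT.out_spec (hv i) hB).2.2.1.1
    · have := hx i
      unfold res at this
      rw [if_neg (not_not.2 hB)] at this
      exact iff_of_true (by linarith) (hT.back_spec (hv i) hB hW).2
  refine ⟨fun v hv => ?_, fun v hv => ?_, hT.rejected⟩
  · simp only [h1]
    exact hT.out v hv
  · have : {a | a ∈ T.arcs ∧ T.hd a = v ∧ T.Cand (T.pushed B W x f) R a} =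
        {a | a ∈ T.arcs ∧ T.hd a = v ∧ T.Cand f R a} := by
      ext a
      exact and_congr_right fun ha => and_congr_right fun _ => h2 a ha
    rw [this]
    exact hT.into v hv

/-- Pushing does not move past `G`. -/
lemma Compat.pushed (hI : T.Inv f R) (hW : T.Witness G D act) (hJ : T.Compat G act f R)
    (hT : T.Tables f R B W) (h0 : B T.hub ≠ 0 ∨ W T.hub ≠ 0)
    (hx : ∀ i, x ≤ T.res f R B W ((T.succ B W)^[i] (T.base B W))) :
    T.Compat G act (T.pushed B W x f) R := by
  classical
  refine ⟨?_, hJ.act⟩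
  by_contra hcon
  push Not at hcon
  obtain ⟨r, hr, hrR, hlt⟩ := hcon
  have hv := fun i => (cycle_spec hI hT h0 i).1
  have hback : ∀ i < T.period B W, B ((T.succ B W)^[i] (T.base B W)) = 0 →
      0 ≤ f (W ((T.succ B W)^[i] (T.base B W))) - G (W ((T.succ B W)^[i] (T.base B W))) := by
    intro i _ hB
    have hWv := (cycle_spec hI hT h0 i).2.resolve_left (not_not.2 hB)
    have := hJ.le _ (hT.into_spec (hv i) hWv).1 (hT.back_spec (hv i) hB hWv).1
    linarith
  obtain ⟨i, hi, hB, hlt'⟩ : ∃ i < T.period B W, B ((T.succ B W)^[i] (T.base B W)) = 0 ∧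
      f (W ((T.succ B W)^[i] (T.base B W))) - G (W ((T.succ B W)^[i] (T.base B W))) < x := by
    rcases pushed_cases hI hT h0 x r with h3 | ⟨i, hi, v, rfl, ⟨hB, rfl, h3⟩ | ⟨hB, hW, rfl, h3⟩⟩
    · rw [h3] at hlt
      exact absurd (hJ.le r hr hrR) (not_le.2 hlt)
    · exact absurd hrR (hT.out_spec (hv i) hB).2.2.1.1
    · exact ⟨i, hi, hB, by linarith⟩
  -- Let `e` be the least surplus `f - G` on an arc of the cycle used backwards. If `x` exceeded it,
  -- pushing only `e` would preserve invariants, tables and compatibility and leave a tight arc used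
  -- backwards, contrary to `lt_of_back`.
  obtain ⟨k, hk, hmin⟩ := Finset.exists_min_image
    ((Finset.range (T.period B W)).filter fun i => B ((T.succ B W)^[i] (T.base B W)) = 0)
    (fun i => f (W ((T.succ B W)^[i] (T.base B W))) - G (W ((T.succ B W)^[i] (T.base B W))))
    ⟨i, by simp [hi, hB]⟩
  simp only [Finset.mem_filter, Finset.mem_range, and_imp] at hk hmin
  set e := f (W ((T.succ B W)^[k] (T.base B W))) - G (W ((T.succ B W)^[k] (T.base B W))) with he
  have hex : e < x := (hmin i hi hB).trans_lt hlt'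
  have he0 : 0 ≤ e := hback k hk.1 hk.2
  have hlt_res := fun i => hex.trans_le (hx i)
  have hI' := hI.pushed hT h0 he0 fun i => (hlt_res i).le
  have hT' := hT.pushed hI h0 he0 hlt_res
  have hJ' : T.Compat G act (T.pushed B W e f) R := by
    refine ⟨fun a ha haR => ?_, hJ.act⟩
    rcases pushed_cases hI hT h0 e a with h3 | ⟨i, hi, v, rfl, ⟨hB, rfl, h3⟩ | ⟨hB, hW, rfl, h3⟩⟩
    · rw [h3]; exact hJ.le a ha haR
    · exact absurd haR (hT.out_spec (hv i) hB).2.2.1.1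
    · linarith [hmin i hi hB]
  -- The base of the cycle is the iterate number `size` of the hub, hence the shift.
  have h4 := lt_of_back hI' hW hJ' hT' h0 (k + T.size)
  rw [← iterate_base] at h4
  have h5 := h4 hk.2
  have h6 := pushed_arcAt hI hT h0 (x := e) hk.1
  unfold arcAt at h6
  simp only [hk.2, ne_eq, not_true_eq_false, if_false] at h6
  rw [h6] at h5
  linarith

/-- A maximal push decreases the potential. -/
lemma potential_pushed (hI : T.Inv f R) (hT : T.Tables f R B W) (h0 : B T.hub ≠ 0 ∨ W T.hub ≠ 0)
    {k : ℕ} (hk : T.res f R B W ((T.succ B W)^[k] (T.base B W)) = x) :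
    T.potential (T.pushed B W x f) R < T.potential f R := by
  have hv := fun i => (cycle_spec hI hT h0 i).1
  have hcap : ∀ i, B ((T.succ B W)^[i] (T.base B W)) ≠ 0 →
      T.dcap R (B ((T.succ B W)^[i] (T.base B W))) = T.cap (B ((T.succ B W)^[i] (T.base B W))) := by
    intro i hB
    obtain ⟨h1, -, h2, -⟩ := hT.out_spec (hv i) hB
    exact dcap_eq_cap_of_pos (dcap_pos_of_avail hI h1 h2)
  wlog hkp : k < T.period B W generalizing k
  · refine this (k := k % T.period B W) ?_ (Nat.mod_lt _ (period_pos hI hT h0))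
    rw [← hk]
    unfold period
    rw [Function.iterate_mod_minimalPeriod_eq]
  unfold potential
  refine Finset.sum_lt_sum (fun a ha => ?_) ⟨arcAt B W ((T.succ B W)^[k] (T.base B W)),
    arcAt_mem hT (hv k) (cycle_spec hI hT h0 k).2, ?_⟩
  · rcases pushed_cases hI hT h0 x a with h3 | ⟨i, hi, v, rfl, ⟨hB, rfl, h3⟩ | ⟨hB, hW, rfl, h3⟩⟩
    · unfold pot; rw [h3]
    · obtain ⟨h1, -, h2, -⟩ := hT.out_spec (hv i) hB
      refine (?_ : _ ≤ 3).trans (?_ : 3 ≤ _)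
      · exact pot_le _ _ _
      · unfold pot
        rw [if_neg h2.1, if_pos (hcap i hB ▸ h2.2)]
    · obtain ⟨h1, h2⟩ := hT.back_spec (hv i) hB hW
      unfold pot
      rw [if_pos h1, if_pos h1, if_neg h2.ne']
      split_ifs <;> omega
  -- At the bottleneck a rejected arc is emptied or an unrejected one saturated. In the latter case
  -- the current capacity equals `T.cap`, to which the potential refers, since the arc was
  -- available.
  · have h3 := pushed_arcAt hI hT h0 (x := x) hkp
    by_cases hB : B ((T.succ B W)^[k] (T.base B W)) = 0
    · obtain ⟨h1, h2⟩ := hT.back_spec (hv k) hB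
        ((cycle_spec hI hT h0 k).2.resolve_left (not_not.2 hB))
      unfold res at hk
      unfold arcAt at h3 ⊢
      rw [if_neg (not_not.2 hB)] at hk
      rw [if_neg (not_not.2 hB), if_neg (not_not.2 hB), hk, add_neg_cancel] at h3
      rw [if_neg (not_not.2 hB)]
      unfold pot
      rw [if_pos h1, if_pos h1, if_neg h2.ne', if_pos h3]
      exact one_pos
    · obtain ⟨h1, -, h2, -⟩ := hT.out_spec (hv k) hB
      unfold res at hk
      unfold arcAt at h3 ⊢
      rw [if_pos hB] at hk
      rw [if_pos hB, if_pos hB] at h3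
      rw [if_pos hB]
      have h4 := hcap k hB
      unfold pot
      rw [if_neg h2.1, if_neg h2.1, if_neg (by linarith), if_pos (h4 ▸ h2.2)]
      omega

end ArcNet

namespace Network

/-! ## Splitting the edges of a network -/

variable {n m : ℕ} (I : Network n m)

/-- Vertices, with all terminals identified with the additional vertex `n`. -/
def vtx (v : Fin n) : ℕ := if I.terminal v = true then n else v

/-- The effective upper bound. -/
def ub (e : Fin m) : ℝ := min (I.upper e) (I.cap e)

/-- The number of the `j`-th arc of the edge `e`. -/
def arc (e : Fin m) (j : ℕ) : ℕ := 5 * e + 1 + j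

/-- Functions on arcs. -/
def onArc {α : Type} (F : Fin m → ℕ → α) (d : α) (a : ℕ) : α :=
  if h : (a - 1) / 5 < m then F ⟨(a - 1) / 5, h⟩ ((a - 1) % 5) else d

lemma onArc_arc {α : Type} (F : Fin m → ℕ → α) (d : α) (e : Fin m) {j : ℕ} (hj : j < 5) :
    onArc F d (arc e j) = F e j := by
  unfold onArc arc
  have h1 : (5 * (e : ℕ) + 1 + j - 1) / 5 = e := by omega
  have h2 : (5 * (e : ℕ) + 1 + j - 1) % 5 = j := by omega
  have h3 : (5 * (e : ℕ) + 1 + j - 1) / 5 < m := by rw [h1]; exact e.2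
  rw [dif_pos h3]
  congr 1
  exact Fin.ext h1

lemma arc_inj {e e' : Fin m} {j j' : ℕ} (hj : j < 5) (hj' : j' < 5) (h : arc e j = arc e' j') :
    e = e' ∧ j = j' := by
  unfold arc at h
  exact ⟨Fin.ext (by omega), by omega⟩

lemma mem_arcs {a : ℕ} : a ∈ Icc 1 (5 * m) ↔ ∃ e : Fin m, ∃ j < 5, a = arc e j := by
  rw [Finset.mem_Icc]
  constructor
  · intro h
    exact ⟨⟨(a - 1) / 5, by omega⟩, (a - 1) % 5, by omega, by unfold arc; simp only; omega⟩
  · rintro ⟨e, j, hj, rfl⟩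
    unfold arc
    have := e.2
    omega

lemma arc_mem (e : Fin m) {j : ℕ} (hj : j < 5) : arc e j ∈ Icc 1 (5 * m) :=
  mem_arcs.2 ⟨e, j, hj, rfl⟩

/-- Every edge `e` is split into five arcs: the forced part of `e` becomes an arc `0` out of the hub
and an arc `1` into the hub, the optional part becomes the arc `2`, the forbidden part becomes the
excess arc `3` into the hub and its mirror arc `4` out of the hub. -/
def split (h : ∀ e, I.lower e ≤ I.ub e) : ArcNet where
  size := 5 * m
  hub := n
  tl := onArc (fun e j => if j = 0 ∨ j = 4 then n else I.vtx (I.tail e)) n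
  hd := onArc (fun e j => if j = 1 ∨ j = 3 then n else I.vtx (I.head e)) n
  outR := onArc (fun e _ => I.outRank e) 0
  inR := onArc (fun e _ => I.inRank e) 0
  cap := onArc (fun e j => if j ≤ 1 then I.lower e else if j = 2 then I.ub e - I.lower e else
    I.cap e - I.ub e) 0
  -- `arc e 3 + 1` is `arc e 4`, the mirror arc. Numbering starts at `1`, so that `0` can stand for
  -- the absence of an arc.
  IsExcess a := ∃ e : Fin m, a = arc e 3
  cap_nonneg := by
    intro a ha
    obtain ⟨e, j, hj, rfl⟩ := mem_arcs.1 ha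
    rw [onArc_arc _ _ _ hj]
    split_ifs
    · exact I.lower_nonneg e
    · exact sub_nonneg.2 (h e)
    · exact sub_nonneg.2 (min_le_right _ _)
  excess_mem := by
    rintro a ⟨e, rfl⟩
    exact arc_mem e (by omega)
  excess_hd := by
    rintro a ⟨e, rfl⟩
    rw [onArc_arc _ _ _ (by omega)]
    simp
  mirror_tl := by
    rintro a ⟨e, rfl⟩
    rw [show arc e 3 + 1 = arc e 4 from rfl, onArc_arc _ _ _ (by omega)]
    simp
  mirror_not_excess := by
    rintro a ⟨e, rfl⟩ ⟨e', h⟩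
    have := (arc_inj (by omega) (by omega) (show arc e 4 = arc e' 3 from h)).2
    omega
  mirror_cap := by
    rintro a ⟨e, rfl⟩
    rw [show arc e 3 + 1 = arc e 4 from rfl, onArc_arc _ _ _ (by omega),
      onArc_arc _ _ _ (by omega)]
    simp

variable {I} (h : ∀ e, I.lower e ≤ I.ub e)

section Values

variable (e : Fin m) {j : ℕ}

lemma split_arcs : (I.split h).arcs = Icc 1 (5 * m) := rfl

lemma split_tl (hj : j < 5) :
    (I.split h).tl (arc e j) = if j = 0 ∨ j = 4 then n else I.vtx (I.tail e) :=
  onArc_arc (fun e j => if j = 0 ∨ j = 4 then n else I.vtx (I.tail e)) n e hj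

lemma split_hd (hj : j < 5) :
    (I.split h).hd (arc e j) = if j = 1 ∨ j = 3 then n else I.vtx (I.head e) :=
  onArc_arc (fun e j => if j = 1 ∨ j = 3 then n else I.vtx (I.head e)) n e hj

lemma split_outR (hj : j < 5) : (I.split h).outR (arc e j) = I.outRank e :=
  onArc_arc (fun e _ => I.outRank e) 0 e hj

lemma split_inR (hj : j < 5) : (I.split h).inR (arc e j) = I.inRank e :=
  onArc_arc (fun e _ => I.inRank e) 0 e hj

lemma split_cap (hj : j < 5) : (I.split h).cap (arc e j) = if j ≤ 1 then I.lower e else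
    if j = 2 then I.ub e - I.lower e else I.cap e - I.ub e :=
  onArc_arc (fun e j => if j ≤ 1 then I.lower e else if j = 2 then I.ub e - I.lower e else
    I.cap e - I.ub e) 0 e hj

lemma split_excess (hj : j < 5) : (I.split h).IsExcess (arc e j) ↔ j = 3 := by
  constructor
  · rintro ⟨e', he⟩
    exact (arc_inj hj (by omega) he).2
  · rintro rfl
    exact ⟨e, rfl⟩

lemma split_excess_pred (hj : j < 5) : (I.split h).IsExcess (arc e j - 1) ↔ j = 4 := by
  constructor
  · rintro ⟨e', he⟩
    unfold arc at he
    omega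
  · rintro rfl
    exact ⟨e, rfl⟩

end Values

lemma vtx_eq_hub {v : Fin n} : I.vtx v = n ↔ I.terminal v = true := by
  unfold vtx
  split_ifs with h1
  · simp [h1]
  · simp only [h1]
    exact iff_of_false (by have := v.2; omega) (by simp)

lemma vtx_eq {v w : Fin n} (hv : I.terminal v = false) : I.vtx w = v ↔ w = v := by
  unfold vtx
  split_ifs with h1
  · refine iff_of_false (by have := v.2; omega) ?_
    rintro rfl
    rw [hv] at h1
    cases h1
  · exact ⟨fun h => Fin.ext h, fun h => h ▸ rfl⟩

lemma vtx_of_not {v : Fin n} (hv : I.terminal v = false) : I.vtx v = v := (vtx_eq hv).2 rfl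

/-- A nonterminal vertex is not identified with any other vertex. -/
lemma eq_of_vtx_eq {v w : Fin n} (hv : I.vtx v ≠ n) (h : I.vtx w = I.vtx v) : w = v := by
  have : I.terminal v = false := by
    rw [← Bool.not_eq_true, ← vtx_eq_hub (I := I)]; exact hv
  rw [vtx_of_not this] at h
  exact (vtx_eq this).1 h

lemma sum_arcs (F : ℕ → ℝ) :
    ∑ a ∈ Icc 1 (5 * m), F a = ∑ e : Fin m, ∑ j ∈ Finset.range 5, F (arc e j) := by
  have key : ∀ k, ∑ a ∈ Icc 1 (5 * k), F a =
      ∑ e ∈ Finset.range k, ∑ j ∈ Finset.range 5, F (5 * e + 1 + j) := by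
    intro k
    induction k with
    | zero => simp
    | succ k ih =>
      rw [Finset.sum_range_succ, ← ih, show 5 * (k + 1) = 5 * k + 4 + 1 by ring]
      simp only [Finset.sum_range_succ, Finset.sum_range_zero]
      iterate 5 rw [Finset.sum_Icc_succ_top (by omega)]
      ring_nf
  rw [key, Finset.sum_range]
  rfl

lemma net_split (f : ℕ → ℝ) {v : Fin n} (hv : I.terminal v = false) :
    (I.split h).net f v = ∑ e with I.head e = v, (f (arc e 0) + f (arc e 2) + f (arc e 4)) -
      ∑ e with I.tail e = v, (f (arc e 1) + f (arc e 2) + f (arc e 3)) := by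
  unfold ArcNet.net
  rw [split_arcs, sum_arcs, Finset.sum_filter, Finset.sum_filter, ← Finset.sum_sub_distrib]
  refine Finset.sum_congr rfl fun e _ => ?_
  have hn : n ≠ (v : ℕ) := v.2.ne'
  simp only [Finset.sum_range_succ, Finset.sum_range_zero]
  rw [split_tl h e (by omega), split_tl h e (by omega), split_tl h e (by omega),
    split_tl h e (by omega), split_tl h e (by omega), split_hd h e (by omega),
    split_hd h e (by omega), split_hd h e (by omega), split_hd h e (by omega),
    split_hd h e (by omega)]
  simp only [or_true, if_true, hn, if_false, one_ne_zero, zero_ne_one,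
    OfNat.ofNat_ne_zero, OfNat.ofNat_ne_one, Nat.reduceEqDiff, or_false, or_self, vtx_eq hv,
    OfNat.zero_ne_ofNat, OfNat.one_ne_ofNat]
  split_ifs <;> ring

/-! ### From stable flows to witnesses. -/

/-- The edge `e` begins an unsaturated walk that dominates `g` at its end. -/
inductive Wanted (I : Network n m) (g : Fin m → ℝ) : Fin m → Prop
  | last (e : Fin m) (hlt : g e < I.cap e) (hend : I.DominatesAtEnd g e) : Wanted I g e
  | cons (e e' : Fin m) (hlt : g e < I.cap e) (hw : I.head e = I.tail e') (hend : Wanted I g e') :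
      Wanted I g e

lemma Wanted.exists_walk {g : Fin m → ℝ} {e : Fin m} (hw : Wanted I g e) :
    ∃ L : List (Fin m), (e :: L).IsChain (fun e e' => I.head e = I.tail e') ∧
      (∀ e' ∈ e :: L, g e' < I.cap e') ∧ I.DominatesAtEnd g ((e :: L).getLast (by simp)) := by
  induction hw with
  | last e hlt hend => exact ⟨[], by simp, by simpa using hlt, by simpa using hend⟩
  | cons e e' hlt hw _ ih =>
    obtain ⟨L, h1, h2, h3⟩ := ih
    refine ⟨e' :: L, List.isChain_cons_cons.2 ⟨hw, h1⟩, ?_, ?_⟩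
    · intro e'' he
      rcases List.mem_cons.1 he with rfl | he
      · exact hlt
      · exact h2 e'' he
    · rwa [List.getLast_cons (by simp)]

/-- Domination at the start would complete a blocking walk. The absence of blocking walks of `g`
enters the comparison only here. -/
lemma Wanted.not_dominates {g : Fin m → ℝ} {e : Fin m} (hw : Wanted I g e)
    (hg : I.IsStableFlow g) : ¬ I.DominatesAtStart g e := by
  intro hs
  obtain ⟨L, h1, h2, h3⟩ := hw.exists_walk
  exact hg.2 ⟨e :: L, by simp, h1, h2, hs, h3⟩

/-- The circulation corresponding to a flow that respects the bounds. -/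
def lift (I : Network n m) (g : Fin m → ℝ) : ℕ → ℝ :=
  onArc (fun e j => if j ≤ 1 then I.lower e else if j = 2 then g e - I.lower e else 0) 0

lemma lift_arc (g : Fin m → ℝ) (e : Fin m) {j : ℕ} (hj : j < 5) : I.lift g (arc e j) =
    if j ≤ 1 then I.lower e else if j = 2 then g e - I.lower e else 0 := onArc_arc _ _ _ hj

/-- The optional and excess arcs of wanted edges. -/
def wantedArcs (I : Network n m) (g : Fin m → ℝ) : Set ℕ :=
  {a | ∃ e, (a = arc e 2 ∨ a = arc e 3) ∧ Wanted I g e}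

/-- The excess arcs of edges that are not wanted. -/
def unwantedExcess (I : Network n m) (g : Fin m → ℝ) : Set ℕ :=
  {a | ∃ e, a = arc e 3 ∧ ¬ Wanted I g e}

lemma le_ub {g : Fin m → ℝ} (hg : I.IsRestrictedStableFlow g) (e : Fin m) : g e ≤ I.ub e :=
  le_min (hg.2.2 e) (hg.1.1.le_cap e)

lemma ub_le_cap (e : Fin m) : I.ub e ≤ I.cap e := min_le_right _ _

lemma wanted_of_mem {g : Fin m → ℝ} {e : Fin m} {j : ℕ} (hj : j < 5)
    (hm : arc e j ∈ I.wantedArcs g) : Wanted I g e ∧ (j = 2 ∨ j = 3) := by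
  obtain ⟨e', h1 | h1, h2⟩ := hm
  · obtain ⟨rfl, rfl⟩ := arc_inj hj (by omega) h1
    exact ⟨h2, Or.inl rfl⟩
  · obtain ⟨rfl, rfl⟩ := arc_inj hj (by omega) h1
    exact ⟨h2, Or.inr rfl⟩

lemma not_wanted_of_mem {g : Fin m → ℝ} {e : Fin m} (hm : arc e 3 ∈ I.unwantedExcess g) :
    ¬ Wanted I g e := by
  obtain ⟨e', h1, h2⟩ := hm
  obtain ⟨rfl, -⟩ := arc_inj (by omega) (by omega) h1
  exact h2

/-- On an arc that `lift g` does not saturate, `g` does not saturate the edge. -/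
lemma mem_wantedArcs_of_lt {g : Fin m → ℝ} (hg : I.IsRestrictedStableFlow g) {e : Fin m} {j : ℕ}
    (hj : j < 5) (hlt : I.lift g (arc e j) < (I.split h).cap (arc e j))
    (hact : (I.split h).IsExcess (arc e j - 1) → arc e j - 1 ∈ I.unwantedExcess g)
    (hact' : ¬ ((I.split h).IsExcess (arc e j) ∧ arc e j ∈ I.unwantedExcess g))
    (hw : g e < I.cap e → j ≠ 3 → Wanted I g e) : arc e j ∈ I.wantedArcs g := by
  rw [lift_arc g e hj, split_cap h e hj] at hlt
  have h1 := le_ub hg e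
  have h2 := ub_le_cap (I := I) e
  rw [split_excess_pred h e hj] at hact
  rw [split_excess h e hj] at hact'
  interval_cases j
  · simp at hlt
  · simp at hlt
  · simp only [Nat.not_ofNat_le_one, if_false, if_true] at hlt
    exact ⟨e, Or.inl rfl, hw (by linarith) (by omega)⟩
  · refine ⟨e, Or.inr rfl, ?_⟩
    by_contra hcon
    exact hact' ⟨rfl, e, rfl, hcon⟩
  -- An open mirror arc belongs to an unwanted edge, whereas `hw` would make the edge wanted; this
  -- case cannot occur.
  · simp only [Nat.not_ofNat_le_one, if_false, Nat.reduceEqDiff] at hlt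
    exact absurd (hw (by linarith) (by omega)) (not_wanted_of_mem (hact rfl))

/-- Stable flows that respect the bounds yield witnesses. -/
lemma witness_lift {g : Fin m → ℝ} (hg : I.IsRestrictedStableFlow g) :
    (I.split h).Witness (I.lift g) (I.wantedArcs g) (I.unwantedExcess g) where
  nonneg a ha := by
    obtain ⟨e, j, hj, rfl⟩ := mem_arcs.1 ha
    rw [lift_arc g e hj]
    split_ifs
    · exact I.lower_nonneg e
    · exact sub_nonneg.2 (hg.2.1 e)
    · exact le_rfl
  le_cap a ha := by
    obtain ⟨e, j, hj, rfl⟩ := mem_arcs.1 ha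
    rw [lift_arc g e hj, split_cap h e hj]
    split_ifs
    · exact le_rfl
    · linarith [le_ub hg e]
    · exact sub_nonneg.2 (ub_le_cap e)
  circ v hv := by
    by_cases hv' : ∃ w : Fin n, I.terminal w = false ∧ (w : ℕ) = v
    · obtain ⟨w, hw, rfl⟩ := hv'
      rw [net_split h _ hw]
      have := hg.1.1.kirchhoff w hw
      simp only [lift_arc g _ (show 0 < 5 by omega), lift_arc g _ (show 1 < 5 by omega),
        lift_arc g _ (show 2 < 5 by omega), lift_arc g _ (show 3 < 5 by omega),
        lift_arc g _ (show 4 < 5 by omega)]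
      simp [this]
    · have hne : ∀ w, I.vtx w ≠ v := by
        intro w hw
        refine hv' ⟨w, ?_, ?_⟩
        · rw [← Bool.not_eq_true, ← vtx_eq_hub (I := I), hw]; exact hv
        · rw [← hw, vtx_of_not]
          rw [← Bool.not_eq_true, ← vtx_eq_hub (I := I), hw]; exact hv
      refine Finset.sum_eq_zero fun a ha => ?_
      obtain ⟨e, j, hj, rfl⟩ := mem_arcs.1 ha
      have hv2 : n ≠ v := fun h => hv h.symm
      rw [split_tl h e hj, split_hd h e hj, if_neg, if_neg, sub_zero]
      · split_ifs
        · exact hv2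
        · exact hne _
      · split_ifs
        · exact hv2
        · exact hne _
  excess := by
    rintro a ⟨e, rfl⟩
    simp [lift_arc]
  mirror := by
    rintro a ⟨e, rfl⟩
    rw [show arc e 3 + 1 = arc e 4 from rfl, lift_arc g e (by omega)]
    simp
  start := by
    intro a ha haD
    obtain ⟨e, j, hj, rfl⟩ := mem_arcs.1 ha
    obtain ⟨hw, hj'⟩ := wanted_of_mem hj haD
    have hnd := hw.not_dominates hg.1
    have htl : (I.split h).tl (arc e j) = I.vtx (I.tail e) := by
      rw [split_tl h e hj, if_neg (by omega)]
    have hub : I.vtx (I.tail e) ≠ n := fun h1 => hnd (Or.inl (vtx_eq_hub.1 h1))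
    rw [htl]
    refine ⟨hub, fun b hb hbt hlt => ?_⟩
    obtain ⟨e', i, hi, rfl⟩ := mem_arcs.1 hb
    rw [split_tl h e' hi] at hbt
    split_ifs at hbt with h1
    · exact absurd hbt.symm hub
    have het := eq_of_vtx_eq hub hbt
    unfold ArcNet.OutBetter at hlt
    rw [split_outR h e hj, split_outR h e' hi] at hlt
    rw [lift_arc g e' hi]
    have hlow := I.lower_nonneg e'
    have hge := hg.2.1 e'
    -- Between parts of the same edge the numbering decides: at the tail, only the excess arc can
    -- come after an arc of `D`, and the lift vanishes on it.
    by_cases hee : e' = e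
    · subst hee
      have : i = 3 := by unfold arc at hlt; omega
      subst this
      simp
    · have hrank : I.outRank e < I.outRank e' := by
        rcases hlt with hlt | hlt
        · exact hlt
        · refine absurd (I.outRank_strict e' e het ?_ hlt.1.symm) hee
          rw [het, ← Bool.not_eq_true, ← vtx_eq_hub (I := I)]; exact hub
      have hz : g e' ≤ 0 := by
        by_contra hpos
        exact hnd (Or.inr ⟨e', het, not_le.1 hpos, hrank⟩)
      split_ifs <;> linarith
  extend a ha hlt hub hact b hb hbD hbt := by
    obtain ⟨e, j, hj, rfl⟩ := mem_arcs.1 ha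
    obtain ⟨e', i, hi, rfl⟩ := mem_arcs.1 hb
    obtain ⟨hw, hi'⟩ := wanted_of_mem hi hbD
    rw [split_hd h e hj] at hub hbt
    rw [split_tl h e' hi, if_neg (by omega)] at hbt
    have hj' : ¬ (j = 1 ∨ j = 3) := fun h1 => hub (if_pos h1)
    rw [if_neg hj'] at hub hbt
    refine mem_wantedArcs_of_lt h hg hj hlt hact ?_ fun h1 _ =>
      Wanted.cons e e' h1 (eq_of_vtx_eq hub hbt).symm hw
    rw [split_excess h e hj]; omega
  dominate a ha hlt hub hact b hb hbt hbet hpos := by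
    obtain ⟨e, j, hj, rfl⟩ := mem_arcs.1 ha
    obtain ⟨e', i, hi, rfl⟩ := mem_arcs.1 hb
    rw [split_hd h e hj] at hub hbt
    have hj' : ¬ (j = 1 ∨ j = 3) := fun h1 => hub (if_pos h1)
    rw [if_neg hj'] at hub hbt
    rw [split_hd h e' hi] at hbt
    split_ifs at hbt with hi'
    · exact absurd hbt.symm hub
    have het := eq_of_vtx_eq hub hbt
    have hlow := I.lower_nonneg e'
    have hge := hg.2.1 e'
    refine mem_wantedArcs_of_lt h hg hj hlt hact (by rw [split_excess h e hj]; omega) fun h1 _ =>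
      Wanted.last e h1 (Or.inr ⟨e', het, ?_, ?_⟩)
    · rw [lift_arc g e' hi] at hpos
      split_ifs at hpos <;> linarith
    · unfold ArcNet.InBetter at hbet
      rw [split_inR h e hj, split_inR h e' hi] at hbet
      rcases hbet with hbet | hbet
      · exact hbet
      exfalso
      have hee : e' = e := by
        refine I.inRank_strict e' e het ?_ hbet.1.symm
        rw [het, ← Bool.not_eq_true, ← vtx_eq_hub (I := I)]; exact hub
      subst hee
      -- Among the arcs `0`, `2`, `4` of one edge at its head, arc `0` is full and arc `4` is empty,
      -- so no arc with room left precedes one with flow.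
      have hji : j < i := by have := hbet.2; unfold arc at this; omega
      rw [lift_arc g e' hi] at hpos
      rw [lift_arc g e' hj, split_cap h e' hj] at hlt
      split_ifs at hpos hlt <;> first | omega | linarith
  hub a ha hlt hub hact hact' := by
    obtain ⟨e, j, hj, rfl⟩ := mem_arcs.1 ha
    refine mem_wantedArcs_of_lt h hg hj hlt hact hact' fun h1 h2 =>
      Wanted.last e h1 (Or.inl ?_)
    rw [split_hd h e hj] at hub
    rw [lift_arc g e hj, split_cap h e hj] at hlt
    split_ifs at hub hlt with h3 h4 h5 h6
    all_goals first | omega | exact absurd hlt (lt_irrefl _) | exact vtx_eq_hub.1 hub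

end Network

/-! ### From accepted circulations to stable flows that respect the bounds. -/

namespace Network

variable {n m : ℕ} {I : Network n m} (h : ∀ e, I.lower e ≤ I.ub e) {f : ℕ → ℝ} {R : Set ℕ}

/-- The circulation uses the forced parts of the edge `e` fully and its forbidden part not at all. -/
def AcceptedAt (I : Network n m) (f : ℕ → ℝ) (e : Fin m) : Prop :=
  I.lower e ≤ f (arc e 0) ∧ I.lower e ≤ f (arc e 1) ∧ f (arc e 3) ≤ 0 ∧ f (arc e 4) ≤ 0

/-- The circulation is accepted at all edges. -/
def Accepted (I : Network n m) (f : ℕ → ℝ) : Prop := ∀ e, I.AcceptedAt f e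

/-- The flow read off from a circulation. -/
def merge (f : ℕ → ℝ) (e : Fin m) : ℝ := f (arc e 0) + f (arc e 2)

lemma dcap_arc (e : Fin m) {j : ℕ} (hj : j < 4) :
    (I.split h).dcap R (arc e j) = (I.split h).cap (arc e j) := by
  unfold ArcNet.dcap
  rw [if_neg]
  rw [split_excess_pred h e (by omega)]
  omega

/-- If some stable flow respects the bounds, then the final circulation is accepted. -/
lemma accepted_of_exists (hI : (I.split h).Inv f R) {g : Fin m → ℝ}
    (hg : I.IsRestrictedStableFlow g)
    (hJ : (I.split h).Compat (I.lift g) (I.unwantedExcess g) f R)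
    (hout : ∀ a ∈ (I.split h).arcs, (I.split h).tl a = n → ¬ (I.split h).Avail f R a)
    (hex : ∀ q, (I.split h).IsExcess q → f q = 0) : I.Accepted f := by
  have key := ArcNet.eq_at_hub hI (witness_lift h hg) hJ hout hex
  intro e
  have h0 := key (arc e 0) (arc_mem e (by omega)) (Or.inl (by rw [split_tl]; rfl; omega))
  have h1 := key (arc e 1) (arc_mem e (by omega)) (Or.inr (by rw [split_hd]; rfl; omega))
  have h3 := key (arc e 3) (arc_mem e (by omega)) (Or.inr (by rw [split_hd]; rfl; omega))
  have h4 := key (arc e 4) (arc_mem e (by omega)) (Or.inl (by rw [split_tl]; rfl; omega))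
  rw [lift_arc g e (by omega)] at h0 h1 h3 h4
  simp at h0 h1 h3 h4
  exact ⟨h0.ge, h1.ge, h3.le, h4.le⟩

section Accepted

variable (hI : (I.split h).Inv f R) (hA : I.Accepted f)

include hI hA

lemma values (e : Fin m) : f (arc e 0) = I.lower e ∧ f (arc e 1) = I.lower e ∧ 0 ≤ f (arc e 2) ∧
    f (arc e 2) ≤ I.ub e - I.lower e ∧ f (arc e 3) = 0 ∧ f (arc e 4) = 0 := by
  obtain ⟨h0, h1, h3, h4⟩ := hA e
  have k0 := hI.le_dcap (arc e 0) (arc_mem e (by omega))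
  have k1 := hI.le_dcap (arc e 1) (arc_mem e (by omega))
  have k2 := hI.le_dcap (arc e 2) (arc_mem e (by omega))
  rw [dcap_arc h e (by omega), split_cap h e (by omega)] at k0 k1 k2
  simp at k0 k1 k2
  exact ⟨le_antisymm k0 h0, le_antisymm k1 h1, hI.nonneg _ (arc_mem e (by omega)), by linarith,
    le_antisymm h3 (hI.nonneg _ (arc_mem e (by omega))),
    le_antisymm h4 (hI.nonneg _ (arc_mem e (by omega)))⟩

/-- With forced arcs full and excess and mirror arcs empty, the parts of an edge at its tail and
those at its head carry the same total, so conservation in the arc network is Kirchhoff's law. -/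
lemma isFlow_merge : I.IsFlow (merge f) where
  nonneg e := by
    have := values h hI hA e
    unfold merge
    linarith [I.lower_nonneg e]
  le_cap e := by
    have := values h hI hA e
    unfold merge
    linarith [ub_le_cap (I := I) e]
  kirchhoff v hv := by
    have := hI.circ v
    rw [net_split h f hv, sub_eq_zero] at this
    unfold merge
    rw [Finset.sum_congr rfl fun e _ => ?_, this, Finset.sum_congr rfl fun e _ => ?_]
    · obtain ⟨h0, h1, -, -, h3, -⟩ := values h hI hA e
      rw [h0, h1, h3, add_zero]
    · obtain ⟨-, -, -, -, -, h4⟩ := values h hI hA e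
      rw [h4, add_zero]

/-- An unsaturated edge that cannot take flow at its tail is rejected by its head. -/
lemma rejected_of_not_avail (hout : ∀ a ∈ (I.split h).arcs, (I.split h).tl a = n →
    ¬ (I.split h).Avail f R a) {e : Fin m} (hlt : merge f e < I.cap e)
    (h2 : ¬ (I.split h).Avail f R (arc e 2)) (h3 : ¬ (I.split h).Avail f R (arc e 3)) :
    arc e 2 ∈ R ∨ arc e 4 ∈ R := by
  obtain ⟨v0, -, -, v2, v3, v4⟩ := values h hI hA e
  unfold merge at hlt
  unfold ArcNet.Avail at h2 h3
  rw [dcap_arc h e (by omega), split_cap h e (by omega)] at h2 h3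
  simp at h2 h3
  by_cases hsat : f (arc e 2) < I.ub e - I.lower e
  · left
    by_contra hR
    linarith [h2 hR]
  -- The optional arc is full. The empty excess arc has room left, so it is unavailable only through
  -- being in `R`; then its mirror arc is open and empty, and since the hub is inactive, that arc
  -- must have been rejected.
  right
  have hpos : I.ub e < I.cap e := by linarith
  have hR3 : arc e 3 ∈ R := by
    by_contra hR
    linarith [h3 hR]
  by_contra hR
  refine hout (arc e 4) (arc_mem e (by omega)) (by rw [split_tl]; rfl; omega) ⟨hR, ?_⟩
  unfold ArcNet.dcap
  rw [if_neg (fun h => h.2 hR3), split_cap h e (by omega)]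
  simp
  linarith

/-- An accepted circulation with inactive hub yields a stable flow that respects the bounds. -/
lemma isRestrictedStableFlow_merge (hout : ∀ a ∈ (I.split h).arcs, (I.split h).tl a = n →
    ¬ (I.split h).Avail f R a) : I.IsRestrictedStableFlow (merge f) := by
  refine ⟨⟨isFlow_merge h hI hA, ?_⟩, fun e => ?_, fun e => ?_⟩
  · rintro ⟨L, hne, hwalk, hunsat, hstart, hend⟩
    have hrej : ∀ e, (arc e 2 ∈ R ∨ arc e 4 ∈ R) → ∃ j < 5, (j = 2 ∨ j = 4) ∧ arc e j ∈ R ∧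
        ¬ (I.split h).IsExcess (arc e j) ∧ (I.split h).hd (arc e j) = I.vtx (I.head e) := by
      rintro e (hR | hR)
      · refine ⟨2, by omega, Or.inl rfl, hR, ?_, ?_⟩
        · rw [split_excess h e (by omega)]; omega
        · rw [split_hd h e (by omega)]; rfl
      · refine ⟨4, by omega, Or.inr rfl, hR, ?_, ?_⟩
        · rw [split_excess h e (by omega)]; omega
        · rw [split_hd h e (by omega)]; rfl
    -- Rejection propagates: the head of a rejected arc has no available out-arc, so the next
    -- unsaturated edge of the walk is rejected too.
    have hlast : ∀ (L : List (Fin m)) (hne : L ≠ []),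
        L.IsChain (fun e e' => I.head e = I.tail e') → (∀ e ∈ L, merge f e < I.cap e) →
        (arc (L.head hne) 2 ∈ R ∨ arc (L.head hne) 4 ∈ R) →
        (arc (L.getLast hne) 2 ∈ R ∨ arc (L.getLast hne) 4 ∈ R) := by
      intro L
      induction L with
      | nil => exact fun hne => absurd rfl hne
      | cons e L ih =>
        intro hne hwalk hunsat hR
        cases L with
        | nil => exact hR
        | cons e' L =>
          rw [List.isChain_cons_cons] at hwalk
          rw [List.getLast_cons (by simp)]
          refine ih (by simp) hwalk.2 (fun e he => hunsat e (List.mem_cons_of_mem _ he)) ?_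
          change arc e' 2 ∈ R ∨ arc e' 4 ∈ R
          obtain ⟨j, hj, -, hR, hex, hhd⟩ := hrej e hR
          have hmem := arc_mem e hj
          have hna := hI.rej_out _ hmem hR hex
          rw [hhd, hwalk.1] at hna
          refine rejected_of_not_avail h hI hA hout (hunsat e' (by simp)) ?_ ?_
          · exact hna _ (arc_mem e' (by omega)) (by rw [split_tl h e' (by omega)]; rfl)
          · exact hna _ (arc_mem e' (by omega)) (by rw [split_tl h e' (by omega)]; rfl)
    -- At a terminal tail nothing is available because the hub is inactive; at any other tail, flow
    -- on a worse out-edge means that the better arcs are unavailable.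
    have hfirst : ∀ e, merge f e < I.cap e → I.DominatesAtStart (merge f) e →
        arc e 2 ∈ R ∨ arc e 4 ∈ R := by
      intro e hlt hs
      have htl : ∀ i, i = 1 ∨ i = 2 ∨ i = 3 → ∀ e : Fin m,
          (I.split h).tl (arc e i) = I.vtx (I.tail e) := by
        intro i hi e
        rw [split_tl h e (by omega), if_neg (by omega)]
      have key : ∀ i, i = 2 ∨ i = 3 → ¬ (I.split h).Avail f R (arc e i) := by
        intro i hi
        have hmem := arc_mem e (show i < 5 by omega)
        by_cases hub : I.terminal (I.tail e) = true
        · refine hout _ hmem ?_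
          rw [htl i (by omega), vtx_eq_hub]
          exact hub
        obtain ⟨e', het, hpos, hrank⟩ := hs.resolve_left hub
        have hub' : I.vtx (I.tail e) ≠ n := by rwa [Ne, vtx_eq_hub]
        -- At the tail the forced part is represented by arc `1` instead of arc `0`.
        obtain ⟨k, hk, hkpos⟩ : ∃ k, (k = 1 ∨ k = 2) ∧ 0 < f (arc e' k) := by
          obtain ⟨v0, v1, v2, -⟩ := values h hI hA e'
          unfold merge at hpos
          rcases (I.lower_nonneg e').lt_or_eq with h1 | h1
          · exact ⟨1, Or.inl rfl, by linarith⟩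
          · exact ⟨2, Or.inr rfl, by linarith⟩
        refine hI.prop (arc e' k) (arc_mem e' (by omega)) _ hmem ?_ ?_ hkpos (Or.inl ?_)
        · rw [htl i (by omega), htl k (by omega), het]
        · rw [htl k (by omega), het]; exact hub'
        · rw [split_outR h e (by omega), split_outR h e' (by omega)]; exact hrank
      exact rejected_of_not_avail h hI hA hout hlt (key 2 (Or.inl rfl)) (key 3 (Or.inr rfl))
    -- The last edge is rejected by its head, which therefore is no terminal and receives nothing on
    -- worse in-edges; the walk cannot dominate at its end.
    obtain ⟨j, hj, hj', hR, hex, hhd⟩ := hrej _ (hlast L hne hwalk hunsat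
      (hfirst _ (hunsat _ (List.head_mem hne)) hstart))
    set e := L.getLast hne
    have hmem := arc_mem e hj
    have hub := hI.rej_hd _ hmem hR hex
    rw [hhd] at hub
    rcases hend with hend | ⟨e', hee, hpos, hrank⟩
    · exact hub (vtx_eq_hub.2 hend)
    · have hz : ∀ k, k = 0 ∨ k = 2 → f (arc e' k) = 0 := by
        intro k hk
        refine (hI.rej_in _ hmem hR hex (arc e' k) (arc_mem e' (by omega)) ?_ (Or.inl ?_)).2
        · rw [hhd, split_hd h e' (by omega), if_neg (by omega), hee]
        · rw [split_inR h e hj, split_inR h e' (by omega)]; exact hrank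
      unfold merge at hpos
      rw [hz 0 (Or.inl rfl), hz 2 (Or.inr rfl)] at hpos
      linarith
  · have := values h hI hA e
    unfold merge
    linarith
  · have := values h hI hA e
    have h1 : I.ub e ≤ I.upper e := min_le_left _ _
    unfold merge
    linarith

end Accepted

end Network

/-! ## Reasoning about programs -/

namespace Program

/-- Straight-line programs. -/
def ops : List Op → Program
  | [] => skip
  | o :: l => seq (op o) (ops l)

/-- The natural-number registers that a program may change. -/
def natRegs : Program → List ℕ
  | skip => []
  | op (.natConst d _) => [d]
  | op (.natCopy d _) => [d]
  | op (.natSucc d) => [d]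
  | op (.natPred d) => [d]
  | op (.natLoad d _ _) => [d]
  | op _ => []
  | seq p q => natRegs p ++ natRegs q
  | branch _ p q => natRegs p ++ natRegs q
  | loop _ p => natRegs p

/-- The real registers that a program may change. -/
def realRegs : Program → List ℕ
  | skip => []
  | op (.realZero d) => [d]
  | op (.realCopy d _) => [d]
  | op (.realAdd d _ _) => [d]
  | op (.realSub d _ _) => [d]
  | op (.realLoad d _ _) => [d]
  | op _ => []
  | seq p q => realRegs p ++ realRegs q
  | branch _ p q => realRegs p ++ realRegs q
  | loop _ p => realRegs p

/-- The natural-number arrays that a program may change. -/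
def natArrs : Program → List ℕ
  | skip => []
  | op (.natStore A _ _) => [A]
  | op _ => []
  | seq p q => natArrs p ++ natArrs q
  | branch _ p q => natArrs p ++ natArrs q
  | loop _ p => natArrs p

/-- The real arrays that a program may change. -/
def realArrs : Program → List ℕ
  | skip => []
  | op (.realStore A _ _) => [A]
  | op _ => []
  | seq p q => realArrs p ++ realArrs q
  | branch _ p q => realArrs p ++ realArrs q
  | loop _ p => realArrs p

/-- Programs without loops. -/
def loopFree : Program → Bool
  | skip => true
  | op _ => true
  | seq p q => loopFree p && loopFree q
  | branch _ p q => loopFree p && loopFree q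
  | loop _ _ => false

/-- A bound on the running time of loop-free programs. -/
def cost : Program → ℕ
  | skip => 0
  | op _ => 1
  | seq p q => cost p + cost q
  | branch _ p q => cost p + cost q + 1
  | loop _ _ => 0

open Classical in
/-- The effect of loop-free programs. -/
def eval : Program → Store → Store
  | skip, σ => σ
  | op o, σ => o.apply σ
  | seq p q, σ => q.eval (p.eval σ)
  | branch b p q, σ => if b.Holds σ then p.eval σ else q.eval σ
  | loop _ _, σ => σ

/-- What a program leaves unchanged. -/
structure Frame (p : Program) (σ τ : Store) : Prop where
  natReg : ∀ r ∉ p.natRegs, τ.natReg r = σ.natReg r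
  realReg : ∀ r ∉ p.realRegs, τ.realReg r = σ.realReg r
  natArr : ∀ A ∉ p.natArrs, τ.natArr A = σ.natArr A
  realArr : ∀ A ∉ p.realArrs, τ.realArr A = σ.realArr A

/-- `p` started in `σ` halts within `B` steps in a state satisfying `Q`. -/
def Runs (p : Program) (σ : Store) (B : ℕ) (Q : Store → Prop) : Prop :=
  ∃ t τ, Exec p σ t τ ∧ t ≤ B ∧ Q τ

lemma Frame.refl (p : Program) (σ : Store) : Frame p σ σ :=
  ⟨fun _ _ => rfl, fun _ _ => rfl, fun _ _ => rfl, fun _ _ => rfl⟩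

lemma Frame.trans {p : Program} {σ τ υ : Store} (h1 : Frame p σ τ) (h2 : Frame p τ υ) :
    Frame p σ υ :=
  ⟨fun r h => (h2.1 r h).trans (h1.1 r h), fun r h => (h2.2 r h).trans (h1.2 r h),
    fun r h => (h2.3 r h).trans (h1.3 r h), fun r h => (h2.4 r h).trans (h1.4 r h)⟩

lemma Frame.mono {p q : Program} {σ τ : Store} (h : Frame p σ τ) (h1 : p.natRegs ⊆ q.natRegs)
    (h2 : p.realRegs ⊆ q.realRegs) (h3 : p.natArrs ⊆ q.natArrs) (h4 : p.realArrs ⊆ q.realArrs) :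
    Frame q σ τ :=
  ⟨fun r hr => h.1 r fun h => hr (h1 h), fun r hr => h.2 r fun h => hr (h2 h),
    fun r hr => h.3 r fun h => hr (h3 h), fun r hr => h.4 r fun h => hr (h4 h)⟩

lemma Exec.frame {p : Program} {σ τ : Store} {t : ℕ} (h : Exec p σ t τ) : Frame p σ τ := by
  induction h with
  | skip σ => exact Frame.refl _ _
  | op o σ =>
    cases o <;>
      exact ⟨fun r h => by simp_all [natRegs, Op.apply],
        fun r h => by simp_all [realRegs, Op.apply],
        fun r h => by simp_all [natArrs, Op.apply],
        fun r h => by simp_all [realArrs, Op.apply]⟩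
  | seq _ _ ih1 ih2 =>
    exact (ih1.mono (by simp [natRegs]) (by simp [realRegs]) (by simp [natArrs])
      (by simp [realArrs])).trans (ih2.mono (by simp [natRegs]) (by simp [realRegs])
        (by simp [natArrs]) (by simp [realArrs]))
  | branch_true _ _ ih =>
    exact ih.mono (by simp [natRegs]) (by simp [realRegs]) (by simp [natArrs])
      (by simp [realArrs])
  | branch_false _ _ ih =>
    exact ih.mono (by simp [natRegs]) (by simp [realRegs]) (by simp [natArrs])
      (by simp [realArrs])
  | loop_stop _ => exact Frame.refl _ _
  | loop_step _ _ _ ih1 ih2 =>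
    exact (ih1.mono (by simp [natRegs]) (by simp [realRegs]) (by simp [natArrs])
      (by simp [realArrs])).trans ih2

lemma Runs.frame {p : Program} {σ : Store} {B : ℕ} {Q : Store → Prop} (h : Runs p σ B Q) :
    Runs p σ B fun τ => Frame p σ τ ∧ Q τ := by
  obtain ⟨t, τ, h1, h2, h3⟩ := h
  exact ⟨t, τ, h1, h2, Exec.frame h1, h3⟩

lemma Runs.mono {p : Program} {σ : Store} {B B' : ℕ} {Q Q' : Store → Prop} (h : Runs p σ B Q)
    (hB : B ≤ B') (hQ : ∀ τ, Q τ → Q' τ) : Runs p σ B' Q' := by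
  obtain ⟨t, τ, h1, h2, h3⟩ := h
  exact ⟨t, τ, h1, h2.trans hB, hQ τ h3⟩

lemma Runs.seq {p q : Program} {σ : Store} {B B' : ℕ} {Q Q' : Store → Prop} (h : Runs p σ B Q)
    (h' : ∀ τ, Q τ → Runs q τ B' Q') : Runs (seq p q) σ (B + B') Q' := by
  obtain ⟨t, τ, h1, h2, h3⟩ := h
  obtain ⟨t', τ', h1', h2', h3'⟩ := h' τ h3
  exact ⟨t + t', τ', .seq h1 h1', by omega, h3'⟩

lemma Runs.branch {b : Test} {p q : Program} {σ : Store} {B : ℕ} {Q : Store → Prop}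
    (h : b.Holds σ → Runs p σ B Q) (h' : ¬ b.Holds σ → Runs q σ B Q) :
    Runs (branch b p q) σ (B + 1) Q := by
  by_cases hb : b.Holds σ
  · obtain ⟨t, τ, h1, h2, h3⟩ := h hb
    exact ⟨t + 1, τ, .branch_true hb h1, by omega, h3⟩
  · obtain ⟨t, τ, h1, h2, h3⟩ := h' hb
    exact ⟨t + 1, τ, .branch_false hb h1, by omega, h3⟩

/-- Reduces loop-free programs to the function `eval`, which can be computed by `simp`. For a
branch, `cost` adds both alternatives, so that the bound does not depend on the memory. -/
lemma runs_of_loopFree {p : Program} (h : p.loopFree = true) (σ : Store) :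
    Runs p σ p.cost (· = p.eval σ) := by
  induction p generalizing σ with
  | skip => exact ⟨0, σ, .skip σ, le_rfl, rfl⟩
  | op o => exact ⟨1, o.apply σ, .op o σ, le_rfl, rfl⟩
  | seq p q ihp ihq =>
    simp only [loopFree, Bool.and_eq_true] at h
    exact (ihp h.1 σ).seq fun τ hτ => by subst hτ; exact ihq h.2 _
  | branch b p q ihp ihq =>
    simp only [loopFree, Bool.and_eq_true] at h
    refine (Runs.branch (B := p.cost + q.cost) (fun hb => ?_) fun hb => ?_)
    · exact (ihp h.1 σ).mono (by omega) fun τ hτ => by rw [hτ, eval, if_pos hb]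
    · exact (ihq h.2 σ).mono (by omega) fun τ hτ => by rw [hτ, eval, if_neg hb]
  | loop b p => cases h

lemma eval_frame {p : Program} (h : p.loopFree = true) (σ : Store) : Frame p σ (p.eval σ) := by
  obtain ⟨t, τ, h1, -, rfl⟩ := runs_of_loopFree h σ
  exact Exec.frame h1

/-- Loops with an invariant that determines the number of rounds. -/
lemma Runs.loop {b : Test} {p : Program} {c : ℕ} (k : ℕ) (P : ℕ → Store → Prop)
    (hbody : ∀ j < k, ∀ σ, P j σ → b.Holds σ ∧ Runs p σ c (P (j + 1)))
    (hexit : ∀ σ, P k σ → ¬ b.Holds σ) {σ : Store} (h0 : P 0 σ) :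
    Runs (loop b p) σ (k * (c + 1) + 1) (P k) := by
  have key : ∀ d ≤ k, ∀ σ, P (k - d) σ → Runs (Program.loop b p) σ (d * (c + 1) + 1) (P k) := by
    intro d
    induction d with
    | zero =>
      intro _ σ hσ
      exact ⟨1, σ, Exec.loop_stop (hexit σ hσ), by omega, hσ⟩
    | succ d ih =>
      intro hd σ hσ
      obtain ⟨hb, t, τ, h1, h2, h3⟩ := hbody _ (by omega) σ hσ
      rw [show k - (d + 1) + 1 = k - d by omega] at h3
      obtain ⟨t', τ', h1', h2', h3'⟩ := ih (by omega) τ h3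
      exact ⟨t + t' + 1, τ', .loop_step hb h1 h1', by rw [Nat.succ_mul]; omega, h3'⟩
  exact key k le_rfl σ (by rwa [Nat.sub_self])

/-- Loops whose rounds decrease a potential. -/
lemma Runs.loop_of_decreasing {b : Test} {p : Program} {c : ℕ} (P : ℕ → Store → Prop)
    (Q : Store → Prop)
    (hbody : ∀ k σ, P k σ → b.Holds σ ∧
      Runs p σ c fun τ => (∃ k' < k, P k' τ) ∨ (Q τ ∧ ¬ b.Holds τ)) (k : ℕ) {σ : Store}
    (h0 : P k σ) : Runs (Program.loop b p) σ ((k + 1) * (c + 1) + 1) Q := by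
  induction k using Nat.strong_induction_on generalizing σ with
  | _ k ih =>
    obtain ⟨hb, t, τ, h1, h2, ⟨k', hk', h3⟩ | ⟨h3, h4⟩⟩ := hbody k σ h0
    · obtain ⟨t', τ', h1', h2', h3'⟩ := ih k' hk' h3
      refine ⟨t + t' + 1, τ', .loop_step hb h1 h1', ?_, h3'⟩
      have : (k' + 1 + 1) * (c + 1) ≤ (k + 1) * (c + 1) := Nat.mul_le_mul_right _ (by omega)
      rw [Nat.succ_mul] at this
      omega
    · refine ⟨t + 1 + 1, τ, .loop_step hb h1 (Exec.loop_stop h4), ?_, h3⟩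
      have : 1 * (c + 1) ≤ (k + 1) * (c + 1) := Nat.mul_le_mul_right _ (by omega)
      omega

/-- The programs that keep the representation of the instance and the current circulation. -/
def KeepsData (p : Program) : Prop :=
  (∀ r ∈ p.natRegs, 5 ≤ r) ∧ (∀ r ∈ p.realRegs, 1 ≤ r) ∧ (∀ A ∈ p.natArrs, 11 ≤ A) ∧
    p.realArrs = []

instance (p : Program) : Decidable p.KeepsData := by unfold KeepsData; infer_instance

end Program

/-! ### The representation of a network and a state in memory, and scans over all arcs. -/

open Program

open Classical in
/-- The memory holds the arc network `T`, the lower bounds `L`, and the state `f`, `R`: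
* natural-number registers `0`, …, `4`: hub, number of edges, number of arcs, the constants `0`, `1`;
* natural-number arrays `5`, …, `10`: tails, heads, ranks at tails, ranks at heads, indicators of the
  excess arcs and of the rejected arcs;
* real register `0`: the constant `0`;
* real arrays `1`, `3`, `4`: lower bounds of the edges, current capacities and flow of the arcs. -/
structure Data (T : ArcNet) (m : ℕ) (L f : ℕ → ℝ) (R : Set ℕ) (σ : Store) : Prop where
  hub : σ.natReg 0 = T.hub
  edges : σ.natReg 1 = m
  size : σ.natReg 2 = T.size
  zero : σ.natReg 3 = 0
  one : σ.natReg 4 = 1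
  rzero : σ.realReg 0 = 0
  tl : ∀ a ∈ T.arcs, σ.natArr 5 a = T.tl a
  hd : ∀ a ∈ T.arcs, σ.natArr 6 a = T.hd a
  outR : ∀ a ∈ T.arcs, σ.natArr 7 a = T.outR a
  inR : ∀ a ∈ T.arcs, σ.natArr 8 a = T.inR a
  excess : ∀ a ∈ T.arcs, σ.natArr 9 a = if T.IsExcess a then 1 else 0
  rejected : ∀ a ∈ T.arcs, σ.natArr 10 a = if a ∈ R then 1 else 0
  lower : σ.realArr 1 = L
  cap : ∀ a ∈ T.arcs, σ.realArr 3 a = T.dcap R a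
  flow : ∀ a ∈ T.arcs, σ.realArr 4 a = f a

variable {T : ArcNet} {m : ℕ} {L f : ℕ → ℝ} {R : Set ℕ}

lemma Data.frame {p : Program} {σ τ : Store} (h : Data T m L f R σ) (hF : Frame p σ τ)
    (hk : p.KeepsData) : Data T m L f R τ := by
  obtain ⟨h1, h2, h3, h4⟩ := hk
  have e1 : ∀ r < 5, τ.natReg r = σ.natReg r := fun r hr =>
    hF.natReg r fun hr' => by have := h1 r hr'; omega
  have e2 : τ.realReg 0 = σ.realReg 0 := hF.realReg 0 fun hr' => by have := h2 0 hr'; omega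
  have e3 : ∀ A < 11, τ.natArr A = σ.natArr A := fun r hr =>
    hF.natArr r fun hr' => by have := h3 r hr'; omega
  have e4 : ∀ A, τ.realArr A = σ.realArr A := fun A => hF.realArr A (by simp [h4])
  constructor
  case hub => rw [e1 0 (by omega), h.hub]
  case edges => rw [e1 1 (by omega), h.edges]
  case size => rw [e1 2 (by omega), h.size]
  case zero => rw [e1 3 (by omega), h.zero]
  case one => rw [e1 4 (by omega), h.one]
  case rzero => rw [e2, h.rzero]
  case tl => rw [e3 5 (by omega)]; exact h.tl
  case hd => rw [e3 6 (by omega)]; exact h.hd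
  case outR => rw [e3 7 (by omega)]; exact h.outR
  case inR => rw [e3 8 (by omega)]; exact h.inR
  case excess => rw [e3 9 (by omega)]; exact h.excess
  case rejected => rw [e3 10 (by omega)]; exact h.rejected
  case lower => rw [e4, h.lower]
  case cap => rw [e4]; exact h.cap
  case flow => rw [e4]; exact h.flow

lemma Data.eval {p : Program} {σ : Store} (h : Data T m L f R σ) (hp : p.loopFree = true)
    (hk : p.KeepsData) : Data T m L f R (p.eval σ) := h.frame (eval_frame hp σ) hk

/-- Performs `body` for all arcs, whose numbers are held in register `5`. -/
def scan (body : Program) : Program :=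
  .seq (.op (.natCopy 5 3)) (.loop (.natLt 5 2) (.seq (.op (.natSucc 5)) body))

/-- Register `5` can serve as counter because the body does not change it, and `hP` says that the
invariant ignores it. The constants account for one test and one increment per round, the initial
copy and the final test. -/
lemma runs_scan {body : Program} (P : ℕ → Store → Prop) (hlf : body.loopFree = true)
    (hk : body.KeepsData) (h5 : 5 ∉ body.natRegs) {σ : Store} (hσ : Data T m L f R σ)
    (hP : ∀ i τ x, P i τ → P i { τ with natReg := Function.update τ.natReg 5 x })
    (hP0 : P 0 σ)
    (hstep : ∀ i, i + 1 ∈ T.arcs → ∀ τ, Data T m L f R τ → τ.natReg 5 = i + 1 → P i τ →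
      P (i + 1) (body.eval τ)) :
    Runs (scan body) σ (T.size * (body.cost + 2) + 2) fun τ => Data T m L f R τ ∧ P T.size τ := by
  have hset : ∀ τ x, Data T m L f R τ →
      Data T m L f R { τ with natReg := Function.update τ.natReg 5 x } := by
    intro τ x h
    refine h.frame (p := .op (.natConst 5 x)) ?_ ⟨by simp [natRegs], by simp [realRegs],
      by simp [natArrs], rfl⟩
    exact eval_frame (p := .op (.natConst 5 x)) rfl τ
  have hloop := Runs.loop (b := .natLt 5 2) (p := .seq (.op (.natSucc 5)) body)
    (c := body.cost + 1) T.size (fun i τ => Data T m L f R τ ∧ τ.natReg 5 = i ∧ P i τ)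
    (fun i hi τ ⟨hd, h5i, hPi⟩ => by
      refine ⟨by simp only [Test.Holds, h5i, hd.size, hi], ?_⟩
      have h1 := runs_of_loopFree (p := .seq (.op (.natSucc 5)) body)
        (by simpa [loopFree] using hlf) τ
      refine h1.mono (by simp only [cost]; omega) fun υ hυ => ?_
      subst hυ
      have h2 := hset τ (τ.natReg 5 + 1) hd
      refine ⟨h2.eval hlf hk, ?_, hstep i ?_ _ h2 ?_ (hP i τ (τ.natReg 5 + 1) hPi)⟩
      · rw [show eval (.seq (.op (.natSucc 5)) body) τ = eval body ((Op.natSucc 5).apply τ) from rfl,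
          (eval_frame hlf _).natReg 5 h5]
        simp [Op.apply, h5i]
      · simp only [ArcNet.arcs, Finset.mem_Icc]; omega
      · exact (Function.update_self 5 (τ.natReg 5 + 1) τ.natReg).trans (by rw [h5i]))
    (fun τ ⟨hd, h5i, _⟩ => by simp [Test.Holds, h5i, hd.size])
    (σ := (Op.natCopy 5 3).apply σ)
    ⟨hset σ _ hσ, by simp [Op.apply, hσ.zero], hP 0 σ _ hP0⟩
  refine ((runs_of_loopFree (p := .op (.natCopy 5 3)) rfl σ).seq fun τ hτ => ?_).mono
    (B := 1 + (T.size * (body.cost + 1 + 1) + 1))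
    (by rw [add_assoc, one_add_one_eq_two]; omega) fun _ h => h
  · subst hτ
    exact hloop.mono le_rfl fun τ h => ⟨h.1, h.2.2⟩

/-! ## Computing the tables -/

/-- Clears the tables (arrays `11` and `12`) at both ends of an arc. -/
def clearBody : Program :=
  ops [.natLoad 6 5 5, .natStore 11 6 3, .natStore 12 6 3, .natLoad 6 6 5, .natStore 11 6 3,
    .natStore 12 6 3]

/-- Enters an arc into the table of the best available out-arcs. -/
def outBody : Program :=
  .seq (ops [.natLoad 8 10 5, .realLoad 1 4 5, .realLoad 2 3 5])
    (.branch (.natEq 8 3)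
      (.branch (.realLt 1 2)
        (.seq (ops [.natLoad 6 5 5, .natLoad 7 11 6, .natLoad 9 7 5, .natLoad 10 7 7])
          (.branch (.natEq 7 3) (.op (.natStore 11 6 5))
            (.branch (.natLt 9 10) (.op (.natStore 11 6 5)) .skip)))
        .skip)
      .skip)

/-- Enters a candidate arc into the table of the worst candidates. -/
def intoUpdate : Program :=
  .seq (ops [.natLoad 7 12 6, .natLoad 9 8 5, .natLoad 10 8 7])
    (.branch (.natEq 7 3) (.op (.natStore 12 6 5))
      -- Non-strict, because among equal ranks the later arc counts as worse; the search for the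
      -- best out-arc compares strictly and so keeps the earlier one.
      (.branch (.natLe 10 9) (.op (.natStore 12 6 5)) .skip))

/-- Enters an arc into the table of the worst candidates. -/
def intoBody : Program :=
  .seq (ops [.natLoad 8 10 5, .realLoad 1 4 5, .natLoad 6 6 5])
    (.branch (.natEq 8 3)
      (.branch (.natNe 6 0) intoUpdate .skip)
      (.branch (.realLt 0 1) intoUpdate .skip))

/-- Looks for an arc to be rejected, whose number is put into register `13`. -/
def markBody : Program :=
  .seq (ops [.natLoad 8 10 5, .natLoad 6 6 5, .natLoad 7 11 6, .natLoad 9 12 6, .natLoad 10 9 5,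
      .realLoad 1 4 5])
    (.branch (.natEq 8 3)
      (.branch (.natNe 6 0)
        (.branch (.natEq 7 3) (.branch (.natEq 9 5) (.op (.natCopy 13 5)) .skip) .skip)
        (.branch (.natEq 10 4) (.branch (.realLt 0 1) (.op (.natCopy 13 5)) .skip) .skip))
      .skip)

/-- Together with `IsPick.insert_keep`, this is the update rule for a running optimum. -/
lemma IsPick.insert {S S' : Set ℕ} {lt : ℕ → ℕ → Prop} {x a : ℕ} (h : IsPick S lt x)
    (hS : ∀ b, b ∈ S' ↔ b = a ∨ b ∈ S) (ha : a ≠ 0) (hlt : x = 0 ∨ lt a x)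
    (htrans : ∀ b, lt a x → lt x b → lt a b) : IsPick S' lt a := by
  refine Or.inr ⟨ha, (hS a).2 (Or.inl rfl), fun b hb hne => ?_⟩
  have hbS := ((hS b).1 hb).resolve_left hne
  rcases h with ⟨_, h⟩ | ⟨h0, _, h⟩
  · exact absurd hbS (h b)
  · have hax := hlt.resolve_left h0
    by_cases hbx : b = x
    · rwa [hbx]
    · exact htrans b hax (h b hbS hbx)

lemma IsPick.insert_keep {S S' : Set ℕ} {lt : ℕ → ℕ → Prop} {x a : ℕ} (h : IsPick S lt x)
    (hS : ∀ b, b ∈ S' ↔ b = a ∨ b ∈ S) (hx : x ≠ 0) (hlt : lt x a) : IsPick S' lt x := by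
  rcases h with ⟨h0, _⟩ | ⟨h0, h1, h⟩
  · exact absurd h0 hx
  · refine Or.inr ⟨h0, (hS x).2 (Or.inr h1), fun b hb hne => ?_⟩
    rcases (hS b).1 hb with rfl | hb
    · exact hlt
    · exact h b hb hne

lemma IsPick.congr {S S' : Set ℕ} {lt : ℕ → ℕ → Prop} {x : ℕ} (h : IsPick S lt x)
    (hS : ∀ b, b ∈ S' ↔ b ∈ S) : IsPick S' lt x := by
  rwa [show S' = S from Set.ext hS]

lemma IsPick.mem {S : Set ℕ} {lt : ℕ → ℕ → Prop} {x : ℕ} (h : IsPick S lt x) (hx : x ≠ 0) :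
    x ∈ S := by
  rcases h with ⟨h0, _⟩ | ⟨_, h1, _⟩
  · exact absurd h0 hx
  · exact h1

lemma mem_arcs_iff {a : ℕ} : a ∈ T.arcs ↔ 1 ≤ a ∧ a ≤ T.size := Finset.mem_Icc

lemma rel_hd {a : ℕ} (ha : a ∈ T.arcs) : T.Rel (T.hd a) := Or.inr ⟨a, ha, Or.inr rfl⟩

/-- The effect of `outBody`. -/
lemma eval_outBody {σ : Store} (h : Data T m L f R σ) {a : ℕ} (ha : a ∈ T.arcs)
    (h5 : σ.natReg 5 = a) :
    (T.Avail f R a → σ.natArr 11 (T.tl a) = 0 ∨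
        σ.natArr 7 a < σ.natArr 7 (σ.natArr 11 (T.tl a)) →
      (outBody.eval σ).natArr 11 = Function.update (σ.natArr 11) (T.tl a) a) ∧
    (¬ (T.Avail f R a ∧ (σ.natArr 11 (T.tl a) = 0 ∨
        σ.natArr 7 a < σ.natArr 7 (σ.natArr 11 (T.tl a)))) →
      (outBody.eval σ).natArr 11 = σ.natArr 11) := by
  have h1 := h.rejected a ha
  have h2 := h.flow a ha
  have h3 := h.cap a ha
  have h4 := h.tl a ha
  have h6 := h.zero
  unfold ArcNet.Avail
  constructor
  · rintro ⟨hR, hlt⟩ hx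
    rw [if_neg hR] at h1
    by_cases h0 : σ.natArr 11 (T.tl a) = 0
    · simp [outBody, ops, eval, Op.apply, Test.Holds, h1, h2, h3, h4, h5, h6, h0, hlt]
    · have := hx.resolve_left h0
      simp [outBody, ops, eval, Op.apply, Test.Holds, h1, h2, h3, h4, h5, h6, h0, hlt, this]
  · intro hx
    by_cases hR : a ∈ R
    · rw [if_pos hR] at h1
      simp [outBody, ops, eval, Op.apply, Test.Holds, h1, h2, h3, h5, h6]
    rw [if_neg hR] at h1
    by_cases hlt : f a < T.dcap R a
    · have h7 : ¬ (σ.natArr 11 (T.tl a) = 0 ∨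
        σ.natArr 7 a < σ.natArr 7 (σ.natArr 11 (T.tl a))) := fun h => hx ⟨⟨hR, hlt⟩, h⟩
      rw [not_or] at h7
      simp [outBody, ops, eval, Op.apply, Test.Holds, h1, h2, h3, h4, h5, h6, hlt, h7.1, h7.2]
    · simp [outBody, ops, eval, Op.apply, Test.Holds, h1, h2, h3, h5, h6, hlt]

/-- The effect of `intoBody`. -/
lemma eval_intoBody {σ : Store} (h : Data T m L f R σ) {a : ℕ} (ha : a ∈ T.arcs)
    (h5 : σ.natReg 5 = a) :
    (T.Cand f R a → σ.natArr 12 (T.hd a) = 0 ∨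
        σ.natArr 8 (σ.natArr 12 (T.hd a)) ≤ σ.natArr 8 a →
      (intoBody.eval σ).natArr 12 = Function.update (σ.natArr 12) (T.hd a) a) ∧
    (¬ (T.Cand f R a ∧ (σ.natArr 12 (T.hd a) = 0 ∨
        σ.natArr 8 (σ.natArr 12 (T.hd a)) ≤ σ.natArr 8 a)) →
      (intoBody.eval σ).natArr 12 = σ.natArr 12) := by
  have h1 := h.rejected a ha
  have h2 := h.flow a ha
  have h4 := h.hd a ha
  have h6 := h.zero
  have h7 := h.hub
  have h8 := h.rzero
  have hc : T.Cand f R a ↔ (a ∉ R ∧ T.hd a ≠ T.hub) ∨ (a ∈ R ∧ 0 < f a) := Iff.rfl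
  constructor
  · intro hcand hx
    by_cases hR : a ∈ R
    · have h9 : 0 < f a := by tauto
      rw [if_pos hR] at h1
      by_cases h0 : σ.natArr 12 (T.hd a) = 0
      · simp [intoBody, intoUpdate, ops, eval, Op.apply, Test.Holds, h1, h2, h4, h5, h6, h8, h9, h0]
      · have := hx.resolve_left h0
        simp [intoBody, intoUpdate, ops, eval, Op.apply, Test.Holds, h1, h2, h4, h5, h6, h8, h9, h0,
          this]
    · have h9 : T.hd a ≠ T.hub := by tauto
      rw [if_neg hR] at h1
      by_cases h0 : σ.natArr 12 (T.hd a) = 0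
      · simp [intoBody, intoUpdate, ops, eval, Op.apply, Test.Holds, h1, h4, h5, h6, h7, h9, h0]
      · have := hx.resolve_left h0
        simp [intoBody, intoUpdate, ops, eval, Op.apply, Test.Holds, h1, h4, h5, h6, h7, h9, h0,
          this]
  · intro hx
    by_cases hcand : T.Cand f R a
    · have h0 : ¬ (σ.natArr 12 (T.hd a) = 0 ∨
        σ.natArr 8 (σ.natArr 12 (T.hd a)) ≤ σ.natArr 8 a) := fun h => hx ⟨hcand, h⟩
      rw [not_or] at h0
      by_cases hR : a ∈ R
      · have h9 : 0 < f a := by tauto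
        rw [if_pos hR] at h1
        simp [intoBody, intoUpdate, ops, eval, Op.apply, Test.Holds, h1, h2, h4, h5, h6, h8, h9,
          h0.1, h0.2]
      · have h9 : T.hd a ≠ T.hub := by tauto
        rw [if_neg hR] at h1
        simp [intoBody, intoUpdate, ops, eval, Op.apply, Test.Holds, h1, h4, h5, h6, h7, h9,
          h0.1, h0.2]
    · by_cases hR : a ∈ R
      · have h9 : ¬ 0 < f a := by tauto
        rw [if_pos hR] at h1
        simp [intoBody, intoUpdate, ops, eval, Op.apply, Test.Holds, h1, h2, h4, h5, h6, h8, h9]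
      · have h9 : T.hd a = T.hub := by tauto
        rw [if_neg hR] at h1
        simp [intoBody, intoUpdate, ops, eval, Op.apply, Test.Holds, h1, h4, h5, h6, h7, h9]

/-- The conditions under which an arc is rejected, given the tables. -/
def Marked (T : ArcNet) (f : ℕ → ℝ) (R : Set ℕ) (B W : ℕ → ℕ) (a : ℕ) : Prop :=
  a ∉ R ∧ ((T.hd a ≠ T.hub ∧ B (T.hd a) = 0 ∧ W (T.hd a) = a) ∨ (T.IsExcess a ∧ 0 < f a))

/-- The effect of `markBody`. -/
lemma eval_markBody {σ : Store} (h : Data T m L f R σ) {a : ℕ} (ha : a ∈ T.arcs)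
    (h5 : σ.natReg 5 = a) :
    (Marked T f R (σ.natArr 11) (σ.natArr 12) a → (markBody.eval σ).natReg 13 = a) ∧
    (¬ Marked T f R (σ.natArr 11) (σ.natArr 12) a →
      (markBody.eval σ).natReg 13 = σ.natReg 13) := by
  have h1 := h.rejected a ha
  have h2 := h.flow a ha
  have h3 := h.excess a ha
  have h4 := h.hd a ha
  have h6 := h.zero
  have h7 := h.hub
  have h8 := h.rzero
  have h9 := h.one
  unfold Marked
  by_cases hR : a ∈ R
  · rw [if_pos hR] at h1
    refine ⟨fun h => absurd hR h.1, fun _ => ?_⟩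
    simp [markBody, ops, eval, Op.apply, Test.Holds, h1, h5, h6]
  rw [if_neg hR] at h1
  by_cases hub : T.hd a = T.hub
  · by_cases he : T.IsExcess a
    · rw [if_pos he] at h3
      by_cases hpos : 0 < f a
      · simp [markBody, ops, eval, Op.apply, Test.Holds, h1, h2, h3, h4, h5, h6, h7, h8, h9, hub,
          hpos, he, hR]
      · simp [markBody, ops, eval, Op.apply, Test.Holds, h1, h2, h3, h4, h5, h6, h7, h8, h9, hub,
          hpos]
    · rw [if_neg he] at h3
      simp [markBody, ops, eval, Op.apply, Test.Holds, h1, h3, h4, h5, h6, h7, h9, hub, he]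
  · have he : ¬ T.IsExcess a := fun h => hub (T.excess_hd a h)
    by_cases hB : σ.natArr 11 (T.hd a) = 0
    · by_cases hW : σ.natArr 12 (T.hd a) = a
      · simp [markBody, ops, eval, Op.apply, Test.Holds, h1, h4, h5, h6, h7, hub, hB, hW, hR]
      · simp [markBody, ops, eval, Op.apply, Test.Holds, h1, h4, h5, h6, h7, hub, hB, hW, he]
    · simp [markBody, ops, eval, Op.apply, Test.Holds, h1, h4, h5, h6, h7, hub, hB, he]

/-- Computes the tables. -/
def tables : Program :=
  .seq (ops [.natStore 11 0 3, .natStore 12 0 3])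
    (.seq (scan clearBody) (.seq (scan outBody) (scan intoBody)))

/-- Looks for an arc to be rejected. -/
def findMark : Program := .seq (.op (.natCopy 13 3)) (scan markBody)

/-- Only the entries at ends of arcs are cleared, after those of the hub have been; thus the time
depends on the number of arcs and not on the number of vertices. -/
lemma runs_clear {σ : Store} (hσ : Data T m L f R σ) (h11 : σ.natArr 11 T.hub = 0)
    (h12 : σ.natArr 12 T.hub = 0) :
    Runs (scan clearBody) σ (T.size * 8 + 2) fun τ => Data T m L f R τ ∧
      ∀ v, T.Rel v → τ.natArr 11 v = 0 ∧ τ.natArr 12 v = 0 := by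
  refine (runs_scan (fun i τ => (τ.natArr 11 T.hub = 0 ∧ τ.natArr 12 T.hub = 0) ∧
    ∀ a ∈ T.arcs, a ≤ i → (τ.natArr 11 (T.tl a) = 0 ∧ τ.natArr 12 (T.tl a) = 0) ∧
      (τ.natArr 11 (T.hd a) = 0 ∧ τ.natArr 12 (T.hd a) = 0)) rfl (by decide) (by decide) hσ
    (fun _ _ _ h => h) ⟨⟨h11, h12⟩, fun a ha h => ?_⟩ ?_).mono le_rfl fun τ ⟨h1, h2, h3⟩ =>
      ⟨h1, fun v hv => ?_⟩
  · rw [mem_arcs_iff] at ha; omega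
  · intro i hi τ hd h5 ⟨h1, h2⟩
    have e1 := hd.tl _ hi
    have e2 := hd.hd _ hi
    have e3 := hd.zero
    have h11 : (clearBody.eval τ).natArr 11 = Function.update
        (Function.update (τ.natArr 11) (T.tl (i + 1)) 0) (T.hd (i + 1)) 0 := by
      simp [clearBody, ops, eval, Op.apply, e1, e2, e3, h5]
    have h12 : (clearBody.eval τ).natArr 12 = Function.update
        (Function.update (τ.natArr 12) (T.tl (i + 1)) 0) (T.hd (i + 1)) 0 := by
      simp [clearBody, ops, eval, Op.apply, e1, e2, e3, h5]
    have key : ∀ v, (τ.natArr 11 v = 0 ∧ τ.natArr 12 v = 0 ∨ v = T.tl (i + 1) ∨ v = T.hd (i + 1)) →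
        (clearBody.eval τ).natArr 11 v = 0 ∧ (clearBody.eval τ).natArr 12 v = 0 := by
      intro v hv
      rw [h11, h12]
      simp only [Function.update_apply]
      constructor
      · split_ifs <;> tauto
      · split_ifs <;> tauto
    refine ⟨key _ (Or.inl h1), fun a ha hai => ?_⟩
    rcases Nat.lt_or_eq_of_le hai with h | h
    · have := h2 a ha (by omega)
      exact ⟨key _ (Or.inl this.1), key _ (Or.inl this.2)⟩
    · subst h
      exact ⟨key _ (Or.inr (Or.inl rfl)), key _ (Or.inr (Or.inr rfl))⟩
  · rcases hv with rfl | ⟨a, ha, rfl | rfl⟩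
    · exact h2
    · exact (h3 a ha (mem_arcs_iff.1 ha).2).1
    · exact (h3 a ha (mem_arcs_iff.1 ha).2).2

/-- After `i` rounds the table holds the best available arcs among the first `i`. The other table
must stay cleared for the scan that follows. -/
lemma runs_out {σ : Store} (hσ : Data T m L f R σ)
    (h0 : ∀ v, T.Rel v → σ.natArr 11 v = 0 ∧ σ.natArr 12 v = 0) :
    Runs (scan outBody) σ (T.size * 15 + 2) fun τ => Data T m L f R τ ∧
      ∀ v, T.Rel v → IsPick {a | a ∈ T.arcs ∧ T.tl a = v ∧ T.Avail f R a} T.OutBetter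
        (τ.natArr 11 v) ∧ τ.natArr 12 v = 0 := by
  refine (runs_scan (fun i τ => ∀ v, T.Rel v →
    IsPick {a | a ∈ T.arcs ∧ a ≤ i ∧ T.tl a = v ∧ T.Avail f R a} T.OutBetter
        (τ.natArr 11 v) ∧ τ.natArr 12 v = 0) rfl (by decide) (by decide) hσ
    (fun _ _ _ h => h) (fun v hv => ⟨Or.inl ⟨(h0 v hv).1, ?_⟩, (h0 v hv).2⟩) ?_).mono
    (by have : outBody.cost = 13 := rfl; rw [this]) fun τ ⟨h1, h2⟩ =>
      ⟨h1, fun v hv => ⟨(h2 v hv).1.congr fun b => ?_, (h2 v hv).2⟩⟩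
  · rintro b ⟨hb, hb0, -⟩
    rw [mem_arcs_iff] at hb; omega
  · intro i hi τ hd h5 hP v hv
    obtain ⟨hp, h12⟩ := hP v hv
    rw [(eval_frame (p := outBody) rfl τ).natArr 12 (by decide)]
    refine ⟨?_, h12⟩
    obtain ⟨e1, e2⟩ := eval_outBody hd hi h5
    by_cases hav : T.Avail f R (i + 1) ∧ T.tl (i + 1) = v
    · obtain ⟨hav, rfl⟩ := hav
      have hS : ∀ b, b ∈ {a | a ∈ T.arcs ∧ a ≤ i + 1 ∧ T.tl a = T.tl (i + 1) ∧ T.Avail f R a} ↔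
          b = i + 1 ∨ b ∈ {a | a ∈ T.arcs ∧ a ≤ i ∧ T.tl a = T.tl (i + 1) ∧ T.Avail f R a} := by
        intro b
        constructor
        · rintro ⟨hb, hbi, hb'⟩
          by_cases h : b = i + 1
          · exact Or.inl h
          · exact Or.inr ⟨hb, by omega, hb'⟩
        · rintro (rfl | ⟨hb, hbi, hb'⟩)
          · exact ⟨hi, le_rfl, rfl, hav⟩
          · exact ⟨hb, by omega, hb'⟩
      by_cases hx : τ.natArr 11 (T.tl (i + 1)) = 0
      · rw [e1 hav (Or.inl hx), Function.update_self]
        exact hp.insert hS (by omega) (Or.inl hx) fun b _ hb => by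
          unfold ArcNet.OutBetter at *; omega
      obtain ⟨hxa, hxi, -, -⟩ := hp.mem hx
      have r1 := hd.outR _ hxa
      have r2 := hd.outR _ hi
      by_cases hlt : τ.natArr 7 (i + 1) < τ.natArr 7 (τ.natArr 11 (T.tl (i + 1)))
      · rw [e1 hav (Or.inr hlt), Function.update_self]
        rw [r1, r2] at hlt
        exact hp.insert hS (by omega) (Or.inr (Or.inl hlt)) fun b _ hb => by
          unfold ArcNet.OutBetter at *; omega
      · rw [e2 (by tauto)]
        rw [r1, r2] at hlt
        refine hp.insert_keep hS hx ?_
        unfold ArcNet.OutBetter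
        omega
    · have harr : (outBody.eval τ).natArr 11 v = τ.natArr 11 v := by
        by_cases h : T.Avail f R (i + 1) ∧ (τ.natArr 11 (T.tl (i + 1)) = 0 ∨
            τ.natArr 7 (i + 1) < τ.natArr 7 (τ.natArr 11 (T.tl (i + 1))))
        · rw [e1 h.1 h.2, Function.update_of_ne (by tauto)]
        · rw [e2 h]
      rw [harr]
      refine hp.congr fun b => ⟨?_, ?_⟩
      · rintro ⟨hb, hbi, hb', hb''⟩
        refine ⟨hb, ?_, hb', hb''⟩
        by_contra h
        obtain rfl : b = i + 1 := by omega
        exact hav ⟨hb'', hb'⟩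
      · rintro ⟨hb, hbi, hb'⟩
        exact ⟨hb, by omega, hb'⟩
  · exact ⟨fun ⟨h1, h2⟩ => ⟨h1, (mem_arcs_iff.1 h1).2, h2⟩, fun ⟨h1, _, h2⟩ => ⟨h1, h2⟩⟩

lemma runs_into {σ : Store} (hσ : Data T m L f R σ)
    (h0 : ∀ v, T.Rel v → IsPick {a | a ∈ T.arcs ∧ T.tl a = v ∧ T.Avail f R a} T.OutBetter
        (σ.natArr 11 v) ∧ σ.natArr 12 v = 0) :
    Runs (scan intoBody) σ (T.size * 22 + 2) fun τ => Data T m L f R τ ∧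
      ∀ v, T.Rel v → IsPick {a | a ∈ T.arcs ∧ T.tl a = v ∧ T.Avail f R a} T.OutBetter
        (τ.natArr 11 v) ∧ IsPick {a | a ∈ T.arcs ∧ T.hd a = v ∧ T.Cand f R a}
        (fun a b => T.InBetter b a) (τ.natArr 12 v) := by
  refine (runs_scan (fun i τ => ∀ v, T.Rel v →
    IsPick {a | a ∈ T.arcs ∧ T.tl a = v ∧ T.Avail f R a} T.OutBetter (τ.natArr 11 v) ∧
    IsPick {a | a ∈ T.arcs ∧ a ≤ i ∧ T.hd a = v ∧ T.Cand f R a} (fun a b => T.InBetter b a)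
        (τ.natArr 12 v)) rfl (by decide) (by decide) hσ
    (fun _ _ _ h => h) (fun v hv => ⟨(h0 v hv).1, Or.inl ⟨(h0 v hv).2, ?_⟩⟩) ?_).mono
    (by have : intoBody.cost = 20 := rfl; rw [this]) fun τ ⟨h1, h2⟩ =>
      ⟨h1, fun v hv => ⟨(h2 v hv).1, (h2 v hv).2.congr fun b => ?_⟩⟩
  · rintro b ⟨hb, hb0, -⟩
    rw [mem_arcs_iff] at hb; omega
  · intro i hi τ hd h5 hP v hv
    obtain ⟨h11, hp⟩ := hP v hv
    rw [(eval_frame (p := intoBody) rfl τ).natArr 11 (by decide)]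
    refine ⟨h11, ?_⟩
    obtain ⟨e1, e2⟩ := eval_intoBody hd hi h5
    by_cases hav : T.Cand f R (i + 1) ∧ T.hd (i + 1) = v
    · obtain ⟨hav, rfl⟩ := hav
      have hS : ∀ b, b ∈ {a | a ∈ T.arcs ∧ a ≤ i + 1 ∧ T.hd a = T.hd (i + 1) ∧ T.Cand f R a} ↔
          b = i + 1 ∨ b ∈ {a | a ∈ T.arcs ∧ a ≤ i ∧ T.hd a = T.hd (i + 1) ∧ T.Cand f R a} := by
        intro b
        constructor
        · rintro ⟨hb, hbi, hb'⟩
          by_cases h : b = i + 1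
          · exact Or.inl h
          · exact Or.inr ⟨hb, by omega, hb'⟩
        · rintro (rfl | ⟨hb, hbi, hb'⟩)
          · exact ⟨hi, le_rfl, rfl, hav⟩
          · exact ⟨hb, by omega, hb'⟩
      by_cases hx : τ.natArr 12 (T.hd (i + 1)) = 0
      · rw [e1 hav (Or.inl hx), Function.update_self]
        exact hp.insert hS (by omega) (Or.inl hx) fun b _ hb => by
          unfold ArcNet.InBetter at *; omega
      obtain ⟨hxa, hxi, -, -⟩ := hp.mem hx
      have r1 := hd.inR _ hxa
      have r2 := hd.inR _ hi
      by_cases hlt : τ.natArr 8 (τ.natArr 12 (T.hd (i + 1))) ≤ τ.natArr 8 (i + 1)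
      · rw [e1 hav (Or.inr hlt), Function.update_self]
        rw [r1, r2] at hlt
        have : T.InBetter (τ.natArr 12 (T.hd (i + 1))) (i + 1) := by
          unfold ArcNet.InBetter; omega
        exact hp.insert hS (by omega) (Or.inr this) fun b _ hb => by
          unfold ArcNet.InBetter at *; omega
      · rw [e2 (by tauto)]
        rw [r1, r2] at hlt
        refine hp.insert_keep hS hx ?_
        unfold ArcNet.InBetter
        omega
    · have harr : (intoBody.eval τ).natArr 12 v = τ.natArr 12 v := by
        by_cases h : T.Cand f R (i + 1) ∧ (τ.natArr 12 (T.hd (i + 1)) = 0 ∨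
            τ.natArr 8 (τ.natArr 12 (T.hd (i + 1))) ≤ τ.natArr 8 (i + 1))
        · rw [e1 h.1 h.2, Function.update_of_ne (by tauto)]
        · rw [e2 h]
      rw [harr]
      refine hp.congr fun b => ⟨?_, ?_⟩
      · rintro ⟨hb, hbi, hb', hb''⟩
        refine ⟨hb, ?_, hb', hb''⟩
        by_contra h
        obtain rfl : b = i + 1 := by omega
        exact hav ⟨hb'', hb'⟩
      · rintro ⟨hb, hbi, hb'⟩
        exact ⟨hb, by omega, hb'⟩
  · exact ⟨fun ⟨h1, h2⟩ => ⟨h1, (mem_arcs_iff.1 h1).2, h2⟩, fun ⟨h1, _, h2⟩ => ⟨h1, h2⟩⟩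

lemma runs_tables {σ : Store} (hσ : Data T m L f R σ) :
    Runs tables σ (T.size * 45 + 8) fun τ => Data T m L f R τ ∧
      ∀ v, T.Rel v → IsPick {a | a ∈ T.arcs ∧ T.tl a = v ∧ T.Avail f R a} T.OutBetter
        (τ.natArr 11 v) ∧ IsPick {a | a ∈ T.arcs ∧ T.hd a = v ∧ T.Cand f R a}
        (fun a b => T.InBetter b a) (τ.natArr 12 v) := by
  have hlf : (ops [.natStore 11 0 3, .natStore 12 0 3]).loopFree = true := rfl
  refine ((runs_of_loopFree hlf σ).seq (B' := (T.size * 8 + 2) + ((T.size * 15 + 2) +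
    (T.size * 22 + 2))) fun τ hτ => ?_).mono ?_ fun _ h => h
  · subst hτ
    have hd := hσ.eval hlf (by decide)
    refine (runs_clear hd ?_ ?_).seq fun τ ⟨h1, h2⟩ => (runs_out h1 h2).seq fun τ ⟨h3, h4⟩ =>
      runs_into h3 h4
    · simp [ops, eval, Op.apply, hσ.hub, hσ.zero]
    · simp [ops, eval, Op.apply, hσ.hub, hσ.zero]
  · have : (ops [.natStore 11 0 3, .natStore 12 0 3]).cost = 2 := rfl
    omega

/-- Register `13` ends with the last marked arc; any other would do as well. -/
lemma runs_findMark {σ : Store} (hσ : Data T m L f R σ) {B W : ℕ → ℕ} (hB : σ.natArr 11 = B)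
    (hW : σ.natArr 12 = W) :
    Runs findMark σ (T.size * 16 + 3) fun τ => Data T m L f R τ ∧ τ.natArr 11 = B ∧
      τ.natArr 12 = W ∧ ((τ.natReg 13 = 0 ∧ ∀ b ∈ T.arcs, ¬ Marked T f R B W b) ∨
        (τ.natReg 13 ∈ T.arcs ∧ Marked T f R B W (τ.natReg 13))) := by
  have hlf : (Program.op (.natCopy 13 3)).loopFree = true := rfl
  refine ((runs_of_loopFree hlf σ).seq (B' := T.size * 16 + 2) fun τ hτ => ?_).mono ?_
    fun _ h => h
  · subst hτ
    refine (runs_scan (fun i τ => τ.natArr 11 = B ∧ τ.natArr 12 = W ∧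
      ((τ.natReg 13 = 0 ∧ ∀ b ∈ T.arcs, b ≤ i → ¬ Marked T f R B W b) ∨
        (τ.natReg 13 ∈ T.arcs ∧ Marked T f R B W (τ.natReg 13)))) rfl (by decide) (by decide)
      (hσ.eval hlf (by decide)) (fun i τ x h => ?_) ⟨hB, hW, Or.inl ⟨?_, ?_⟩⟩ ?_).mono
      (by have : markBody.cost = 14 := rfl; rw [this]) fun τ ⟨h1, h2, h3, h4⟩ =>
        ⟨h1, h2, h3, h4.imp (fun h => ⟨h.1, fun b hb => h.2 b hb (mem_arcs_iff.1 hb).2⟩) id⟩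
    · simpa using h
    · simp [eval, Op.apply, hσ.zero]
    · intro b hb h
      rw [mem_arcs_iff] at hb; omega
    · rintro i hi τ hd h5 ⟨h11, h12, h13⟩
      have hF := eval_frame (p := markBody) rfl τ
      obtain ⟨e1, e2⟩ := eval_markBody hd hi h5
      rw [h11, h12] at e1 e2
      rw [hF.natArr 11 (by decide), hF.natArr 12 (by decide)]
      refine ⟨h11, h12, ?_⟩
      by_cases hM : Marked T f R B W (i + 1)
      · rw [e1 hM]; exact Or.inr ⟨hi, hM⟩
      · rw [e2 hM]
        refine h13.imp (fun h => ⟨h.1, fun b hb hbi => ?_⟩) id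
        rcases Nat.lt_or_eq_of_le hbi with hlt | rfl
        · exact h.2 b hb (by omega)
        · exact hM
  · have : (Program.op (.natCopy 13 3)).cost = 1 := rfl
    omega

variable {B W : ℕ → ℕ}

/-! ## Walking and pushing -/

/-- Replaces the vertex in register `6` by its successor. -/
def stepBody : Program :=
  .seq (.op (.natLoad 7 11 6))
    (.branch (.natNe 7 3) (.op (.natLoad 6 6 7)) (ops [.natLoad 7 12 6, .natLoad 6 5 7]))

/-- The same, and computes in real register `1` what the old vertex can pass on. -/
def resBody : Program :=
  .seq (.op (.natLoad 7 11 6))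
    (.branch (.natNe 7 3)
      (ops [.realLoad 1 3 7, .realLoad 2 4 7, .realSub 1 1 2, .natLoad 6 6 7])
      (ops [.natLoad 7 12 6, .realLoad 1 4 7, .natLoad 6 5 7]))

/-- The same, and keeps the minimum in real register `5`. -/
def minBody : Program := .seq resBody (.branch (.realLt 1 5) (.op (.realCopy 5 1)) .skip)

/-- Replaces the vertex in register `6` by its successor, and passes on the amount in real
register `5`. -/
def pushBody : Program :=
  .seq (.op (.natLoad 7 11 6))
    (.branch (.natNe 7 3)
      (ops [.realLoad 1 4 7, .realAdd 1 1 5, .realStore 4 7 1, .natLoad 6 6 7])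
      (ops [.natLoad 7 12 6, .realLoad 1 4 7, .realSub 1 1 5, .realStore 4 7 1, .natLoad 6 5 7]))

/-- Finds a cycle and pushes as much as possible around it. -/
def augment : Program :=
  .seq (.op (.natCopy 6 0)) (.seq (scan stepBody) (.seq (.op (.natCopy 13 6))
    (.seq (.seq resBody (.op (.realCopy 5 1))) (.seq (scan minBody) (.seq (.op (.natCopy 6 13))
      (.seq pushBody (.loop (.natNe 6 13) pushBody)))))))

lemma eval_stepBody {σ : Store} (h : Data T m L f R σ) {v : ℕ} (hv : T.Rel v)
    (hgood : B v ≠ 0 ∨ W v ≠ 0) (hT : T.Tables f R B W) (hB : σ.natArr 11 = B)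
    (hW : σ.natArr 12 = W) (h6 : σ.natReg 6 = v) :
    (stepBody.eval σ).natReg 6 = T.succ B W v := by
  have h3 := h.zero
  by_cases hb : B v = 0
  · have e1 := h.tl _ (hT.into_spec hv (hgood.resolve_left (not_not.2 hb))).1
    rw [ArcNet.succ_of_eq hb]
    simp [stepBody, ops, eval, Op.apply, Test.Holds, h3, hB, hW, h6, hb, e1]
  · have e1 := h.hd _ (hT.out_spec hv hb).1
    rw [ArcNet.succ_of_ne hb]
    simp [stepBody, ops, eval, Op.apply, Test.Holds, h3, hB, h6, hb, e1]

lemma eval_resBody {σ : Store} (h : Data T m L f R σ) {v : ℕ} (hv : T.Rel v)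
    (hgood : B v ≠ 0 ∨ W v ≠ 0) (hT : T.Tables f R B W) (hB : σ.natArr 11 = B)
    (hW : σ.natArr 12 = W) (h6 : σ.natReg 6 = v) :
    (resBody.eval σ).natReg 6 = T.succ B W v ∧
      (resBody.eval σ).realReg 1 = T.res f R B W v := by
  have h3 := h.zero
  unfold ArcNet.res
  by_cases hb : B v = 0
  · have hm := (hT.into_spec hv (hgood.resolve_left (not_not.2 hb))).1
    have e1 := h.tl _ hm
    have e2 := h.flow _ hm
    rw [ArcNet.succ_of_eq hb, if_neg (not_not.2 hb)]
    simp [resBody, ops, eval, Op.apply, Test.Holds, h3, hB, hW, h6, hb, e1, e2]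
  · have hm := (hT.out_spec hv hb).1
    have e1 := h.hd _ hm
    have e2 := h.flow _ hm
    have e3 := h.cap _ hm
    rw [ArcNet.succ_of_ne hb, if_pos hb]
    simp [resBody, ops, eval, Op.apply, Test.Holds, h3, hB, h6, hb, e1, e2, e3]

/-- The representation after a change of the flow, the capacities and the rejected arcs. -/
lemma Data.update {p : Program} {σ τ : Store} (h : Data T m L f R σ) (hF : Frame p σ τ)
    (h1 : ∀ r ∈ p.natRegs, 5 ≤ r) (h2 : ∀ r ∈ p.realRegs, 1 ≤ r) (h3 : ∀ A ∈ p.natArrs, 10 ≤ A)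
    (h4 : ∀ A ∈ p.realArrs, 3 ≤ A) {f' : ℕ → ℝ} {R' : Set ℕ}
    (hR : ∀ a ∈ T.arcs, a ∈ R' → τ.natArr 10 a = 1) (hR' : ∀ a ∈ T.arcs, a ∉ R' → τ.natArr 10 a = 0)
    (hc : ∀ a ∈ T.arcs, τ.realArr 3 a = T.dcap R' a) (hf : ∀ a ∈ T.arcs, τ.realArr 4 a = f' a) :
    Data T m L f' R' τ := by
  have e1 : ∀ r < 5, τ.natReg r = σ.natReg r := fun r hr =>
    hF.natReg r fun hr' => by have := h1 r hr'; omega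
  have e2 : τ.realReg 0 = σ.realReg 0 := hF.realReg 0 fun hr' => by have := h2 0 hr'; omega
  have e3 : ∀ A < 10, τ.natArr A = σ.natArr A := fun r hr =>
    hF.natArr r fun hr' => by have := h3 r hr'; omega
  have e4 : ∀ A < 3, τ.realArr A = σ.realArr A := fun A hA =>
    hF.realArr A fun hr' => by have := h4 A hr'; omega
  constructor
  case hub => rw [e1 0 (by omega), h.hub]
  case edges => rw [e1 1 (by omega), h.edges]
  case size => rw [e1 2 (by omega), h.size]
  case zero => rw [e1 3 (by omega), h.zero]
  case one => rw [e1 4 (by omega), h.one]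
  case rzero => rw [e2, h.rzero]
  case tl => rw [e3 5 (by omega)]; exact h.tl
  case hd => rw [e3 6 (by omega)]; exact h.hd
  case outR => rw [e3 7 (by omega)]; exact h.outR
  case inR => rw [e3 8 (by omega)]; exact h.inR
  case excess => rw [e3 9 (by omega)]; exact h.excess
  case rejected =>
    intro a ha
    split_ifs with h
    · exact hR a ha h
    · exact hR' a ha h
  case lower => rw [e4 1 (by omega), h.lower]
  case cap => exact hc
  case flow => exact hf

lemma eval_pushBody {σ : Store} {g : ℕ → ℝ} (h : Data T m L g R σ) {v : ℕ}
    (hv : T.Rel v) (hgood : B v ≠ 0 ∨ W v ≠ 0) (hT : T.Tables f R B W) (hB : σ.natArr 11 = B)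
    (hW : σ.natArr 12 = W) (h6 : σ.natReg 6 = v) {x : ℝ} (hx : σ.realReg 5 = x) :
    (pushBody.eval σ).natReg 6 = T.succ B W v ∧
      Data T m L (ArcNet.pushAt B W x g v) R (pushBody.eval σ) := by
  have h3 := h.zero
  have hF := eval_frame (p := pushBody) rfl σ
  have key : ∀ f', (∀ a ∈ T.arcs, (pushBody.eval σ).realArr 4 a = f' a) →
      Data T m L f' R (pushBody.eval σ) := by
    intro f' hf'
    have e1 := hF.natArr 10 (by decide)
    refine h.update hF (by decide) (by decide) (by decide) (by decide) (fun a ha haR => ?_)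
      (fun a ha haR => ?_) (fun a ha => ?_) hf'
    · rw [e1, h.rejected a ha, if_pos haR]
    · rw [e1, h.rejected a ha, if_neg haR]
    · rw [hF.realArr 3 (by decide), h.cap a ha]
  unfold ArcNet.pushAt
  by_cases hb : B v = 0
  · have hm := (hT.into_spec hv (hgood.resolve_left (not_not.2 hb))).1
    have e1 := h.tl _ hm
    have e2 := h.flow _ hm
    rw [ArcNet.succ_of_eq hb, if_neg (not_not.2 hb)]
    refine ⟨by simp [pushBody, ops, eval, Op.apply, Test.Holds, h3, hB, hW, h6, hb, e1],
      key _ fun a ha => ?_⟩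
    have e3 := h.flow a ha
    simp [pushBody, ops, eval, Op.apply, Test.Holds, h3, hB, hW, h6, hb, e2, hx,
      Function.update_apply, e3]
  · have hm := (hT.out_spec hv hb).1
    have e1 := h.hd _ hm
    have e2 := h.flow _ hm
    rw [ArcNet.succ_of_ne hb, if_pos hb]
    refine ⟨by simp [pushBody, ops, eval, Op.apply, Test.Holds, h3, hB, h6, hb, e1],
      key _ fun a ha => ?_⟩
    have e3 := h.flow a ha
    simp [pushBody, ops, eval, Op.apply, Test.Holds, h3, hB, h6, hb, e2, hx,
      Function.update_apply, e3]

/-! ### One augmentation on the machine. -/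

section Augment

variable {σ : Store}

/-- The memory during an augmentation: vertex `v`, and tables `B` and `W`. -/
structure At (B W : ℕ → ℕ) (v : ℕ) (σ : Store) : Prop where
  out : σ.natArr 11 = B
  into : σ.natArr 12 = W
  vertex : σ.natReg 6 = v

/-- Only `size` rounds are needed, because by then the walk from the hub has entered its cycle. The
scan serves merely to count the rounds. -/
lemma runs_step (hσ : Data T m L f R σ) (hI : T.Inv f R) (hT : T.Tables f R B W)
    (h0 : B T.hub ≠ 0 ∨ W T.hub ≠ 0) (hA : At B W T.hub σ) :
    Runs (scan stepBody) σ (T.size * 7 + 2) fun τ => Data T m L f R τ ∧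
      At B W (T.base B W) τ := by
  refine (runs_scan (fun i τ => At B W ((T.succ B W)^[i] T.hub) τ) rfl (by decide) (by decide) hσ
    (fun i τ x h => ⟨h.1, h.2, by simpa using h.3⟩) hA ?_).mono
    (by have : stepBody.cost = 5 := rfl; rw [this]) fun τ h => h
  intro i _ τ hd _ hP
  obtain ⟨h1, h2⟩ := ArcNet.orbit_spec hI hT h0 i
  have hF := eval_frame (p := stepBody) rfl τ
  refine ⟨(hF.natArr 11 (by decide)).trans hP.1, (hF.natArr 12 (by decide)).trans hP.2, ?_⟩
  rw [Function.iterate_succ_apply']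
  exact eval_stepBody hd h1 h2 hT hP.1 hP.2 hP.3

/-- The register starts with the amount at the base, and the next `size` vertices cover the whole
cycle, whose length is at most `size`. Meeting vertices repeatedly does not affect a minimum. -/
lemma runs_min (hσ : Data T m L f R σ) (hI : T.Inv f R) (hT : T.Tables f R B W)
    (h0 : B T.hub ≠ 0 ∨ W T.hub ≠ 0) (hA : At B W (T.succ B W (T.base B W)) σ)
    (h5 : σ.realReg 5 = T.res f R B W (T.base B W)) {w : ℕ} (hw : σ.natReg 13 = w) :
    Runs (scan minBody) σ (T.size * 13 + 2) fun τ => Data T m L f R τ ∧ τ.natArr 11 = B ∧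
      τ.natArr 12 = W ∧ τ.natReg 13 = w ∧
      (∀ i, τ.realReg 5 ≤ T.res f R B W ((T.succ B W)^[i] (T.base B W))) ∧
      ∃ i, T.res f R B W ((T.succ B W)^[i] (T.base B W)) = τ.realReg 5 := by
  refine (runs_scan (fun i τ => At B W ((T.succ B W)^[i + 1] (T.base B W)) τ ∧ τ.natReg 13 = w ∧
      (∀ j ≤ i, τ.realReg 5 ≤ T.res f R B W ((T.succ B W)^[j] (T.base B W))) ∧
      ∃ j, T.res f R B W ((T.succ B W)^[j] (T.base B W)) = τ.realReg 5) rfl (by decide)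
    (by decide) hσ (fun i τ x h => ⟨⟨h.1.1, h.1.2, by simpa using h.1.3⟩, by simpa using h.2.1,
      h.2.2⟩) ⟨hA, hw, fun j hj => ?_, 0, h5.symm⟩ ?_).mono
    (by have : minBody.cost = 11 := rfl; rw [this])
    fun τ ⟨h1, h2, h3, h4, h5⟩ => ⟨h1, h2.1, h2.2, h3, fun i => ?_, h5⟩
  · obtain rfl : j = 0 := by omega
    exact h5.le
  · intro i _ τ hd _ ⟨hP, h13, hle, hex⟩
    obtain ⟨h1, h2⟩ := ArcNet.cycle_spec hI hT h0 (i + 1)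
    have hF := eval_frame (p := minBody) rfl τ
    obtain ⟨e1, e2⟩ := eval_resBody hd h1 h2 hT hP.1 hP.2 hP.3
    have hF' := (eval_frame (p := resBody) rfl τ).realReg 5 (by decide)
    have e5 : (minBody.eval τ).realReg 5 = min (τ.realReg 5)
        (T.res f R B W ((T.succ B W)^[i + 1] (T.base B W))) := by
      rw [← hF', ← e2]
      unfold minBody
      simp only [eval]
      by_cases h : (Test.realLt 1 5).Holds (resBody.eval τ)
      · rw [if_pos h, min_eq_right (le_of_lt h)]
        simp [Op.apply]
      · rw [if_neg h, min_eq_left (not_lt.1 h)]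
    have e6 : (minBody.eval τ).natReg 6 = (resBody.eval τ).natReg 6 := by
      unfold minBody
      simp only [eval]
      split_ifs <;> simp [Op.apply]
    refine ⟨⟨(hF.natArr 11 (by decide)).trans hP.1, (hF.natArr 12 (by decide)).trans hP.2, ?_⟩,
      (hF.natReg 13 (by decide)).trans h13, fun j hj => ?_, ?_⟩
    · rw [e6, e1, Function.iterate_succ_apply' _ (i + 1)]
    · rw [e5]
      rcases Nat.lt_or_eq_of_le hj with h | rfl
      · exact (min_le_left _ _).trans (hle j (by omega))
      · exact min_le_right _ _
    · rw [e5]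
      rcases min_choice (τ.realReg 5)
        (T.res f R B W ((T.succ B W)^[i + 1] (T.base B W))) with h | h
      · rw [h]; exact hex
      · rw [h]; exact ⟨_, rfl⟩
  · have hp := ArcNet.period_le hI hT h0
    have hp' := Nat.mod_lt i (ArcNet.period_pos hI hT h0)
    have := h4 (i % T.period B W) (by omega)
    unfold ArcNet.period at this
    rwa [Function.iterate_mod_minimalPeriod_eq] at this

/-- The first push precedes the loop, since the walk starts at the vertex where it has to stop. The
loop performs the remaining `period - 1` pushes; minimality of the period ensures that it does not
stop earlier. -/
lemma runs_push (hσ : Data T m L f R σ) (hI : T.Inv f R) (hT : T.Tables f R B W)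
    (h0 : B T.hub ≠ 0 ∨ W T.hub ≠ 0) (hA : At B W (T.base B W) σ) {x : ℝ}
    (h5 : σ.realReg 5 = x) (hw : σ.natReg 13 = T.base B W) :
    Runs (.seq pushBody (.loop (.natNe 6 13) pushBody)) σ (T.size * 12 + 12)
      fun τ => Data T m L (T.pushed B W x f) R τ := by
  set P : ℕ → Store → Prop := fun j τ => Data T m L (T.push B W x f (T.base B W) j) R τ ∧
    At B W ((T.succ B W)^[j] (T.base B W)) τ ∧ τ.realReg 5 = x ∧ τ.natReg 13 = T.base B W with hP
  have hlf : pushBody.loopFree = true := rfl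
  have hcost : pushBody.cost = 11 := rfl
  have hstep : ∀ j τ, P j τ → P (j + 1) (pushBody.eval τ) := by
    rintro j τ ⟨hd, hA, h5, hw⟩
    obtain ⟨h1, h2⟩ := ArcNet.cycle_spec hI hT h0 j
    have hF := eval_frame hlf τ
    obtain ⟨e1, e2⟩ := eval_pushBody hd h1 h2 hT hA.1 hA.2 hA.3 h5
    refine ⟨e2, ⟨(hF.natArr 11 (by decide)).trans hA.1, (hF.natArr 12 (by decide)).trans hA.2, ?_⟩,
      (hF.realReg 5 (by decide)).trans h5, (hF.natReg 13 (by decide)).trans hw⟩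
    rw [Function.iterate_succ_apply']
    exact e1
  have hpos := ArcNet.period_pos hI hT h0
  have hle := ArcNet.period_le hI hT h0
  refine ((runs_of_loopFree hlf σ).seq (B' := T.size * 12 + 1) fun τ hτ => ?_).mono
    (by omega) fun _ h => h
  subst hτ
  have hloop := Runs.loop (b := .natNe 6 13) (p := pushBody) (c := 11) (T.period B W - 1)
    (fun j τ => P (j + 1) τ) (fun j hj τ hPj => ⟨?_, ?_⟩) (fun τ hPj => ?_)
    (hstep 0 σ ⟨hσ, hA, h5, hw⟩)
  · refine hloop.mono (by omega) fun τ hτ => ?_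
    have := hτ.1
    rwa [Nat.sub_add_cancel hpos] at this
  · simp only [Test.Holds]
    rw [hPj.2.1.3, hPj.2.2.2]
    intro h
    exact absurd (Function.IsPeriodicPt.minimalPeriod_le (Nat.succ_pos j) h)
      (by have : j < Function.minimalPeriod (T.succ B W) (T.base B W) - 1 := hj
          omega)
  · exact (runs_of_loopFree hlf τ).mono hcost.le fun υ hυ => hυ ▸ hstep _ τ hPj
  · simp only [Test.Holds, not_not]
    rw [hPj.2.1.3, hPj.2.2.2, Nat.sub_add_cancel hpos, ArcNet.iterate_period]

lemma runs_augment (hσ : Data T m L f R σ) (hI : T.Inv f R) (hT : T.Tables f R B W)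
    (h0 : B T.hub ≠ 0 ∨ W T.hub ≠ 0) (hB : σ.natArr 11 = B) (hW : σ.natArr 12 = W) :
    Runs augment σ (T.size * 32 + 30) fun τ => ∃ x,
      (∀ i, x ≤ T.res f R B W ((T.succ B W)^[i] (T.base B W))) ∧
      (∃ i, T.res f R B W ((T.succ B W)^[i] (T.base B W)) = x) ∧
      Data T m L (T.pushed B W x f) R τ := by
  have hlf1 : (Program.op (.natCopy 6 0)).loopFree = true := rfl
  have hlf2 : (Program.op (.natCopy 13 6)).loopFree = true := rfl
  have hlf3 : (Program.seq resBody (.op (.realCopy 5 1))).loopFree = true := rfl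
  have hlf4 : (Program.op (.natCopy 6 13)).loopFree = true := rfl
  have hc3 : (Program.seq resBody (.op (.realCopy 5 1))).cost = 10 := rfl
  refine ((runs_of_loopFree hlf1 σ).seq (B' := (T.size * 7 + 2) + (1 + (10 +
    ((T.size * 13 + 2) + (1 + (T.size * 12 + 12)))))) fun τ hτ => ?_).mono
    (by simp only [cost]; omega) fun _ h => h
  subst hτ
  have hd1 := hσ.eval hlf1 (by decide)
  refine (runs_step hd1 hI hT h0 ⟨hB, hW, by simp [eval, Op.apply, hσ.hub]⟩).seq
    fun τ ⟨hd2, hA2⟩ => ?_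
  refine (runs_of_loopFree hlf2 τ).seq fun υ hυ => ?_
  subst hυ
  have hd3 := hd2.eval hlf2 (by decide)
  have hA3 : At B W (T.base B W) ((Program.op (.natCopy 13 6)).eval τ) :=
    ⟨hA2.1, hA2.2, by simp [eval, Op.apply, hA2.3]⟩
  have hw3 : ((Program.op (.natCopy 13 6)).eval τ).natReg 13 = T.base B W := by
    simp [eval, Op.apply, hA2.3]
  generalize (Program.op (.natCopy 13 6)).eval τ = τ at hd3 hA3 hw3
  obtain ⟨h1, h2⟩ := ArcNet.cycle_spec hI hT h0 0
  obtain ⟨e1, e2⟩ := eval_resBody hd3 h1 h2 hT hA3.1 hA3.2 hA3.3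
  have hF := eval_frame hlf3 τ
  refine ((runs_of_loopFree hlf3 τ).mono hc3.le fun _ h => h).seq fun υ hυ => ?_
  subst hυ
  have hd4 := hd3.eval hlf3 (by decide)
  refine (runs_min hd4 hI hT h0 ⟨(hF.natArr 11 (by decide)).trans hA3.1,
    (hF.natArr 12 (by decide)).trans hA3.2, e1⟩ ?_
    ((hF.natReg 13 (by decide)).trans hw3)).seq fun τ ⟨hd5, h11, h12, h13, hmin, hex⟩ => ?_
  · simp only [eval, Op.apply, Function.update_self]
    exact e2
  refine (runs_of_loopFree hlf4 τ).seq fun υ hυ => ?_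
  subst hυ
  refine (runs_push (hd5.eval hlf4 (by decide)) hI hT h0 ⟨h11, h12, ?_⟩ rfl ?_).mono le_rfl
    fun υ hυ => ⟨_, hmin, hex, hυ⟩
  · simp [eval, Op.apply, h13]
  · simp [eval, Op.apply, h13]

end Augment

/-! ## The main loop -/

/-- Rejects the arc in register `13`, and opens its mirror arc in case of an excess arc. -/
def markArc : Program :=
  .seq (ops [.natStore 10 13 4, .natLoad 7 9 13])
    (.branch (.natEq 7 4) (ops [.realLoad 1 3 13, .natCopy 6 13, .natSucc 6, .realStore 3 6 1])
      .skip)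

/-- Augments, or clears the flag in register `11` if the hub is inactive. -/
def augmentOrStop : Program :=
  .seq (ops [.natLoad 6 11 0, .natLoad 7 12 0])
    (.seq (.branch (.natEq 6 3) (.op (.natCopy 6 7)) .skip)
      (.branch (.natEq 6 3) (.op (.natCopy 11 3)) augment))

/-- One phase. -/
def phase : Program :=
  .seq tables (.seq findMark (.branch (.natNe 13 3) markArc augmentOrStop))

lemma dcap_insert {r a : ℕ} (ha : a ∈ T.arcs) (h : ¬ (T.IsExcess r ∧ a = r + 1)) :
    T.dcap (insert r R) a = T.dcap R a := by
  rw [mem_arcs_iff] at ha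
  have key : (T.IsExcess (a - 1) ∧ a - 1 ∉ insert r R) ↔ (T.IsExcess (a - 1) ∧ a - 1 ∉ R) := by
    refine and_congr_right fun he => not_congr ⟨fun h1 => h1.resolve_left ?_, Or.inr⟩
    rintro rfl
    exact h ⟨he, by omega⟩
  unfold ArcNet.dcap
  split_ifs <;> tauto

/-- An excess arc is not itself a mirror arc, so its entry in the capacity array is its full
capacity; `markArc` opens the mirror by copying that entry. -/
lemma dcap_mirror {r : ℕ} (h : T.IsExcess r) : T.dcap (insert r R) (r + 1) = T.dcap R r := by
  have h1 := mem_arcs_iff.1 (T.excess_mem r h)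
  unfold ArcNet.dcap
  rw [if_neg, if_neg, T.mirror_cap r h]
  · rintro ⟨h2, -⟩
    have := T.mirror_not_excess _ h2
    rw [Nat.sub_add_cancel h1.1] at this
    exact this h
  · rintro ⟨-, h2⟩
    exact h2 (Set.mem_insert r R)

lemma eval_markArc {σ : Store} (h : Data T m L f R σ) (hr : σ.natReg 13 ∈ T.arcs) :
    Data T m L f (insert (σ.natReg 13) R) (markArc.eval σ) := by
  have hF := eval_frame (p := markArc) rfl σ
  have h3 := h.excess _ hr
  have h4 := h.one
  have h10 : (markArc.eval σ).natArr 10 = Function.update (σ.natArr 10) (σ.natReg 13) 1 := by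
    by_cases he : T.IsExcess (σ.natReg 13)
    · rw [if_pos he] at h3
      simp [markArc, ops, eval, Op.apply, Test.Holds, h3, h4]
    · rw [if_neg he] at h3
      simp [markArc, ops, eval, Op.apply, Test.Holds, h3, h4]
  refine h.update hF (by decide) (by decide) (by decide) (by decide) (fun a ha haR => ?_)
    (fun a ha haR => ?_) (fun a ha => ?_) (fun a ha => ?_)
  · rw [h10, Function.update_apply]
    split_ifs with h1
    · rfl
    · rw [h.rejected a ha, if_pos (haR.resolve_left h1)]
  · have h1 : a ≠ σ.natReg 13 := fun h => haR (Or.inl h)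
    rw [h10, Function.update_of_ne h1, h.rejected a ha, if_neg fun h => haR (Or.inr h)]
  · by_cases he : T.IsExcess (σ.natReg 13)
    · rw [if_pos he] at h3
      have : (markArc.eval σ).realArr 3 = Function.update (σ.realArr 3) (σ.natReg 13 + 1)
          (σ.realArr 3 (σ.natReg 13)) := by
        simp [markArc, ops, eval, Op.apply, Test.Holds, h3, h4]
      rw [this, Function.update_apply]
      split_ifs with h1
      · rw [h1, dcap_mirror he, h.cap _ hr]
      · rw [h.cap a ha, dcap_insert ha fun h => h1 h.2]
    · rw [if_neg he] at h3
      have : (markArc.eval σ).realArr 3 = σ.realArr 3 := by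
        simp [markArc, ops, eval, Op.apply, Test.Holds, h3, h4]
      rw [this, h.cap a ha, dcap_insert ha fun h => he h.1]
  · rw [hF.realArr 4 (by decide), h.flow a ha]

/-- The states of the algorithm: the invariants hold, and no solution has been passed. -/
structure Valid (T : ArcNet) (f : ℕ → ℝ) (R : Set ℕ) : Prop where
  inv : T.Inv f R
  compat : ∀ {G D act}, T.Witness G D act → T.Compat G act f R

/-- The final states: the hub is inactive. -/
structure Final (T : ArcNet) (f : ℕ → ℝ) (R : Set ℕ) : Prop extends Valid T f R where
  out : ∀ a ∈ T.arcs, T.tl a = T.hub → ¬ T.Avail f R a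
  excess : ∀ q, T.IsExcess q → f q = 0

lemma valid_zero : Valid T (fun _ => 0) ∅ := ⟨ArcNet.inv_zero, fun _ => ArcNet.compat_zero⟩

/-- The intermediate results of the tables. -/
def Picks (T : ArcNet) (f : ℕ → ℝ) (R : Set ℕ) (B W : ℕ → ℕ) : Prop :=
  ∀ v, T.Rel v → IsPick {a | a ∈ T.arcs ∧ T.tl a = v ∧ T.Avail f R a} T.OutBetter (B v) ∧
    IsPick {a | a ∈ T.arcs ∧ T.hd a = v ∧ T.Cand f R a} (fun a b => T.InBetter b a) (W v)

lemma Valid.insert (h : Valid T f R) (hp : Picks T f R B W) {r : ℕ} (hr : r ∈ T.arcs)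
    (hM : Marked T f R B W r) : Valid T f (insert r R) := by
  obtain ⟨-, ⟨h1, h2, h3⟩ | ⟨h1, h2⟩⟩ := hM
  · obtain ⟨p1, p2⟩ := hp _ (rel_hd hr)
    rw [h2] at p1
    rw [h3] at p2
    have := h.inv.insert_worst h1 p1 p2 hr
    exact ⟨this.1, fun hW => this.2 hW (h.compat hW)⟩
  · exact ⟨h.inv.insert (Or.inl h1), fun hW => (h.compat hW).insert_excess h.inv hW h1 h2⟩

lemma Picks.tables (hp : Picks T f R B W) (hM : ∀ b ∈ T.arcs, ¬ Marked T f R B W b) :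
    T.Tables f R B W :=
  ⟨fun v hv => (hp v hv).1, fun v hv => (hp v hv).2,
    fun a ha hR hub h1 h2 => hM a ha ⟨hR, Or.inl ⟨hub, h1, h2⟩⟩⟩

/-- An excess arc with flow would be marked if it were not rejected, and would be a candidate at the
hub if it were. -/
lemma Valid.final (h : Valid T f R) (hp : Picks T f R B W)
    (hM : ∀ b ∈ T.arcs, ¬ Marked T f R B W b) (h1 : B T.hub = 0) (h2 : W T.hub = 0) :
    Final T f R where
  toValid := h
  out := (hp.tables hM).out_none (Or.inl rfl) h1
  excess q hq := by
    have hqa : q ∈ T.arcs := T.excess_mem q hq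
    refine le_antisymm (not_lt.1 fun hpos => ?_) (h.inv.nonneg q hqa)
    by_cases hR : q ∈ R
    · exact (hp.tables hM).into_none (Or.inl rfl) h2 q hqa (T.excess_hd q hq) (Or.inr ⟨hR, hpos⟩)
    · exact hM q hqa ⟨hR, Or.inr ⟨hq, hpos⟩⟩

lemma res_pos (hI : T.Inv f R) (hT : T.Tables f R B W) (h0 : B T.hub ≠ 0 ∨ W T.hub ≠ 0) (i : ℕ) :
    0 < T.res f R B W ((T.succ B W)^[i] (T.base B W)) := by
  obtain ⟨h1, h2⟩ := ArcNet.cycle_spec hI hT h0 i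
  unfold ArcNet.res
  split_ifs with hB
  · exact sub_pos.2 (hT.out_spec h1 hB).2.2.1.2
  · exact (hT.back_spec h1 (not_not.1 hB) (h2.resolve_left hB)).2

/-- The possible results of a phase. -/
def PhaseResult (T : ArcNet) (m : ℕ) (L f : ℕ → ℝ) (R : Set ℕ) (τ : Store) : Prop :=
  (∃ f' R', Data T m L f' R' τ ∧ Valid T f' R' ∧ T.potential f' R' < T.potential f R ∧
    τ.natReg 11 = 1) ∨ (Data T m L f R τ ∧ Final T f R ∧ τ.natReg 11 = 0)

lemma runs_augmentOrStop {σ : Store} (hσ : Data T m L f R σ) (hV : Valid T f R)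
    (hp : Picks T f R B W) (hM : ∀ b ∈ T.arcs, ¬ Marked T f R B W b) (hB : σ.natArr 11 = B)
    (hW : σ.natArr 12 = W) (h11 : σ.natReg 11 = 1) :
    Runs augmentOrStop σ (T.size * 32 + 35) (PhaseResult T m L f R) := by
  set p1 : Program := ops [.natLoad 6 11 0, .natLoad 7 12 0] with hp1
  set p2 : Program := .branch (.natEq 6 3) (.op (.natCopy 6 7)) .skip with hp2
  have hlf : (Program.seq p1 p2).loopFree = true := rfl
  have hF := eval_frame hlf σ
  have hd := hσ.eval hlf (by decide)
  have h6 : ((Program.seq p1 p2).eval σ).natReg 6 = 0 ↔ B T.hub = 0 ∧ W T.hub = 0 := by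
    by_cases hB0 : B T.hub = 0
    · simp [hp1, hp2, ops, eval, Op.apply, Test.Holds, hB, hW, hσ.hub, hσ.zero, hB0]
    · simp [hp1, hp2, ops, eval, Op.apply, Test.Holds, hB, hσ.hub, hσ.zero, hB0]
  have key : Runs (.branch (.natEq 6 3) (.op (.natCopy 11 3)) augment)
      ((Program.seq p1 p2).eval σ) (T.size * 32 + 30 + 1) (PhaseResult T m L f R) := by
    refine Runs.branch (fun hb => ?_) fun hb => ?_
    · simp only [Test.Holds] at hb
      rw [hd.zero, h6] at hb
      refine (runs_of_loopFree (p := .op (.natCopy 11 3)) rfl _).mono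
        (by simp only [cost]; omega) fun τ hτ => Or.inr ?_
      subst hτ
      refine ⟨hd.eval rfl (by decide), hV.final hp hM hb.1 hb.2, ?_⟩
      have := hd.zero
      simpa [eval, Op.apply] using this
    · simp only [Test.Holds] at hb
      rw [hd.zero, h6, not_and_or] at hb
      have hT := hp.tables hM
      refine (runs_augment hd hV.inv hT hb ((hF.natArr 11 (by decide)).trans hB)
        ((hF.natArr 12 (by decide)).trans hW)).frame.mono le_rfl
        fun τ ⟨hFτ, x, hx, ⟨k, hk⟩, hdτ⟩ => Or.inl ⟨_, R, hdτ, ⟨?_, fun hWit => ?_⟩, ?_, ?_⟩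
      · refine hV.inv.pushed hT hb ?_ hx
        rw [← hk]; exact (res_pos hV.inv hT hb k).le
      · exact (hV.compat hWit).pushed hV.inv hWit hT hb hx
      · exact ArcNet.potential_pushed hV.inv hT hb hk
      · rw [hFτ.natReg 11 (by decide), hF.natReg 11 (by decide), h11]
  -- `key` starts from the joint effect of `p1` and `p2`, whereas `augmentOrStop` groups `p2` with
  -- the final branch; the execution is reassembled accordingly.
  obtain ⟨t1, τ1, e1, e2, rfl⟩ := runs_of_loopFree (p := p1) rfl σ
  obtain ⟨t2, τ2, e3, e4, rfl⟩ := runs_of_loopFree (p := p2) rfl (p1.eval σ)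
  obtain ⟨t3, τ3, e5, e6, e7⟩ := key
  have c1 : p1.cost = 2 := rfl
  have c2 : p2.cost = 2 := rfl
  exact ⟨_, τ3, .seq e1 (.seq e3 e5), by omega, e7⟩

/-- Linear in the number of arcs: four scans always, at most two more in an augmentation, and one
walk around the cycle. -/
lemma runs_phase {σ : Store} (hσ : Data T m L f R σ) (hV : Valid T f R)
    (h11 : σ.natReg 11 = 1) :
    Runs phase σ (T.size * 93 + 47) (PhaseResult T m L f R) := by
  refine ((runs_tables hσ).frame.seq (B' := (T.size * 16 + 3) + (T.size * 32 + 35 + 1))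
    fun τ ⟨hF, hd, hp⟩ => ?_).mono (by omega) fun _ h => h
  have h11' := (hF.natReg 11 (by decide)).trans h11
  refine (runs_findMark hd rfl rfl).frame.seq fun υ ⟨hF', hd', hB, hW, hM⟩ => ?_
  have h11'' := (hF'.natReg 11 (by decide)).trans h11'
  refine Runs.branch (fun hb => ?_) fun hb => ?_
  · simp only [Test.Holds] at hb
    rw [hd'.zero] at hb
    have hM' := hM.resolve_left fun h => hb h.1
    refine (runs_of_loopFree (p := markArc) rfl υ).mono
      (by have : markArc.cost = 7 := rfl; omega) fun τ' hτ' => Or.inl ?_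
    subst hτ'
    refine ⟨f, _, eval_markArc hd' hM'.1, hV.insert hp hM'.1 hM'.2,
      ArcNet.potential_insert hM'.1 hM'.2.1, ?_⟩
    rw [(eval_frame (p := markArc) rfl υ).natReg 11 (by decide), h11'']
  · simp only [Test.Holds, not_not] at hb
    rw [hd'.zero] at hb
    have hM' : ∀ b ∈ T.arcs, ¬ Marked T f R (τ.natArr 11) (τ.natArr 12) b := by
      rcases hM with h | h
      · exact h.2
      · exact absurd hb (ArcNet.ne_zero_of_mem h.1)
    exact runs_augmentOrStop hd' hV hp hM' hB hW h11''

/-- The main loop reaches a final state within a quadratic number of steps. -/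
lemma runs_main {σ : Store} (hσ : Data T m L f R σ) (hV : Valid T f R) (h11 : σ.natReg 11 = 1) :
    Runs (.loop (.natEq 11 4) phase) σ ((3 * T.size + 1) * (T.size * 93 + 48) + 1) fun τ =>
      ∃ f R, Data T m L f R τ ∧ Final T f R := by
  refine (Runs.loop_of_decreasing (c := T.size * 93 + 47)
    (fun k τ => ∃ f R, Data T m L f R τ ∧ Valid T f R ∧ T.potential f R = k ∧ τ.natReg 11 = 1)
    (fun τ => ∃ f R, Data T m L f R τ ∧ Final T f R) ?_ (T.potential f R)
    ⟨f, R, hσ, hV, rfl, h11⟩).mono ?_ fun _ h => h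
  · rintro k τ ⟨f, R, hd, hV, rfl, h11⟩
    refine ⟨by simp only [Test.Holds]; rw [h11, hd.one], ?_⟩
    refine (runs_phase hd hV h11).mono le_rfl fun υ hυ => ?_
    rcases hυ with ⟨f', R', h1, h2, h3, h4⟩ | ⟨h1, h2, h3⟩
    · exact Or.inl ⟨_, h3, f', R', h1, h2, rfl, h4⟩
    · refine Or.inr ⟨⟨f, R, h1, h2⟩, ?_⟩
      simp only [Test.Holds]
      rw [h3, h1.one]
      omega
  -- The potential can drop in at most `3 * T.size` phases; one further phase clears the flag.
  · have := ArcNet.potential_le (T := T) f R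
    exact Nat.add_le_add_right (Nat.mul_le_mul (by omega) (by omega)) 1

/-! ## Building the arc network -/

/-- Loads the edge held in register `5`: its ends, ranks, and the capacities of its parts. Sets
register `12` to `1` if the bounds of the edge contradict each other. -/
def loadEdge : Program :=
  .seq (ops [.natLoad 6 0 5, .natLoad 8 4 6])
  (.seq (.branch (.natEq 8 4) (.op (.natCopy 6 0)) .skip)
  (.seq (ops [.natLoad 7 1 5, .natLoad 8 4 7])
  (.seq (.branch (.natEq 8 4) (.op (.natCopy 7 0)) .skip)
  (.seq (ops [.natLoad 8 2 5, .natLoad 9 3 5, .realLoad 1 0 5, .realLoad 2 1 5, .realLoad 3 2 5])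
  (.seq (.branch (.realLt 1 3) (.op (.realCopy 3 1)) .skip)
  (.seq (.branch (.realLt 3 2) (.op (.natCopy 12 4)) .skip)
  (ops [.realSub 4 3 2, .realSub 5 1 3])))))))

/-- Appends an arc: tail, head and excess indicator are held in the registers `t`, `h`, `x`, the
ranks in the registers `8` and `9`, the capacity in the real register `c`. -/
def appendArc (t h x c : ℕ) : Program :=
  ops [.natSucc 2, .natStore 5 2 t, .natStore 6 2 h, .natStore 7 2 8, .natStore 8 2 9,
    .natStore 9 2 x, .realStore 3 2 c]

/-- Appends the five arcs of the edge held in register `5`. -/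
def splitEdge : Program :=
  .seq loadEdge (.seq (appendArc 0 7 3 2) (.seq (appendArc 6 0 3 2) (.seq (appendArc 6 7 3 4)
    (.seq (appendArc 6 0 4 5) (.seq (appendArc 0 7 3 0) (.op (.natSucc 5)))))))

/-- What the memory holds about an arc. -/
structure Row where
  tl : ℕ
  hd : ℕ
  outR : ℕ
  inR : ℕ
  excess : ℕ
  cap : ℝ

/-- The data held in the memory about the arc `a`. -/
def Store.row (σ : Store) (a : ℕ) : Row :=
  ⟨σ.natArr 5 a, σ.natArr 6 a, σ.natArr 7 a, σ.natArr 8 a, σ.natArr 9 a, σ.realArr 3 a⟩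

/-- Register `2`, the arc counter, is incremented before anything is stored, so it must not be among
the sources. -/
lemma row_appendArc (t h x c : ℕ) (ht : t ≠ 2) (hh : h ≠ 2) (hx : x ≠ 2) (σ : Store) (a : ℕ) :
    ((appendArc t h x c).eval σ).row a = if a = σ.natReg 2 + 1 then
      ⟨σ.natReg t, σ.natReg h, σ.natReg 8, σ.natReg 9, σ.natReg x, σ.realReg c⟩ else σ.row a := by
  split_ifs with ha
  · simp [appendArc, ops, Program.eval, Op.apply, Store.row, ht, hh, hx, ha]
  · simp [appendArc, ops, Program.eval, Op.apply, Store.row, ha]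

lemma natReg_appendArc (t h x c : ℕ) (σ : Store) (r : ℕ) :
    ((appendArc t h x c).eval σ).natReg r = if r = 2 then σ.natReg 2 + 1 else σ.natReg r := by
  split_ifs with hr
  · simp [appendArc, ops, Program.eval, Op.apply, hr]
  · simp [appendArc, ops, Program.eval, Op.apply, hr]

lemma realReg_appendArc (t h x c : ℕ) (σ : Store) (r : ℕ) :
    ((appendArc t h x c).eval σ).realReg r = σ.realReg r := rfl

lemma row_natSucc (d : ℕ) (σ : Store) (a : ℕ) : ((Op.natSucc d).apply σ).row a = σ.row a := rfl

lemma eval_seq (p q : Program) (σ : Store) : (Program.seq p q).eval σ = q.eval (p.eval σ) := rfl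

lemma eval_op (o : Op) (σ : Store) : (Program.op o).eval σ = o.apply σ := rfl

namespace Network

variable {n k : ℕ} (I : Network n k)

/-- The data of the `j`-th arc of the edge `e`. -/
def row (e : Fin k) (j : ℕ) : Row where
  tl := if j = 0 ∨ j = 4 then n else I.vtx (I.tail e)
  hd := if j = 1 ∨ j = 3 then n else I.vtx (I.head e)
  outR := I.outRank e
  inR := I.inRank e
  excess := if j = 3 then 1 else 0
  -- The mirror arc starts closed: the memory holds current capacities.
  cap := if j = 4 then 0 else if j ≤ 1 then I.lower e else if j = 2 then I.ub e - I.lower e else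
    I.cap e - I.ub e

/-- The constants and the part of the input that are not changed while the arc network is built. -/
structure InputData (σ : Store) : Prop where
  hub : σ.natReg 0 = n
  edges : σ.natReg 1 = k
  zero : σ.natReg 3 = 0
  one : σ.natReg 4 = 1
  rzero : σ.realReg 0 = 0
  tail : σ.natArr 0 = arrayOf fun e => (I.tail e : ℕ)
  head : σ.natArr 1 = arrayOf fun e => (I.head e : ℕ)
  outRank : σ.natArr 2 = arrayOf I.outRank
  inRank : σ.natArr 3 = arrayOf I.inRank
  terminal : σ.natArr 4 = arrayOf fun v => if I.terminal v = true then 1 else 0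
  rejected : σ.natArr 10 = fun _ => 0
  cap : σ.realArr 0 = arrayOf I.cap
  lower : σ.realArr 1 = arrayOf I.lower
  upper : σ.realArr 2 = arrayOf I.upper
  flow : σ.realArr 4 = fun _ => 0

variable {I}

lemma InputData.frame {p : Program} {σ τ : Store} (h : I.InputData σ) (hF : Frame p σ τ)
    (h1 : ∀ r ∈ p.natRegs, r = 2 ∨ 5 ≤ r) (h2 : ∀ r ∈ p.realRegs, 1 ≤ r)
    (h3 : ∀ A ∈ p.natArrs, 5 ≤ A ∧ A ≠ 10) (h4 : ∀ A ∈ p.realArrs, A = 3) : I.InputData τ := by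
  have e1 : ∀ r, r ≠ 2 → r < 5 → τ.natReg r = σ.natReg r := fun r hr hr' =>
    hF.natReg r fun hm => by have := h1 r hm; omega
  have e2 : τ.realReg 0 = σ.realReg 0 := hF.realReg 0 fun hm => by have := h2 0 hm; omega
  have e3 : ∀ A, A < 5 ∨ A = 10 → τ.natArr A = σ.natArr A := fun A hA =>
    hF.natArr A fun hm => by have := h3 A hm; omega
  have e4 : ∀ A, A ≠ 3 → τ.realArr A = σ.realArr A := fun A hA => hF.realArr A fun hm => hA (h4 A hm)
  constructor
  case hub => rw [e1 0 (by omega) (by omega), h.hub]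
  case edges => rw [e1 1 (by omega) (by omega), h.edges]
  case zero => rw [e1 3 (by omega) (by omega), h.zero]
  case one => rw [e1 4 (by omega) (by omega), h.one]
  case rzero => rw [e2, h.rzero]
  case tail => rw [e3 0 (by omega), h.tail]
  case head => rw [e3 1 (by omega), h.head]
  case outRank => rw [e3 2 (by omega), h.outRank]
  case inRank => rw [e3 3 (by omega), h.inRank]
  case terminal => rw [e3 4 (by omega), h.terminal]
  case rejected => rw [e3 10 (by omega), h.rejected]
  case cap => rw [e4 0 (by omega), h.cap]
  case lower => rw [e4 1 (by omega), h.lower]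
  case upper => rw [e4 2 (by omega), h.upper]
  case flow => rw [e4 4 (by omega), h.flow]

lemma arrayOf_apply {α : Type} [Zero α] (f : Fin k → α) (e : Fin k) : arrayOf f e = f e :=
  dif_pos e.2

lemma vtx_eq_ite (v : Fin n) : I.vtx v = if arrayOf
    (fun v => if I.terminal v = true then 1 else 0) (v : ℕ) = 1 then n else (v : ℕ) := by
  rw [arrayOf_apply]
  unfold vtx
  split_ifs <;> simp_all

lemma eval_loadEdge {σ : Store} (hσ : I.InputData σ) {e : Fin k} (h5 : σ.natReg 5 = e) :
    (loadEdge.eval σ).natReg 6 = I.vtx (I.tail e) ∧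
    (loadEdge.eval σ).natReg 7 = I.vtx (I.head e) ∧
    (loadEdge.eval σ).natReg 8 = I.outRank e ∧ (loadEdge.eval σ).natReg 9 = I.inRank e ∧
    (loadEdge.eval σ).realReg 2 = I.lower e ∧
    (loadEdge.eval σ).realReg 4 = I.ub e - I.lower e ∧
    (loadEdge.eval σ).realReg 5 = I.cap e - I.ub e ∧
    (loadEdge.eval σ).natReg 12 = if I.ub e < I.lower e then 1 else σ.natReg 12 := by
  rw [vtx_eq_ite, vtx_eq_ite, ub]
  generalize hx : arrayOf (fun v => if I.terminal v = true then 1 else 0) (I.tail e : ℕ) = x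
  generalize hy : arrayOf (fun v => if I.terminal v = true then 1 else 0) (I.head e : ℕ) = y
  by_cases hc : I.cap e < I.upper e
  · rw [min_eq_right hc.le]
    by_cases hl : I.cap e < I.lower e <;> by_cases hx1 : x = 1 <;> by_cases hy1 : y = 1 <;>
      simp [loadEdge, ops, Program.eval, Op.apply, Test.Holds, h5, hσ.hub, hσ.one, hσ.tail,
        hσ.head, hσ.outRank, hσ.inRank, hσ.terminal, hσ.cap, hσ.lower, hσ.upper, arrayOf_apply,
        hx, hy, hx1, hy1, hc, hl]
  · rw [min_eq_left (not_lt.1 hc)]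
    by_cases hl : I.upper e < I.lower e <;> by_cases hx1 : x = 1 <;> by_cases hy1 : y = 1 <;>
      simp [loadEdge, ops, Program.eval, Op.apply, Test.Holds, h5, hσ.hub, hσ.one, hσ.tail,
        hσ.head, hσ.outRank, hσ.inRank, hσ.terminal, hσ.cap, hσ.lower, hσ.upper, arrayOf_apply,
        hx, hy, hx1, hy1, hc, hl]

/-- The memory after the arcs of the first `i` edges have been built. -/
structure SplitData (I : Network n k) (i : ℕ) (σ : Store) : Prop extends I.InputData σ where
  size : σ.natReg 2 = 5 * i
  counter : σ.natReg 5 = i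
  row : ∀ e : Fin k, (e : ℕ) < i → ∀ j < 5, σ.row (arc e j) = I.row e j
  bounds : (σ.natReg 12 = 0 ∧ ∀ e : Fin k, (e : ℕ) < i → I.lower e ≤ I.ub e) ∨
    (σ.natReg 12 = 1 ∧ ∃ e, I.ub e < I.lower e)

lemma SplitData.eval {i : ℕ} (hi : i < k) {σ : Store} (hσ : I.SplitData i σ) :
    I.SplitData (i + 1) (splitEdge.eval σ) := by
  obtain ⟨a6, a7, a8, a9, b2, b4, b5, a12⟩ :=
    eval_loadEdge (e := ⟨i, hi⟩) hσ.toInputData hσ.counter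
  have hτ : I.InputData (loadEdge.eval σ) := hσ.toInputData.frame (eval_frame rfl σ)
    (by decide) (by decide) (by decide) (by decide)
  have hF := eval_frame (p := loadEdge) rfl σ
  have c2 := (hF.natReg 2 (by decide)).trans hσ.size
  have c5 := (hF.natReg 5 (by decide)).trans hσ.counter
  have hrow : ∀ a, (loadEdge.eval σ).row a = σ.row a := by
    intro a
    unfold Store.row
    rw [hF.natArr 5 (by decide), hF.natArr 6 (by decide), hF.natArr 7 (by decide),
      hF.natArr 8 (by decide), hF.natArr 9 (by decide), hF.realArr 3 (by decide)]
  refine ⟨hσ.toInputData.frame (eval_frame (p := splitEdge) rfl σ) (by decide) (by decide)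
    (by decide) (by decide), ?_, ?_, ?_, ?_⟩
  · simp [splitEdge, Program.eval, natReg_appendArc, Op.apply, c2]
    omega
  · simp [splitEdge, Program.eval, natReg_appendArc, Op.apply, c5]
  · intro e he j hj
    rw [splitEdge]
    simp only [eval_seq, eval_op, row_natSucc, row_appendArc, natReg_appendArc, realReg_appendArc, ne_eq, OfNat.zero_ne_ofNat,
      Nat.reduceEqDiff, not_false_eq_true, c2, a6, a7, a8, a9, b2, b4, b5, hτ.hub, hτ.zero, hτ.one,
      hτ.rzero, if_true, if_false, hrow]
    rcases Nat.lt_succ_iff_lt_or_eq.1 he with he' | he'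
    -- The five arcs appended now have larger numbers than all arcs of earlier edges.
    · unfold arc at *
      rw [if_neg (by omega), if_neg (by omega), if_neg (by omega), if_neg (by omega),
        if_neg (by omega)]
      exact hσ.row e he' j hj
    · obtain rfl : e = ⟨i, hi⟩ := Fin.ext he'
      unfold arc
      interval_cases j <;> simp [Network.row]
  · have h12 : (splitEdge.eval σ).natReg 12 = (loadEdge.eval σ).natReg 12 := by
      simp [splitEdge, Program.eval, natReg_appendArc, Op.apply]
    rw [h12, a12]
    split_ifs with hl
    · exact Or.inr ⟨rfl, _, hl⟩
    · rcases hσ.bounds with ⟨h1, h2⟩ | h1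
      · refine Or.inl ⟨h1, fun e he => ?_⟩
        rcases Nat.lt_succ_iff_lt_or_eq.1 he with he' | he'
        · exact h2 e he'
        · obtain rfl : e = ⟨i, hi⟩ := Fin.ext he'
          exact not_lt.1 hl
      · exact Or.inr h1

/-- The memory after the constant in register `4` has been set. -/
lemma splitData_zero : I.SplitData 0 ((Op.natConst 4 1).apply I.input) where
  hub := rfl
  edges := rfl
  zero := rfl
  one := rfl
  rzero := rfl
  tail := rfl
  head := rfl
  outRank := rfl
  inRank := rfl
  terminal := rfl
  rejected := rfl
  cap := rfl
  lower := rfl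
  upper := rfl
  flow := rfl
  size := rfl
  counter := rfl
  row := fun _ he => absurd he (Nat.not_lt_zero _)
  bounds := Or.inl ⟨rfl, fun _ he => absurd he (Nat.not_lt_zero _)⟩

lemma runs_split {σ : Store} (hσ : I.SplitData 0 σ) :
    Runs (.loop (.natLt 5 1) splitEdge) σ (k * 60 + 1) (I.SplitData k) :=
  Runs.loop (c := 59) k I.SplitData
    (fun i hi τ hτ => ⟨by simp only [Test.Holds, hτ.counter, hτ.edges, hi],
      (runs_of_loopFree (p := splitEdge) rfl τ).mono (by decide)
        fun υ hυ => by subst hυ; exact hτ.eval hi⟩)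
    (fun τ hτ => by simp [Test.Holds, hτ.counter, hτ.edges]) hσ

/-- With nothing rejected, the current capacity of a mirror arc is `0` and that of any other arc is
its full capacity, as in `Network.row`. -/
lemma SplitData.data (h : ∀ e, I.lower e ≤ I.ub e) {σ : Store} (hσ : I.SplitData k σ) :
    Data (I.split h) k (arrayOf I.lower) (fun _ => 0) ∅ σ := by
  have key : ∀ a ∈ (I.split h).arcs, ∃ e : Fin k, ∃ j < 5, a = arc e j ∧
      σ.row a = I.row e j := by
    intro a ha
    obtain ⟨e, j, hj, rfl⟩ := mem_arcs.1 ha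
    exact ⟨e, j, hj, rfl, hσ.row e e.2 j hj⟩
  constructor
  case hub => exact hσ.hub
  case edges => exact hσ.edges
  case size => exact hσ.size
  case zero => exact hσ.zero
  case one => exact hσ.one
  case rzero => exact hσ.rzero
  case tl =>
    intro a ha
    obtain ⟨e, j, hj, rfl, hr⟩ := key a ha
    rw [split_tl h e hj]
    exact congrArg Row.tl hr
  case hd =>
    intro a ha
    obtain ⟨e, j, hj, rfl, hr⟩ := key a ha
    rw [split_hd h e hj]
    exact congrArg Row.hd hr
  case outR =>
    intro a ha
    obtain ⟨e, j, hj, rfl, hr⟩ := key a ha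
    rw [split_outR h e hj]
    exact congrArg Row.outR hr
  case inR =>
    intro a ha
    obtain ⟨e, j, hj, rfl, hr⟩ := key a ha
    rw [split_inR h e hj]
    exact congrArg Row.inR hr
  case excess =>
    intro a ha
    obtain ⟨e, j, hj, rfl, hr⟩ := key a ha
    simp only [split_excess h e hj]
    exact congrArg Row.excess hr
  case rejected =>
    intro a _
    simp [hσ.rejected]
  case lower => exact hσ.lower
  case cap =>
    intro a ha
    obtain ⟨e, j, hj, rfl, hr⟩ := key a ha
    refine (congrArg Row.cap hr).trans ?_
    rw [ArcNet.dcap, split_excess_pred h e hj, split_cap h e hj]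
    simp [Network.row]
  case flow =>
    intro a _
    simp [hσ.flow]

end Network

/-! ## Reading off the flow -/

/-- Checks whether the circulation is accepted at the edge held in register `5`, and computes the
flow of the edge. Sets register `11` to `0` if it is not. -/
def mergeEdge : Program :=
  .seq (ops [.realLoad 1 1 5, .natSucc 6, .realLoad 2 4 6])
  (.seq (.branch (.realLt 2 1) (.op (.natCopy 11 3)) .skip)
  (.seq (ops [.natSucc 6, .realLoad 3 4 6])
  (.seq (.branch (.realLt 3 1) (.op (.natCopy 11 3)) .skip)
  (.seq (ops [.natSucc 6, .realLoad 3 4 6, .realAdd 2 2 3, .natSucc 6, .realLoad 3 4 6])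
  (.seq (.branch (.realLt 0 3) (.op (.natCopy 11 3)) .skip)
  (.seq (ops [.natSucc 6, .realLoad 3 4 6])
  (.seq (.branch (.realLt 0 3) (.op (.natCopy 11 3)) .skip)
  -- The result overwrites the edge capacities in real array `0`, which are no longer needed.
  (ops [.realStore 0 5 2, .natSucc 5]))))))))

namespace Network

variable {n k : ℕ} {I : Network n k}

/-- The memory after the flow of the first `i` edges has been computed. -/
structure MergeData (I : Network n k) (f : ℕ → ℝ) (i : ℕ) (σ : Store) : Prop where
  edges : σ.natReg 1 = k
  zero : σ.natReg 3 = 0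
  rzero : σ.realReg 0 = 0
  lower : σ.realArr 1 = arrayOf I.lower
  flow : ∀ e : Fin k, ∀ j < 5, σ.realArr 4 (arc e j) = f (arc e j)
  counter : σ.natReg 5 = i
  arcCounter : σ.natReg 6 = 5 * i
  merged : ∀ e : Fin k, (e : ℕ) < i → σ.realArr 0 e = merge f e
  accepted : (σ.natReg 11 = 1 ∧ ∀ e : Fin k, (e : ℕ) < i → I.AcceptedAt f e) ∨
    (σ.natReg 11 = 0 ∧ ∃ e, ¬ I.AcceptedAt f e)

variable {f : ℕ → ℝ}

open Classical in
lemma eval_mergeEdge {i : ℕ} {σ : Store} (hσ : I.MergeData f i σ) (hi : i < k) :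
    (mergeEdge.eval σ).natReg 5 = i + 1 ∧ (mergeEdge.eval σ).natReg 6 = 5 * (i + 1) ∧
    (mergeEdge.eval σ).realArr 0 = Function.update (σ.realArr 0) i (merge f ⟨i, hi⟩) ∧
    (mergeEdge.eval σ).natReg 11 = if I.AcceptedAt f ⟨i, hi⟩ then σ.natReg 11 else 0 := by
  have hf := hσ.flow ⟨i, hi⟩
  have f0 := hf 0 (by omega)
  have f1 := hf 1 (by omega)
  have f2 := hf 2 (by omega)
  have f3 := hf 3 (by omega)
  have f4 := hf 4 (by omega)
  have hl : arrayOf I.lower i = I.lower ⟨i, hi⟩ := arrayOf_apply I.lower ⟨i, hi⟩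
  unfold merge AcceptedAt
  simp only [← not_lt]
  generalize f (arc ⟨i, hi⟩ 0) = x0 at *
  generalize f (arc ⟨i, hi⟩ 1) = x1 at *
  generalize f (arc ⟨i, hi⟩ 2) = x2 at *
  generalize f (arc ⟨i, hi⟩ 3) = x3 at *
  generalize f (arc ⟨i, hi⟩ 4) = x4 at *
  generalize I.lower ⟨i, hi⟩ = l at *
  simp only [arc, add_zero, Nat.add_assoc, Nat.reduceAdd] at f0 f1 f2 f3 f4
  by_cases h0 : x0 < l <;> by_cases h1 : x1 < l <;> by_cases h3 : 0 < x3 <;> by_cases h4 : 0 < x4 <;>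
    simp [mergeEdge, ops, Program.eval, Op.apply, Test.Holds, hσ.counter, hσ.arcCounter, hσ.zero,
      hσ.rzero, hσ.lower, f0, f1, f2, f3, f4, h0, h1, h3, h4, hl, Nat.add_assoc, Nat.mul_add]

lemma MergeData.eval {i : ℕ} {σ : Store} (hσ : I.MergeData f i σ) (hi : i < k) :
    I.MergeData f (i + 1) (mergeEdge.eval σ) := by
  obtain ⟨h5, h6, h0, h11⟩ := eval_mergeEdge hσ hi
  have hF := eval_frame (p := mergeEdge) rfl σ
  have cases_lt : ∀ e : Fin k, (e : ℕ) < i + 1 → (e : ℕ) < i ∨ e = ⟨i, hi⟩ := fun e he =>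
    (Nat.lt_succ_iff_lt_or_eq.1 he).imp_right Fin.ext
  constructor
  case edges => rw [hF.natReg 1 (by decide), hσ.edges]
  case zero => rw [hF.natReg 3 (by decide), hσ.zero]
  case rzero => rw [hF.realReg 0 (by decide), hσ.rzero]
  case lower => rw [hF.realArr 1 (by decide), hσ.lower]
  case flow => rw [hF.realArr 4 (by decide)]; exact hσ.flow
  case counter => exact h5
  case arcCounter => exact h6
  case merged =>
    intro e he
    rw [h0]
    rcases cases_lt e he with he' | rfl
    · rw [Function.update_of_ne he'.ne, hσ.merged e he']
    · exact Function.update_self _ _ _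
  case accepted =>
    rw [h11]
    split_ifs with hA
    · refine hσ.accepted.imp_left fun ⟨h1, h2⟩ => ⟨h1, fun e he => ?_⟩
      rcases cases_lt e he with he' | rfl
      exacts [h2 e he', hA]
    · exact Or.inr ⟨rfl, _, hA⟩

lemma runs_merge {σ : Store} (hσ : I.MergeData f 0 σ) :
    Runs (.loop (.natLt 5 1) mergeEdge) σ (k * 30 + 1) (I.MergeData f k) :=
  Runs.loop (c := 29) k (I.MergeData f)
    (fun i hi τ hτ => ⟨by simp only [Test.Holds, hτ.counter, hτ.edges, hi],
      (runs_of_loopFree (p := mergeEdge) rfl τ).mono (by decide)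
        fun υ hυ => by subst hυ; exact hτ.eval hi⟩)
    (fun τ hτ => by simp [Test.Holds, hτ.counter, hτ.edges]) hσ

lemma mergeData_zero (h : ∀ e, I.lower e ≤ I.ub e) {R : Set ℕ} {σ : Store}
    (hσ : Data (I.split h) k (arrayOf I.lower) f R σ) :
    I.MergeData f 0 ((ops [.natCopy 5 3, .natCopy 6 3, .natCopy 11 4]).eval σ) where
  edges := hσ.edges
  zero := hσ.zero
  rzero := hσ.rzero
  lower := hσ.lower
  flow := fun e _ hj => hσ.flow _ (arc_mem e hj)
  counter := hσ.zero
  arcCounter := hσ.zero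
  merged := fun _ he => absurd he (Nat.not_lt_zero _)
  accepted := Or.inl ⟨hσ.one, fun _ he => absurd he (Nat.not_lt_zero _)⟩

end Network

/-! ## The algorithm -/

/-- Computes a final circulation in the arc network and reads off the answer. -/
def solveSplit : Program :=
  .seq (.op (.natCopy 11 4)) (.seq (.loop (.natEq 11 4) phase)
    (.seq (ops [.natCopy 5 3, .natCopy 6 3, .natCopy 11 4])
      (.seq (.loop (.natLt 5 1) mergeEdge) (.op (.natCopy 0 11)))))

/-- The algorithm. -/
def solve : Program :=
  .seq (.op (.natConst 4 1)) (.seq (.loop (.natLt 5 1) splitEdge)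
    (.branch (.natEq 12 3) solveSplit (.op (.natCopy 0 3))))

namespace Network

variable {n k : ℕ} {I : Network n k}

/-- The result is correct. -/
def Solved (I : Network n k) (σ : Store) : Prop :=
  (σ.answer = 1 ∧ I.IsRestrictedStableFlow (σ.flow k)) ∨
    (σ.answer = 0 ∧ ¬ ∃ f : Fin k → ℝ, I.IsRestrictedStableFlow f)

lemma runs_solveSplit (h : ∀ e, I.lower e ≤ I.ub e) {σ : Store}
    (hσ : Data (I.split h) k (arrayOf I.lower) (fun _ => 0) ∅ σ) :
    Runs solveSplit σ ((3 * (5 * k) + 1) * (5 * k * 93 + 48) + k * 30 + 10) I.Solved := by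
  have h1 := runs_of_loopFree (p := .op (.natCopy 11 4)) rfl σ
  refine (h1.seq (B' := (3 * (5 * k) + 1) * (5 * k * 93 + 48) + 1 + (3 + (k * 30 + 1 + 1)))
    fun τ hτ => ?_).mono (by simp only [cost]; omega) fun _ h => h
  subst hτ
  refine (runs_main (hσ.eval (p := .op (.natCopy 11 4)) rfl (by decide)) valid_zero hσ.one).seq ?_
  rintro τ ⟨f, R, hd, hF⟩
  refine (runs_of_loopFree rfl τ).seq fun υ hυ => ?_
  subst hυ
  refine (runs_merge (mergeData_zero h hd)).seq fun υ hυ => ?_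
  refine (runs_of_loopFree (p := .op (.natCopy 0 11)) rfl υ).mono le_rfl fun ω hω => ?_
  subst hω
  rcases hυ.accepted with ⟨ha, hA⟩ | ⟨ha, e, he⟩
  · refine Or.inl ⟨ha, ?_⟩
    have hflow : ((Program.op (.natCopy 0 11)).eval υ).flow k = merge f :=
      funext fun e => hυ.merged e e.2
    rw [hflow]
    exact isRestrictedStableFlow_merge h hF.inv (fun e => hA e e.2) hF.out
  · refine Or.inr ⟨ha, ?_⟩
    -- The final state is compatible with every witness, so one edge that is not accepted refutes
    -- every `g`.
    rintro ⟨g, hg⟩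
    exact he (accepted_of_exists h hF.inv hg (hF.compat (witness_lift h hg)) hF.out hF.excess e)

lemma runs_solve (I : Network n k) :
    Runs solve I.input ((3 * (5 * k) + 1) * (5 * k * 93 + 48) + k * 90 + 13) I.Solved := by
  refine ((runs_of_loopFree (p := .op (.natConst 4 1)) rfl I.input).seq
    (B' := k * 60 + 1 + ((3 * (5 * k) + 1) * (5 * k * 93 + 48) + k * 30 + 10 + 1))
    fun τ hτ => ?_).mono (by simp only [cost]; omega) fun _ h => h
  subst hτ
  refine (runs_split splitData_zero).seq fun τ hτ => ?_
  refine Runs.branch (fun hb => ?_) fun hb => ?_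
  · simp only [Test.Holds, hτ.zero] at hb
    rcases hτ.bounds with ⟨-, h⟩ | ⟨h1, -⟩
    · exact runs_solveSplit (fun e => h e e.2) (hτ.data fun e => h e e.2)
    · omega
  · simp only [Test.Holds, hτ.zero] at hb
    refine (runs_of_loopFree (p := .op (.natCopy 0 3)) rfl τ).mono
      (by simp only [cost]; omega) fun υ hυ => ?_
    subst hυ
    refine Or.inr ⟨hτ.zero, ?_⟩
    rintro ⟨g, hg⟩
    -- A solution would satisfy `lower e ≤ g e ≤ ub e`, contrary to the contradiction found between
    -- the bounds.
    rcases hτ.bounds with ⟨h1, -⟩ | ⟨-, e, he⟩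
    · exact hb h1
    · exact he.not_ge ((hg.2.1 e).trans (le_ub hg e))

end Network

/-- The running time is `O(m²)` already, so a positive lower bound on the logarithm suffices. -/
lemma half_le_log {x : ℝ} (hx : 2 ≤ x) : 1 / 2 ≤ Real.log x := by
  have h1 : Real.log 2 ≤ Real.log x := Real.log_le_log (by norm_num) hx
  have h2 := Real.log_two_gt_d9
  linarith

end StableFlow

end

/-- There is one program that, on every stable flow instance with `n` vertices, `m` edges and forced
and forbidden edges, halts within `O(m² log n)` steps, having found a stable flow that respects all
bounds or reporting correctly that there is none. (The maxima matter only for `m = 0` or `n ≤ 1`.) -/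
theorem mainTheorem1 :
    ∃ (p : StableFlow.Program) (C : ℝ), ∀ (n m : ℕ) (I : StableFlow.Network n m),
      ∃ t : ℕ, StableFlow.Solves p I t ∧
        (t : ℝ) ≤ C * (max (m : ℝ) 1) ^ 2 * Real.log (max (n : ℝ) 2) := by
  -- The step bound is `6975 m² + 1275 m + 61`, hence at most `10000 M²` with `M = max m 1`;
  -- doubling the constant makes up for a logarithm of at least `1 / 2`.
  refine ⟨StableFlow.solve, 20000, fun n m I => ?_⟩
  obtain ⟨t, σ, h1, h2, h3⟩ := StableFlow.Network.runs_solve I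
  refine ⟨t, ⟨σ, h1, h3⟩, ?_⟩
  have hlog := StableFlow.half_le_log (le_max_right (n : ℝ) 2)
  have hm : (m : ℝ) ≤ max (m : ℝ) 1 := le_max_left _ _
  have hone : 1 ≤ max (m : ℝ) 1 := le_max_right _ _
  have h0 : (0 : ℝ) ≤ m := m.cast_nonneg
  generalize max (m : ℝ) 1 = M at *
  have h4 : (t : ℝ) ≤ (3 * (5 * m) + 1) * (5 * m * 93 + 48) + m * 90 + 13 := by exact_mod_cast h2
  have h5 : (3 * (5 * m) + 1) * (5 * m * 93 + 48) + m * 90 + 13 ≤ 10000 * M ^ 2 := by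
    have h6 : (m : ℝ) ^ 2 ≤ M ^ 2 := pow_le_pow_left₀ h0 hm 2
    have h7 : M ≤ M ^ 2 := by nlinarith
    nlinarith
  have h8 : 10000 * M ^ 2 ≤ 20000 * M ^ 2 * Real.log (max (n : ℝ) 2) := by
    have := mul_le_mul_of_nonneg_left hlog (by positivity : 0 ≤ 20000 * M ^ 2)
    linarith
  linarith
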